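/- **Theorem.** Consider a real system $$\dot x=p(x,y)=a_{00}+a_{10}x+a_{01}y+a_{20}x^2+2a_{11}xy+a_{02}y^2,\qquad \dot y=q(x,y)=b_{00}+b_{10}x+b_{01}y+b_{20}x^2+2b_{11}xy+b_{02}y^2,$$ denoted $(S)$, with coefficient vector $a=(a_{00},\dots,b_{02})\in\mathbb R^{12}$. Let $p_i,q_i$ be the homogeneous parts of degree $i$ of $p,q$, and let $P(X,Y,Z)=Z^2p(X/Z,Y/Z)$, $Q(X,Y,Z)=Z^2q(X/Z,Y/Z)$, $C=YP-XQ$. Call $(S)$ *essentially quadratic* if $\gcd(P,Q)=1$ and $Z\nmid C$. For such a system let $I_w(F,G)$ be the intersection number at $w\in\mathbb P^2(\mathbb C)$ of the curves $F=0$ and $G=0$, and, with $w$ running over the points of the complex line $Z=0$, put $$D_S(P,Q;Z)=\sum_w I_w(P,Q)\,w,\qquad D_S(C,Z)=\sum_w I_w(C,Z)\,w,\qquad D_S=\sum_w\binom{I_w(P,Q)}{I_w(C,Z)}w,$$ $$\Delta_S=\deg D_S(P,Q;Z)=\sum_w I_w(P,Q),\qquad M_C=\max_w I_w(C,Z).$$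 *Comitants.* With derivatives taken in $\mathbb R[a,x,y]$, let $C_i=yp_i-xq_i$, $M=2\,\mathrm{Hess}(C_2)$ (the Hessian determinant being $\mathrm{Hess}(f)=f_{xx}f_{yy}-f_{xy}^2$), $\eta=\mathrm{Discrim}(C_2)$ (the discriminant of the binary cubic form $C_2$), $K=\mathrm{Jacob}(p_2,q_2)$, $H=-\mathrm{Discrim}(\alpha p_2+\beta q_2)|_{\alpha=y,\,\beta=-x}$ (the discriminant $B^2-4AE$ of the binary quadratic form $Ax^2+Bxy+Ey^2$, with $\alpha,\beta$ treated as constants), $L=4K+8H-M$, $K_1=p_1q_2-p_2q_1$, $\mu_0=\mathrm{Res}_x(p_2,q_2)/y^4$, $\kappa=(M,K)^{(2)}$, $\kappa_1=(M,C_1)^{(2)}$, where $(f,g)^{(2)}=f_{xx}g_{yy}-2f_{xy}g_{xy}+f_{yy}g_{xx}$. Let $\mathcal L=x\,\mathbf L_2-y\,\mathbf L_1$ with $$\mathbf L_1=2a_{00}\tfrac{\partial}{\partial a_{10}}+a_{10}\tfrac{\partial}{\partial a_{20}}+\tfrac12a_{01}\tfrac{\partial}{\partial a_{11}}+2b_{00}\tfrac{\partial}{\partial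 b_{10}}+b_{10}\tfrac{\partial}{\partial b_{20}}+\tfrac12b_{01}\tfrac{\partial}{\partial b_{11}},$$ $$\mathbf L_2=2a_{00}\tfrac{\partial}{\partial a_{01}}+a_{01}\tfrac{\partial}{\partial a_{02}}+\tfrac12a_{10}\tfrac{\partial}{\partial a_{11}}+2b_{00}\tfrac{\partial}{\partial b_{01}}+b_{01}\tfrac{\partial}{\partial b_{02}}+\tfrac12b_{10}\tfrac{\partial}{\partial b_{11}},$$ and $\mu_i=\frac1{i!}\mathcal L^{i}(\mu_0)$ for $i=1,\dots,4$. All these are evaluated at the coefficients of $(S)$, and $U=0$ means that $U$ vanishes identically in $x,y$. *Conditions.* $(\mathcal I_1)$: $\eta>0$; $(\mathcal I_2)$: $\eta<0$; $(\mathcal I_3)$: $\eta=0$ and $M\neq0$; $(\mathcal I_4)$: $M=0$. $(E_m)$, $0\le m\le4$: $\mu_i=0$ for all $i<m$, and $\mu_m\ne0$. *Table.* Here $p,q,r$ denote real points, $q^c,r^c$ complex non-real points of the line $Z=0$, and different letters in a row denote different points. $$\begin{array}{c|c|c|l|l} \text{class}&\Delta_S&M_C&D_S&\text{conditions}\\\hline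 \Sigma_{1} & 0 & 1 & \binom{0}{1}p+\binom{0}{1}q+\binom{0}{1}r & E_0,\ \mathcal I_1 \\ \Sigma_{2} & 0 & 1 & \binom{0}{1}p+\binom{0}{1}q^c+\binom{0}{1}r^c & E_0,\ \mathcal I_2 \\ \Sigma_{3} & 0 & 2 & \binom{0}{1}p+\binom{0}{2}q & E_0,\ \mathcal I_3 \\ \Sigma_{4} & 0 & 3 & \binom{0}{3}p & E_0,\ \mathcal I_4 \\ \Sigma_{5} & 1 & 1 & \binom{1}{1}p+\binom{0}{1}q+\binom{0}{1}r & E_1,\ \mathcal I_1 \\ \Sigma_{6} & 1 & 1 & \binom{1}{1}p+\binom{0}{1}q^c+\binom{0}{1}r^c & E_1,\ \mathcal I_2 \\ \Sigma_{7} & 1 & 2 & \binom{1}{1}p+\binom{0}{2}q & E_1,\ \kappa\ne0,\ \mathcal I_3 \\ \Sigma_{8} & 1 & 2 & \binom{0}{1}p+\binom{1}{2}q & E_1,\ \kappa=0,\ \mathcal I_3 \\ \Sigma_{9} & 1 & 3 & \binom{1}{3}p & E_1,\ \mathcal I_4 \\ \Sigma_{10} & 2 & 1 & \binom{2}{1}p+\binom{0}{1}q+\binom{0}{1}r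 & E_2,\ \kappa\ne0,\ \mathcal I_1 \\ \Sigma_{11} & 2 & 1 & \binom{1}{1}p+\binom{1}{1}q+\binom{0}{1}r & E_2,\ \kappa=0,\ \mathcal I_1 \\ \Sigma_{12} & 2 & 1 & \binom{2}{1}p+\binom{0}{1}q^c+\binom{0}{1}r^c & E_2,\ \kappa\ne0,\ \mathcal I_2 \\ \Sigma_{13} & 2 & 1 & \binom{0}{1}p+\binom{1}{1}q^c+\binom{1}{1}r^c & E_2,\ \kappa=0,\ \mathcal I_2 \\ \Sigma_{14} & 2 & 2 & \binom{2}{1}p+\binom{0}{2}q & E_2,\ \kappa\ne0,\ \mathcal I_3 \\ \Sigma_{15} & 2 & 2 & \binom{1}{1}p+\binom{1}{2}q & E_2,\ \kappa=0,\ L=0,\ \mathcal I_3 \\ \Sigma_{16} & 2 & 2 & \binom{0}{1}p+\binom{2}{2}q & E_2,\ \kappa=0,\ L\ne0,\ \mathcal I_3 \\ \Sigma_{17} & 2 & 3 & \binom{2}{3}p & E_2,\ \mathcal I_4 \\ \Sigma_{18} & 3 & 1 & \binom{3}{1}p+\binom{0}{1}q+\binom{0}{1}r & E_3,\ \kappa\ne0,\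 \mathcal I_1 \\ \Sigma_{19} & 3 & 1 & \binom{2}{1}p+\binom{1}{1}q+\binom{0}{1}r & E_3,\ \kappa=0,\ \mathcal I_1 \\ \Sigma_{20} & 3 & 1 & \binom{3}{1}p+\binom{0}{1}q^c+\binom{0}{1}r^c & E_3,\ \mathcal I_2 \\ \Sigma_{21} & 3 & 2 & \binom{3}{1}p+\binom{0}{2}q & E_3,\ \kappa\ne0,\ \mathcal I_3 \\ \Sigma_{22} & 3 & 2 & \binom{2}{1}p+\binom{1}{2}q & E_3,\ \kappa=0,\ L=0,\ \kappa_1\ne0,\ \mathcal I_3 \\ \Sigma_{23} & 3 & 2 & \binom{1}{1}p+\binom{2}{2}q & E_3,\ \kappa=0,\ L=0,\ \kappa_1=0,\ \mathcal I_3 \\ \Sigma_{24} & 3 & 2 & \binom{0}{1}p+\binom{3}{2}q & E_3,\ \kappa=0,\ L\ne0,\ \mathcal I_3 \\ \Sigma_{25} & 3 & 3 & \binom{3}{3}p & E_3,\ \mathcal I_4 \\ \Sigma_{26} & 4 & 1 & \binom{4}{1}p+\binom{0}{1}q+\binom{0}{1}r & E_4,\ \kappa\ne0,\ \mathcal I_1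 \\ \Sigma_{27} & 4 & 1 & \binom{3}{1}p+\binom{1}{1}q+\binom{0}{1}r & E_4,\ \kappa=0,\ K_1\ne0,\ \mathcal I_1 \\ \Sigma_{28} & 4 & 1 & \binom{2}{1}p+\binom{2}{1}q+\binom{0}{1}r & E_4,\ \kappa=0,\ K_1=0,\ \mathcal I_1 \\ \Sigma_{29} & 4 & 1 & \binom{4}{1}p+\binom{0}{1}q^c+\binom{0}{1}r^c & E_4,\ \kappa\ne0,\ \mathcal I_2 \\ \Sigma_{30} & 4 & 1 & \binom{0}{1}p+\binom{2}{1}q^c+\binom{2}{1}r^c & E_4,\ \kappa=0,\ \mathcal I_2 \\ \Sigma_{31} & 4 & 2 & \binom{4}{1}p+\binom{0}{2}q & E_4,\ \kappa\ne0,\ \mathcal I_3 \\ \Sigma_{32} & 4 & 2 & \binom{3}{1}p+\binom{1}{2}q & E_4,\ \kappa=0,\ L=0,\ \kappa_1\ne0,\ \mathcal I_3 \\ \Sigma_{33} & 4 & 2 & \binom{2}{1}p+\binom{2}{2}q & E_4,\ \kappa=0,\ L=0,\ \kappa_1=0,\ K_1=0,\ \mathcal I_3 \\ \Sigma_{34}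 & 4 & 2 & \binom{1}{1}p+\binom{3}{2}q & E_4,\ \kappa=0,\ L=0,\ \kappa_1=0,\ K_1\ne0,\ \mathcal I_3 \\ \Sigma_{35} & 4 & 2 & \binom{0}{1}p+\binom{4}{2}q & E_4,\ \kappa=0,\ L\ne0,\ \mathcal I_3 \\ \Sigma_{36} & 4 & 3 & \binom{4}{3}p & E_4,\ \mathcal I_4 \\ \end{array}$$ Let $\Sigma_i$ be the class of the essentially quadratic systems whose $\Delta_S$, $M_C$ and $D_S$ are as in row $i$ (for some choice of the points of $Z=0$). Then the table lists all the possibilities for $(\Delta_S,M_C,D_S)$ and only these: every essentially quadratic system belongs to exactly one of the classes $\Sigma_1,\dots,\Sigma_{36}$, and none of these classes is empty. Moreover, an essentially quadratic system belongs to $\Sigma_i$ if and only if it satisfies the conditions in the last column of row $i$. -/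

import Mathlib

open scoped LinearAlgebra.Projectivization

noncomputable section

namespace QuadInf

/-! ### Intersection numbers of projective plane curves -/

/-- The ideal of the origin in the coordinate ring of the complex affine plane. -/
def originIdeal : Ideal (MvPolynomial (Fin 2) ℂ) :=
  RingHom.ker (MvPolynomial.constantCoeff : MvPolynomial (Fin 2) ℂ →+* ℂ)

instance originIdeal_isPrime : originIdeal.IsPrime :=
  RingHom.ker_isPrime _

/-- The local ring of the complex affine plane at the origin. -/
abbrev LocalRingAtOrigin : Type := Localization.AtPrime originIdeal

/-- The intersection number of `f = 0` and `g = 0` at the origin of the affine plane: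
the dimension over `ℂ` of the local ring at the origin modulo `(f, g)`. -/
def affineIntersectionNumber (f g : MvPolynomial (Fin 2) ℂ) : ℕ∞ :=
  Cardinal.toENat (Module.rank ℂ
    (LocalRingAtOrigin ⧸ Ideal.span
      ({algebraMap (MvPolynomial (Fin 2) ℂ) LocalRingAtOrigin f,
        algebraMap (MvPolynomial (Fin 2) ℂ) LocalRingAtOrigin g} : Set LocalRingAtOrigin)))

/-- The points of the complex projective plane, `[X : Y : Z]`. -/
abbrev Plane : Type := ℙ ℂ (Fin 3 → ℂ)

/-- The index of the first nonzero homogeneous coordinate of `w`. -/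
def chartIndex (w : Plane) : Fin 3 :=
  if w.rep 0 ≠ 0 then 0 else if w.rep 1 ≠ 0 then 1 else 2

/-- The polynomial `F` in the affine chart in which the coordinate number `chartIndex w` is `1`,
with the origin translated to the point `w`. -/
def localEquation (F : MvPolynomial (Fin 3) ℂ) (w : Plane) : MvPolynomial (Fin 2) ℂ :=
  MvPolynomial.aeval
    ((chartIndex w).insertNth (α := fun _ => MvPolynomial (Fin 2) ℂ) 1
      (fun k => MvPolynomial.X k +
        MvPolynomial.C (w.rep ((chartIndex w).succAbove k) / w.rep (chartIndex w)))) F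

/-- The intersection number `I_w(F, G)` of the projective curves `F = 0` and `G = 0` at `w`. -/
def intersectionNumber (F G : MvPolynomial (Fin 3) ℂ) (w : Plane) : ℕ∞ :=
  affineIntersectionNumber (localEquation F w) (localEquation G w)

/-- The complex line at infinity `Z = 0`. -/
abbrev LineAtInfinity : Type := {w : Plane // w.rep 2 = 0}

/-- A point of the line at infinity is real if it has real homogeneous coordinates. -/
def IsRealPoint (w : LineAtInfinity) : Prop :=
  ∃ (v : Fin 3 → ℝ) (hv : (fun i => (v i : ℂ)) ≠ 0),
    (w : Plane) = Projectivization.mk ℂ (fun i => (v i : ℂ)) hv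

/-! ### Quadratic systems and their divisors at infinity -/

/-- Names of the twelve coefficients of a quadratic system
`dx/dt = a00 + a10 x + a01 y + a20 x² + 2 a11 x y + a02 y²`,
`dy/dt = b00 + b10 x + b01 y + b20 x² + 2 b11 x y + b02 y²`. -/
inductive Coef : Type
  | a00 | a10 | a01 | a20 | a11 | a02
  | b00 | b10 | b01 | b20 | b11 | b02

/-- A real system, given by its twelve coefficients. -/
abbrev QSystem : Type := Coef → ℝ

section Curves

open MvPolynomial

/-- The homogenization of degree two of
`c00 + c10 x + c01 y + c20 x² + 2 c11 x y + c02 y²`. -/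
def homogenized (c00 c10 c01 c20 c11 c02 : ℝ) : MvPolynomial (Fin 3) ℂ :=
  C (c00 : ℂ) * X 2 ^ 2 + C (c10 : ℂ) * X 0 * X 2 + C (c01 : ℂ) * X 1 * X 2
    + C (c20 : ℂ) * X 0 ^ 2 + C (2 * c11 : ℂ) * X 0 * X 1 + C (c02 : ℂ) * X 1 ^ 2

/-- `P(X, Y, Z) = Z² p(X/Z, Y/Z)`. -/
def curveP (S : QSystem) : MvPolynomial (Fin 3) ℂ :=
  homogenized (S .a00) (S .a10) (S .a01) (S .a20) (S .a11) (S .a02)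

/-- `Q(X, Y, Z) = Z² q(X/Z, Y/Z)`. -/
def curveQ (S : QSystem) : MvPolynomial (Fin 3) ℂ :=
  homogenized (S .b00) (S .b10) (S .b01) (S .b20) (S .b11) (S .b02)

/-- `C = Y P - X Q`. -/
def curveC (S : QSystem) : MvPolynomial (Fin 3) ℂ :=
  X 1 * curveP S - X 0 * curveQ S

/-- Essentially quadratic systems: `gcd(P, Q) = 1` and `Z ∤ C`. The second condition forces the
quadratic parts of `p` and `q` not to vanish both. -/
def IsEssentiallyQuadratic (S : QSystem) : Prop :=
  IsRelPrime (curveP S) (curveQ S) ∧ ¬ (X 2 : MvPolynomial (Fin 3) ℂ) ∣ curveC S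

/-- The divisor `D_S(P, Q; Z)`, as its coefficient function `w ↦ I_w(P, Q)`. -/
def divisorPQ (S : QSystem) (w : LineAtInfinity) : ℕ∞ :=
  intersectionNumber (curveP S) (curveQ S) w

/-- The divisor `D_S(C, Z)`, as its coefficient function `w ↦ I_w(C, Z)`. -/
def divisorCZ (S : QSystem) (w : LineAtInfinity) : ℕ∞ :=
  intersectionNumber (curveC S) (X 2) w

/-- The divisor `D_S`, with the two multiplicities `I_w(P, Q)` and `I_w(C, Z)` as coefficient. -/
def divisorD (S : QSystem) (w : LineAtInfinity) : ℕ∞ × ℕ∞ :=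
  (divisorPQ S w, divisorCZ S w)

/-- `Δ_S = deg D_S(P, Q; Z)`. -/
def degPQ (S : QSystem) : ℕ∞ := ∑ᶠ w, divisorPQ S w

/-- `M_C`, the largest coefficient of `D_S(C, Z)` (off the support the coefficients are `0`). -/
def maxMultC (S : QSystem) : ℕ∞ := ⨆ w, divisorCZ S w

end Curves

/-! ### Invariants and comitants -/

section Comitants

open MvPolynomial

/-- The ring `ℝ[a, x, y]` of polynomials in the twelve coefficients and in `x`, `y`. -/
abbrev PolyRing : Type := MvPolynomial (Coef ⊕ Fin 2) ℝ

/-- The coefficient `c` as an indeterminate. -/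
def co (c : Coef) : PolyRing := X (Sum.inl c)

/-- The indeterminate `x`. -/
def vx : PolyRing := X (Sum.inr 0)

/-- The indeterminate `y`. -/
def vy : PolyRing := X (Sum.inr 1)

/-- `∂U/∂c` for a coefficient `c`. -/
def dco (c : Coef) (U : PolyRing) : PolyRing := pderiv (Sum.inl c) U

/-- `∂U/∂x`. -/
def dx (U : PolyRing) : PolyRing := pderiv (Sum.inr 0) U

/-- `∂U/∂y`. -/
def dy (U : PolyRing) : PolyRing := pderiv (Sum.inr 1) U

/-- `p₁(x, y)`. -/
def p1 : PolyRing := co .a10 * vx + co .a01 * vy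

/-- `q₁(x, y)`. -/
def q1 : PolyRing := co .b10 * vx + co .b01 * vy

/-- `p₂(x, y)`. -/
def p2 : PolyRing := co .a20 * vx ^ 2 + 2 * co .a11 * vx * vy + co .a02 * vy ^ 2

/-- `q₂(x, y)`. -/
def q2 : PolyRing := co .b20 * vx ^ 2 + 2 * co .b11 * vx * vy + co .b02 * vy ^ 2

/-- `C₁ = y p₁ - x q₁`. -/
def C1 : PolyRing := vy * p1 - vx * q1

/-- `C₂ = y p₂ - x q₂`. -/
def C2 : PolyRing := vy * p2 - vx * q2

/-- The Jacobian determinant with respect to `x`, `y`. -/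
def jacob (f g : PolyRing) : PolyRing := dx f * dy g - dy f * dx g

/-- The Hessian determinant with respect to `x`, `y`. -/
def hess (f : PolyRing) : PolyRing := dx (dx f) * dy (dy f) - dx (dy f) ^ 2

/-- The transvectant of index two, `(f, g)⁽²⁾`. -/
def transvectant2 (f g : PolyRing) : PolyRing :=
  dx (dx f) * dy (dy g) - 2 * dx (dy f) * dx (dy g) + dy (dy f) * dx (dx g)

/-- `M = 2 Hess(C₂)`. -/
def M : PolyRing := 2 * hess C2

/-- `η = Discrim(C₂)`, the discriminant of the binary cubic form
`C₂ = -b20 x³ + (a20 - 2 b11) x² y + (2 a11 - b02) x y² + a02 y³`. -/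
def eta : PolyRing :=
  Cubic.discr (⟨-co .b20, co .a20 - 2 * co .b11, 2 * co .a11 - co .b02, co .a02⟩ : Cubic PolyRing)

/-- `K = Jacob(p₂, q₂)`. -/
def K : PolyRing := jacob p2 q2

/-- `H`: minus the discriminant of the binary quadratic form `α p₂ + β q₂`, evaluated at
`α = y`, `β = -x`. -/
def H : PolyRing :=
  -discrim (vy * co .a20 - vx * co .b20) (vy * (2 * co .a11) - vx * (2 * co .b11))
    (vy * co .a02 - vx * co .b02)

/-- `L = 4 K + 8 H - M`. -/
def L : PolyRing := 4 * K + 8 * H - M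

/-- `K₁ = p₁ q₂ - p₂ q₁`. -/
def K1 : PolyRing := p1 * q2 - p2 * q1

/-- `κ = (M, K)⁽²⁾`. -/
def kappa : PolyRing := transvectant2 M K

/-- `κ₁ = (M, C₁)⁽²⁾`. -/
def kappa1 : PolyRing := transvectant2 M C1

/-- `μ₀ = Res_x(p₂, q₂) / y⁴`, that is, the resultant of the quadratic polynomials `p₂(x, 1)`
and `q₂(x, 1)`. -/
def mu0 : PolyRing :=
  Polynomial.resultant
    (Polynomial.C (co .a20) * Polynomial.X ^ 2 + Polynomial.C (2 * co .a11) * Polynomial.X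
      + Polynomial.C (co .a02))
    (Polynomial.C (co .b20) * Polynomial.X ^ 2 + Polynomial.C (2 * co .b11) * Polynomial.X
      + Polynomial.C (co .b02)) 2 2

/-- The differential operator `𝐋₁`. -/
def opL1 (U : PolyRing) : PolyRing :=
  2 * co .a00 * dco .a10 U + co .a10 * dco .a20 U + C (1 / 2) * co .a01 * dco .a11 U
    + 2 * co .b00 * dco .b10 U + co .b10 * dco .b20 U + C (1 / 2) * co .b01 * dco .b11 U

/-- The differential operator `𝐋₂`. -/
def opL2 (U : PolyRing) : PolyRing :=
  2 * co .a00 * dco .a01 U + co .a01 * dco .a02 U + C (1 / 2) * co .a10 * dco .a11 U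
    + 2 * co .b00 * dco .b01 U + co .b01 * dco .b02 U + C (1 / 2) * co .b10 * dco .b11 U

/-- The differential operator `𝓛 = x 𝐋₂ - y 𝐋₁`. -/
def opL (U : PolyRing) : PolyRing := vx * opL2 U - vy * opL1 U

/-- `μ_i = 𝓛⁽ⁱ⁾(μ₀) / i!`. -/
def mu (i : ℕ) : PolyRing := C (1 / (i.factorial : ℝ)) * opL^[i] mu0

/-- The value `U(a, x, y)` at the coefficients `a` of the system `S`. -/
def value (S : QSystem) (U : PolyRing) (x y : ℝ) : ℝ := eval (Sum.elim S ![x, y]) U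

/-- `U = 0` for the system `S`, as a polynomial in `x`, `y`. -/
def Vanishes (S : QSystem) (U : PolyRing) : Prop := ∀ x y : ℝ, value S U x y = 0

end Comitants

/-! ### The conditions on the comitants and the classification table -/

/-- `η > 0` (the invariant `η` does not involve `x`, `y`). -/
def CondI1 (S : QSystem) : Prop := 0 < value S eta 0 0

/-- `η < 0`. -/
def CondI2 (S : QSystem) : Prop := value S eta 0 0 < 0

/-- `η = 0`, `M ≠ 0`. -/
def CondI3 (S : QSystem) : Prop := value S eta 0 0 = 0 ∧ ¬ Vanishes S M

/-- `M = 0`. -/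
def CondI4 (S : QSystem) : Prop := Vanishes S M

/-- `μ₀ = ⋯ = μ_{m-1} = 0` and `μ_m ≠ 0`. -/
def FirstMu (S : QSystem) (m : ℕ) : Prop :=
  (∀ i < m, Vanishes S (mu i)) ∧ ¬ Vanishes S (mu m)

/-- Functions on the line at infinity with values in pairs, among them the divisors `D_S`. -/
abbrev PairDivisor : Type := LineAtInfinity → ℕ∞ × ℕ∞

/-- `D = s p` with a real point `p`. -/
def One (s : ℕ∞ × ℕ∞) (D : PairDivisor) : Prop :=
  ∃ p : LineAtInfinity, IsRealPoint p ∧ D = ⇑(Finsupp.single p s)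

/-- `D = s p + t q` with distinct real points `p`, `q`. -/
def Two (s t : ℕ∞ × ℕ∞) (D : PairDivisor) : Prop :=
  ∃ p q : LineAtInfinity, IsRealPoint p ∧ IsRealPoint q ∧ p ≠ q ∧
    D = ⇑(Finsupp.single p s + Finsupp.single q t)

/-- `D = s p + t q + u r` with distinct real points `p`, `q`, `r`. -/
def Three (s t u : ℕ∞ × ℕ∞) (D : PairDivisor) : Prop :=
  ∃ p q r : LineAtInfinity, IsRealPoint p ∧ IsRealPoint q ∧ IsRealPoint r ∧
    p ≠ q ∧ p ≠ r ∧ q ≠ r ∧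
    D = ⇑(Finsupp.single p s + Finsupp.single q t + Finsupp.single r u)

/-- `D = s p + t qᶜ + u rᶜ` with distinct points `p`, `qᶜ`, `rᶜ`, of which `p` is real while
`qᶜ` and `rᶜ` are not. -/
def ThreeC (s t u : ℕ∞ × ℕ∞) (D : PairDivisor) : Prop :=
  ∃ p q r : LineAtInfinity, IsRealPoint p ∧ ¬ IsRealPoint q ∧ ¬ IsRealPoint r ∧
    p ≠ q ∧ p ≠ r ∧ q ≠ r ∧
    D = ⇑(Finsupp.single p s + Finsupp.single q t + Finsupp.single r u)

/-- A row of the classification table: the values of `Δ_S` and `M_C`, the form of `D_S`, and the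
conditions on the comitants. -/
structure Row where
  /-- the value of `Δ_S` -/
  deg : ℕ∞
  /-- the value of `M_C` -/
  maxC : ℕ∞
  /-- the form of `D_S` -/
  form : PairDivisor → Prop
  /-- the conditions on the comitants -/
  cond : QSystem → Prop

/-- The classification table; the entry with index `i` describes the class `Σ_{i+1}`. -/
def table : Fin 36 → Row := ![
  -- `Δ_S = 0`
  ⟨0, 1, Three (0, 1) (0, 1) (0, 1), fun S => FirstMu S 0 ∧ CondI1 S⟩,
  ⟨0, 1, ThreeC (0, 1) (0, 1) (0, 1), fun S => FirstMu S 0 ∧ CondI2 S⟩,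
  ⟨0, 2, Two (0, 1) (0, 2), fun S => FirstMu S 0 ∧ CondI3 S⟩,
  ⟨0, 3, One (0, 3), fun S => FirstMu S 0 ∧ CondI4 S⟩,
  -- `Δ_S = 1`
  ⟨1, 1, Three (1, 1) (0, 1) (0, 1), fun S => FirstMu S 1 ∧ CondI1 S⟩,
  ⟨1, 1, ThreeC (1, 1) (0, 1) (0, 1), fun S => FirstMu S 1 ∧ CondI2 S⟩,
  ⟨1, 2, Two (1, 1) (0, 2), fun S => FirstMu S 1 ∧ ¬ Vanishes S kappa ∧ CondI3 S⟩,
  ⟨1, 2, Two (0, 1) (1, 2), fun S => FirstMu S 1 ∧ Vanishes S kappa ∧ CondI3 S⟩,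
  ⟨1, 3, One (1, 3), fun S => FirstMu S 1 ∧ CondI4 S⟩,
  -- `Δ_S = 2`
  ⟨2, 1, Three (2, 1) (0, 1) (0, 1), fun S => FirstMu S 2 ∧ ¬ Vanishes S kappa ∧ CondI1 S⟩,
  ⟨2, 1, Three (1, 1) (1, 1) (0, 1), fun S => FirstMu S 2 ∧ Vanishes S kappa ∧ CondI1 S⟩,
  ⟨2, 1, ThreeC (2, 1) (0, 1) (0, 1), fun S => FirstMu S 2 ∧ ¬ Vanishes S kappa ∧ CondI2 S⟩,
  ⟨2, 1, ThreeC (0, 1) (1, 1) (1, 1), fun S => FirstMu S 2 ∧ Vanishes S kappa ∧ CondI2 S⟩,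
  ⟨2, 2, Two (2, 1) (0, 2), fun S => FirstMu S 2 ∧ ¬ Vanishes S kappa ∧ CondI3 S⟩,
  ⟨2, 2, Two (1, 1) (1, 2),
    fun S => FirstMu S 2 ∧ Vanishes S kappa ∧ Vanishes S L ∧ CondI3 S⟩,
  ⟨2, 2, Two (0, 1) (2, 2),
    fun S => FirstMu S 2 ∧ Vanishes S kappa ∧ ¬ Vanishes S L ∧ CondI3 S⟩,
  ⟨2, 3, One (2, 3), fun S => FirstMu S 2 ∧ CondI4 S⟩,
  -- `Δ_S = 3`
  ⟨3, 1, Three (3, 1) (0, 1) (0, 1), fun S => FirstMu S 3 ∧ ¬ Vanishes S kappa ∧ CondI1 S⟩,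
  ⟨3, 1, Three (2, 1) (1, 1) (0, 1), fun S => FirstMu S 3 ∧ Vanishes S kappa ∧ CondI1 S⟩,
  ⟨3, 1, ThreeC (3, 1) (0, 1) (0, 1), fun S => FirstMu S 3 ∧ CondI2 S⟩,
  ⟨3, 2, Two (3, 1) (0, 2), fun S => FirstMu S 3 ∧ ¬ Vanishes S kappa ∧ CondI3 S⟩,
  ⟨3, 2, Two (2, 1) (1, 2), fun S => FirstMu S 3 ∧ Vanishes S kappa ∧ Vanishes S L ∧
    ¬ Vanishes S kappa1 ∧ CondI3 S⟩,
  ⟨3, 2, Two (1, 1) (2, 2), fun S => FirstMu S 3 ∧ Vanishes S kappa ∧ Vanishes S L ∧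
    Vanishes S kappa1 ∧ CondI3 S⟩,
  ⟨3, 2, Two (0, 1) (3, 2),
    fun S => FirstMu S 3 ∧ Vanishes S kappa ∧ ¬ Vanishes S L ∧ CondI3 S⟩,
  ⟨3, 3, One (3, 3), fun S => FirstMu S 3 ∧ CondI4 S⟩,
  -- `Δ_S = 4`
  ⟨4, 1, Three (4, 1) (0, 1) (0, 1), fun S => FirstMu S 4 ∧ ¬ Vanishes S kappa ∧ CondI1 S⟩,
  ⟨4, 1, Three (3, 1) (1, 1) (0, 1),
    fun S => FirstMu S 4 ∧ Vanishes S kappa ∧ ¬ Vanishes S K1 ∧ CondI1 S⟩,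
  ⟨4, 1, Three (2, 1) (2, 1) (0, 1),
    fun S => FirstMu S 4 ∧ Vanishes S kappa ∧ Vanishes S K1 ∧ CondI1 S⟩,
  ⟨4, 1, ThreeC (4, 1) (0, 1) (0, 1), fun S => FirstMu S 4 ∧ ¬ Vanishes S kappa ∧ CondI2 S⟩,
  ⟨4, 1, ThreeC (0, 1) (2, 1) (2, 1), fun S => FirstMu S 4 ∧ Vanishes S kappa ∧ CondI2 S⟩,
  ⟨4, 2, Two (4, 1) (0, 2), fun S => FirstMu S 4 ∧ ¬ Vanishes S kappa ∧ CondI3 S⟩,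
  ⟨4, 2, Two (3, 1) (1, 2), fun S => FirstMu S 4 ∧ Vanishes S kappa ∧ Vanishes S L ∧
    ¬ Vanishes S kappa1 ∧ CondI3 S⟩,
  ⟨4, 2, Two (2, 1) (2, 2), fun S => FirstMu S 4 ∧ Vanishes S kappa ∧ Vanishes S L ∧
    Vanishes S kappa1 ∧ Vanishes S K1 ∧ CondI3 S⟩,
  ⟨4, 2, Two (1, 1) (3, 2), fun S => FirstMu S 4 ∧ Vanishes S kappa ∧ Vanishes S L ∧
    Vanishes S kappa1 ∧ ¬ Vanishes S K1 ∧ CondI3 S⟩,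
  ⟨4, 2, Two (0, 1) (4, 2),
    fun S => FirstMu S 4 ∧ Vanishes S kappa ∧ ¬ Vanishes S L ∧ CondI3 S⟩,
  ⟨4, 3, One (4, 3), fun S => FirstMu S 4 ∧ CondI4 S⟩]

/-- The class of the essentially quadratic systems whose triple `(Δ_S, M_C, D_S)` is the one of
the row `i` of the table. -/
def sigmaClass (i : Fin 36) : Set QSystem :=
  {S | IsEssentiallyQuadratic S ∧ degPQ S = (table i).deg ∧ maxMultC S = (table i).maxC ∧
    (table i).form (divisorD S)}

end QuadInf

end

/-! Everything takes place on the line Z = 0, where two mechanisms turn intersection data into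
comitants.

Total multiplicity. The operator 𝓛 generates the substitution Z ↦ Z + t (x Y - y X), so μ_i is the
coefficient of t^i in the resultant of P and Q restricted to the line Z = t (x Y - y X)
(`valueC_mu`). If [X_j : Y_j : Z_j] are the common points of P and Q, this resultant is up to a
constant the product of the factors Z_j - t (x Y_j - y X_j). For general x, y its order at t = 0
therefore counts the common points at infinity with multiplicity. The code obtains this equality by
computing the order (`HasOrder`) and the local intersection number side by side in normal forms.
Both are unchanged under invertible combinations of P, Q and under linear changes of X, Y, and
intersection numbers are additive when one curve splits into lines
(`affineIntersectionNumber_linear_mul`).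

Distribution. Suppose p₂ and q₂ have a common zero. (i) If they are not proportional, the common
zero w is unique and real, and carries the whole multiplicity; a combination of P and Q has
quadratic parts s u and u² there (`exists_order_of_simple_normal`). Then κ = 0 exactly when w is a
multiple zero of C₂ (`structure_of_not_proportional`). (ii) If p₂ = a g and q₂ = b g, then b P - a Q
is Z times a line, the zeros of C₂ are the two zeros of g and the real point [a : b], and κ = 0. How
much each zero of g carries depends on whether the linear form b p₁ - a q₁ vanishes there
(`exists_order_of_proportional_normal`, `structure_of_proportional`). The sign of the discriminant η
and the Hessian M give the type of C₂. When κ = 0 and C₂ has exactly one double zero, L tells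
whether the simple zero carries multiplicity, κ₁ tests b p₁ - a q₁ at the double zero when L = 0,
and K₁ tests whether this form is identically zero.

Logic. `exists_row` provides, for every essentially quadratic system, one row of which both the
conditions and the divisor data hold. The conditions of distinct rows are incompatible
(`eq_of_fits`) and so are the divisor data (`eq_of_mem_sigmaClass`); existence, uniqueness and the
equivalence follow formally. For nonemptiness it suffices to check conditions on explicit systems
with Z ∤ C, since a nonzero μ_m already forces P and Q to be relatively prime
(`isRelPrime_of_hasOrder`). -/

noncomputable section

namespace QuadInf

section

/-! ### Computation of intersection numbers in the local ring -/

section Rank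

variable {k B : Type*} [Field k] [CommRing B] [Algebra k B]

/-- Additivity of the length of `B / (f, g)` in the second argument. -/
theorem rank_quotient_span_pair_mul (f l h : B) (hl : ∀ y, f ∣ l * y → f ∣ y) :
    Module.rank k (B ⧸ Ideal.span {f, l * h}) =
      Module.rank k (B ⧸ Ideal.span {f, l}) + Module.rank k (B ⧸ Ideal.span {f, h}) := by
  have hle : Ideal.span {f, l * h} ≤ Ideal.span {f, l} := by
    rw [Ideal.span_le]
    rintro x (rfl | rfl)
    · exact Ideal.subset_span (by simp)
    · exact Ideal.mul_mem_right _ _ (Ideal.subset_span (by simp))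
  have hle' : Ideal.span {f, h} ≤
      Submodule.comap (LinearMap.mulLeft B l) (Ideal.span {f, l * h}) := by
    rw [Ideal.span_le]
    rintro x (rfl | rfl)
    · exact Ideal.mul_mem_left _ _ (Ideal.subset_span (by simp))
    · exact Ideal.subset_span (by simp)
  -- The sequence 0 → B/(f, h) → B/(f, l h) → B/(f, l) → 0, whose first map is multiplication by l,
  -- is exact; `hl` is what makes that map injective.
  let π : (B ⧸ Ideal.span {f, l * h}) →ₗ[k] (B ⧸ Ideal.span {f, l}) :=
    (Submodule.mapQ (Ideal.span {f, l * h}) (Ideal.span {f, l}) LinearMap.id hle).restrictScalars k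
  let φ : (B ⧸ Ideal.span {f, h}) →ₗ[k] (B ⧸ Ideal.span {f, l * h}) :=
    (Submodule.mapQ (Ideal.span {f, h}) (Ideal.span {f, l * h}) (LinearMap.mulLeft B l)
      hle').restrictScalars k
  have hπ : Function.Surjective π := by
    intro x
    obtain ⟨x, rfl⟩ := Submodule.Quotient.mk_surjective _ x
    exact ⟨Submodule.Quotient.mk x, rfl⟩
  have hφ : Function.Injective φ := by
    rw [← LinearMap.ker_eq_bot, LinearMap.ker_eq_bot']
    intro x hx
    obtain ⟨x, rfl⟩ := Submodule.Quotient.mk_surjective _ x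
    have h1 : l * x ∈ Ideal.span {f, l * h} := (Submodule.Quotient.mk_eq_zero _).1 hx
    obtain ⟨a, b, hab⟩ := Ideal.mem_span_pair.1 h1
    obtain ⟨c, hc⟩ := hl (x - b * h) ⟨a, by linear_combination -hab⟩
    refine (Submodule.Quotient.mk_eq_zero _).2 (Ideal.mem_span_pair.2 ⟨c, b, ?_⟩)
    linear_combination -hc
  have hrange : LinearMap.range φ = LinearMap.ker π := by
    ext x
    obtain ⟨x, rfl⟩ := Submodule.Quotient.mk_surjective _ x
    constructor
    · rintro ⟨y, hy⟩
      obtain ⟨y, rfl⟩ := Submodule.Quotient.mk_surjective _ y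
      rw [← hy]
      exact (Submodule.Quotient.mk_eq_zero _).2
        (Ideal.mul_mem_right _ _ (Ideal.subset_span (by simp)))
    · intro hx
      have hx' : x ∈ Ideal.span {f, l} := (Submodule.Quotient.mk_eq_zero _).1 hx
      obtain ⟨a, b, hab⟩ := Ideal.mem_span_pair.1 hx'
      refine ⟨Submodule.Quotient.mk b, ?_⟩
      refine (Submodule.Quotient.eq _).2 (Ideal.mem_span_pair.2 ⟨-a, 0, ?_⟩)
      simp only [LinearMap.mulLeft_apply]
      linear_combination -hab
  rw [← LinearMap.rank_range_add_rank_ker π, ← hrange, rank_range_of_injective φ hφ,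
    rank_range_of_surjective π hπ]

end Rank

open MvPolynomial

/-- The structure map from the affine plane to its local ring at the origin. -/
abbrev toLocal : MvPolynomial (Fin 2) ℂ →+* LocalRingAtOrigin :=
  algebraMap (MvPolynomial (Fin 2) ℂ) LocalRingAtOrigin

theorem mem_originIdeal {f : MvPolynomial (Fin 2) ℂ} :
    f ∈ originIdeal ↔ constantCoeff f = 0 := RingHom.mem_ker

theorem isUnit_toLocal {f : MvPolynomial (Fin 2) ℂ} (h : constantCoeff f ≠ 0) :
    IsUnit (toLocal f) :=
  (IsLocalization.AtPrime.isUnit_to_map_iff LocalRingAtOrigin originIdeal f).2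
    (fun h' => h (mem_originIdeal.1 h'))

theorem toLocal_injective : Function.Injective toLocal :=
  IsLocalization.injective _ originIdeal.primeCompl_le_nonZeroDivisors

theorem affineIntersectionNumber_eq_of_span {f g f' g' : MvPolynomial (Fin 2) ℂ}
    (h : Ideal.span {toLocal f, toLocal g} = Ideal.span {toLocal f', toLocal g'}) :
    affineIntersectionNumber f g = affineIntersectionNumber f' g' := by
  unfold affineIntersectionNumber
  rw [show Ideal.span {algebraMap (MvPolynomial (Fin 2) ℂ) LocalRingAtOrigin f,
        algebraMap (MvPolynomial (Fin 2) ℂ) LocalRingAtOrigin g} = _ from h]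

/-- Cramer's rule: the adjugate matrix times the inverse e of the determinant recovers f and g. -/
theorem span_pair_eq_of_linear {A : Type*} [CommRing A] {f g f' g' a b c d : A}
    (hf : f' = a * f + b * g) (hg : g' = c * f + d * g) (hu : IsUnit (a * d - b * c)) :
    Ideal.span {f, g} = Ideal.span {f', g'} := by
  obtain ⟨e, he⟩ := hu.exists_right_inv
  apply le_antisymm
  · rw [Ideal.span_le]
    rintro x (rfl | rfl)
    · exact Ideal.mem_span_pair.2 ⟨e * d, - e * b, by rw [hf, hg]; linear_combination x * he⟩
    · exact Ideal.mem_span_pair.2 ⟨- e * c, e * a, by rw [hf, hg]; linear_combination x * he⟩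
  · rw [Ideal.span_le]
    rintro x (rfl | rfl)
    · exact Ideal.mem_span_pair.2 ⟨a, b, hf.symm⟩
    · exact Ideal.mem_span_pair.2 ⟨c, d, hg.symm⟩

/-- Invariance of the intersection number under invertible combinations of the equations. -/
theorem affineIntersectionNumber_eq_of_linear {f g f' g' a b c d : MvPolynomial (Fin 2) ℂ}
    (hf : f' = a * f + b * g) (hg : g' = c * f + d * g)
    (hu : constantCoeff (a * d - b * c) ≠ 0) :
    affineIntersectionNumber f g = affineIntersectionNumber f' g' := by
  apply affineIntersectionNumber_eq_of_span
  apply span_pair_eq_of_linear (a := toLocal a) (b := toLocal b) (c := toLocal c) (d := toLocal d)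
  · rw [hf]; simp
  · rw [hg]; simp
  · simpa using isUnit_toLocal hu

theorem affineIntersectionNumber_comm (f g : MvPolynomial (Fin 2) ℂ) :
    affineIntersectionNumber f g = affineIntersectionNumber g f :=
  affineIntersectionNumber_eq_of_linear (a := 0) (b := 1) (c := 1) (d := 0)
    (by ring) (by ring) (by simp)

theorem affineIntersectionNumber_add_mul (f g h : MvPolynomial (Fin 2) ℂ) :
    affineIntersectionNumber f g = affineIntersectionNumber (f + h * g) g :=
  affineIntersectionNumber_eq_of_linear (a := 1) (b := h) (c := 0) (d := 1)
    (by ring) (by ring) (by simp)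

theorem affineIntersectionNumber_eq_zero {f g : MvPolynomial (Fin 2) ℂ}
    (h : constantCoeff g ≠ 0) : affineIntersectionNumber f g = 0 := by
  unfold affineIntersectionNumber
  have htop : Ideal.span {algebraMap (MvPolynomial (Fin 2) ℂ) LocalRingAtOrigin f,
      algebraMap (MvPolynomial (Fin 2) ℂ) LocalRingAtOrigin g} = ⊤ :=
    Ideal.eq_top_of_isUnit_mem _ (Ideal.subset_span (by simp)) (isUnit_toLocal h)
  rw [htop]
  have : Subsingleton (LocalRingAtOrigin ⧸ (⊤ : Ideal LocalRingAtOrigin)) :=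
    Ideal.Quotient.subsingleton_iff.2 rfl
  rw [rank_subsingleton']
  simp

theorem affineIntersectionNumber_eq_zero_left {f g : MvPolynomial (Fin 2) ℂ}
    (h : constantCoeff f ≠ 0) : affineIntersectionNumber f g = 0 := by
  rw [affineIntersectionNumber_comm, affineIntersectionNumber_eq_zero h]

theorem affineIntersectionNumber_unit_mul {f l h : MvPolynomial (Fin 2) ℂ}
    (hl : constantCoeff l ≠ 0) :
    affineIntersectionNumber f (l * h) = affineIntersectionNumber f h :=
  (affineIntersectionNumber_eq_of_linear (a := 1) (b := 0) (c := 0) (d := l)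
    (by ring) (by ring) (by simpa using hl)).symm

theorem originIdeal_eq_span : originIdeal = Ideal.span {X 0, X 1} := by
  have h : (({X 0, X 1} : Set (MvPolynomial (Fin 2) ℂ))) = X '' Set.univ := by
    ext x
    simp [Fin.exists_fin_two, eq_comm]
  rw [h]
  ext f
  rw [mem_originIdeal, mem_ideal_span_X_image]
  constructor
  · intro hf m hm
    by_contra! hcon
    have : m = 0 := by
      ext i
      simpa using hcon i
    rw [this, mem_support_iff] at hm
    exact hm hf
  · intro hf
    by_contra hcon
    obtain ⟨i, -, hi⟩ := hf 0 (mem_support_iff.2 hcon)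
    exact hi rfl

/-- The two coordinates generate the maximal ideal, and the quotient is the residue field ℂ: a
fraction f/s is congruent to the constant f(0)/s(0). -/
theorem affineIntersectionNumber_X_X : affineIntersectionNumber (X 0) (X 1) = 1 := by
  unfold affineIntersectionNumber
  set I : Ideal LocalRingAtOrigin := Ideal.span
    {algebraMap (MvPolynomial (Fin 2) ℂ) LocalRingAtOrigin (X 0),
      algebraMap (MvPolynomial (Fin 2) ℂ) LocalRingAtOrigin (X 1)} with hI
  have hImap : I = originIdeal.map toLocal := by
    refine Eq.trans ?_ (congrArg (Ideal.map toLocal) originIdeal_eq_span).symm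
    rw [Ideal.map_span, Set.image_pair]
  have hIne : I ≠ ⊤ := by
    rw [hImap]
    exact (IsLocalization.AtPrime.map_eq_maximalIdeal originIdeal LocalRingAtOrigin) ▸
      (IsLocalRing.maximalIdeal.isMaximal LocalRingAtOrigin).ne_top
  have : Nontrivial (LocalRingAtOrigin ⧸ I) := Ideal.Quotient.nontrivial_iff.2 hIne
  have hsurj : Function.Surjective (Algebra.linearMap ℂ (LocalRingAtOrigin ⧸ I)) := by
    intro x
    obtain ⟨x, rfl⟩ := Ideal.Quotient.mk_surjective x
    obtain ⟨f, s, rfl⟩ := IsLocalization.exists_mk'_eq originIdeal.primeCompl x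
    have hs : constantCoeff (s : MvPolynomial (Fin 2) ℂ) ≠ 0 :=
      fun h => s.2 (mem_originIdeal.2 h)
    set c : ℂ := constantCoeff f / constantCoeff (s : MvPolynomial (Fin 2) ℂ) with hc
    refine ⟨c, ?_⟩
    have hmem : f - C c * (s : MvPolynomial (Fin 2) ℂ) ∈ originIdeal := by
      rw [mem_originIdeal]
      simp [hc, div_mul_cancel₀ _ hs]
    have hmem' : toLocal (f - C c * (s : MvPolynomial (Fin 2) ℂ)) ∈ I := hImap ▸ Ideal.mem_map_of_mem _ hmem
    have hu : IsUnit (toLocal (s : MvPolynomial (Fin 2) ℂ)) := isUnit_toLocal hs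
    have hCc : toLocal (C c) = algebraMap ℂ LocalRingAtOrigin c := by
      rw [IsScalarTower.algebraMap_apply ℂ (MvPolynomial (Fin 2) ℂ) LocalRingAtOrigin]
      rfl
    change Ideal.Quotient.mk I (algebraMap ℂ LocalRingAtOrigin c) = _
    rw [eq_comm, Ideal.Quotient.eq, ← hCc]
    refine (Ideal.unit_mul_mem_iff_mem I hu).1 ?_
    convert hmem' using 1
    rw [mul_sub, IsLocalization.mk'_spec', map_sub, map_mul, mul_comm (toLocal (C c))]
  have hinj : Function.Injective (Algebra.linearMap ℂ (LocalRingAtOrigin ⧸ I)) :=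
    (algebraMap ℂ (LocalRingAtOrigin ⧸ I)).injective
  rw [← (LinearEquiv.ofBijective _ ⟨hinj, hsurj⟩).rank_eq, Module.rank_self]
  simp

/-- Two curves meeting transversally at the origin. -/
theorem affineIntersectionNumber_eq_one {f g a b c d : MvPolynomial (Fin 2) ℂ}
    (hf : f = a * X 0 + b * X 1) (hg : g = c * X 0 + d * X 1)
    (hu : constantCoeff (a * d - b * c) ≠ 0) : affineIntersectionNumber f g = 1 := by
  rw [← affineIntersectionNumber_eq_of_linear hf hg hu, affineIntersectionNumber_X_X]

/-- Since l vanishes at the origin, so does every multiple of l; the prime ideal (l) thus misses the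
denominators and survives localization. -/
theorem prime_toLocal {l : MvPolynomial (Fin 2) ℂ} (hl : Prime l) (h0 : constantCoeff l = 0) :
    Prime (toLocal l) := by
  have hne : toLocal l ≠ 0 := fun h => hl.ne_zero (toLocal_injective (by rw [h, map_zero]))
  rw [← Ideal.span_singleton_prime hne, ← Set.image_singleton, ← Ideal.map_span]
  refine IsLocalization.isPrime_of_isPrime_disjoint originIdeal.primeCompl _ _
    ((Ideal.span_singleton_prime hl.ne_zero).2 hl) ?_
  rw [Set.disjoint_left]
  rintro s hs hs'
  obtain ⟨t, rfl⟩ := Ideal.mem_span_singleton.1 hs'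
  exact hs (mem_originIdeal.2 (by rw [map_mul, h0, zero_mul]))

theorem not_toLocal_dvd {l f : MvPolynomial (Fin 2) ℂ} (hl : Prime l)
    (h0 : constantCoeff l = 0) (hf : ¬ l ∣ f) : ¬ toLocal l ∣ toLocal f := by
  rintro ⟨x, hx⟩
  obtain ⟨g, s, rfl⟩ := IsLocalization.exists_mk'_eq originIdeal.primeCompl x
  have h1 : toLocal (f * s) = toLocal (l * g) := by
    rw [map_mul, hx, mul_assoc, IsLocalization.mk'_spec, map_mul]
  have h2 : l ∣ f * s := ⟨g, toLocal_injective h1⟩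
  rcases hl.dvd_or_dvd h2 with h | ⟨t, ht⟩
  · exact hf h
  · exact s.2 (mem_originIdeal.2 (by rw [ht, map_mul, h0, zero_mul]))

/-- If l vanishes at the origin, it stays prime in the local ring and still does not divide f; so f
∣ l y forces f ∣ y and `rank_quotient_span_pair_mul` applies. If it does not vanish there, l is a
unit and contributes 0. -/
theorem affineIntersectionNumber_mul_of_prime {f l : MvPolynomial (Fin 2) ℂ} (hl : Prime l)
    (hf : ¬ l ∣ f) (h : MvPolynomial (Fin 2) ℂ) :
    affineIntersectionNumber f (l * h) =
      affineIntersectionNumber f l + affineIntersectionNumber f h := by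
  by_cases h0 : constantCoeff l = 0
  · unfold affineIntersectionNumber
    rw [map_mul, rank_quotient_span_pair_mul, map_add]
    rintro y ⟨a, ha⟩
    have hp := prime_toLocal hl h0
    rcases hp.dvd_or_dvd (⟨y, ha.symm⟩ : toLocal l ∣ toLocal f * a) with h' | ⟨b, rfl⟩
    · exact absurd h' (not_toLocal_dvd hl h0 hf)
    · refine ⟨b, mul_left_cancel₀ hp.ne_zero ?_⟩
      rw [ha]
      ring
  · rw [affineIntersectionNumber_unit_mul h0, affineIntersectionNumber_eq_zero h0, zero_add]

theorem prime_linear {a b : ℂ} (hab : a ≠ 0 ∨ b ≠ 0) :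
    Prime (C a * X 0 + C b * X 1 : MvPolynomial (Fin 2) ℂ) := by
  have hc0 : coeff (Finsupp.single 0 1) (C a * X 0 + C b * X 1 : MvPolynomial (Fin 2) ℂ) = a := by
    simp [coeff_C_mul, coeff_X, Finsupp.single_left_inj]
  have hc1 : coeff (Finsupp.single 1 1) (C a * X 0 + C b * X 1 : MvPolynomial (Fin 2) ℂ) = b := by
    simp [coeff_C_mul, coeff_X, Finsupp.single_left_inj]
  refine (irreducible_of_totalDegree_eq_one (le_antisymm ?_ ?_) ?_).prime
  · refine (totalDegree_add _ _).trans (max_le ?_ ?_) <;>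
      exact (totalDegree_mul _ _).trans (by simp)
  · rcases hab with h | h
    · refine le_trans (by simp) (le_totalDegree (s := Finsupp.single 0 1) ?_)
      rwa [mem_support_iff, hc0]
    · refine le_trans (by simp) (le_totalDegree (s := Finsupp.single 1 1) ?_)
      rwa [mem_support_iff, hc1]
  · intro x hx
    rcases hab with h | h
    · exact isUnit_of_dvd_unit (hc0 ▸ hx _) (isUnit_iff_ne_zero.2 h)
    · exact isUnit_of_dvd_unit (hc1 ▸ hx _) (isUnit_iff_ne_zero.2 h)

/-- Additivity with respect to a line `a u + b z = 0` through the origin, provided that the other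
curve misses some point `(b v, -a v)` of the line. -/
theorem affineIntersectionNumber_linear_mul {a b v : ℂ} (hab : a ≠ 0 ∨ b ≠ 0)
    {f : MvPolynomial (Fin 2) ℂ} (hf : eval ![b * v, -a * v] f ≠ 0)
    (h : MvPolynomial (Fin 2) ℂ) :
    affineIntersectionNumber f ((C a * X 0 + C b * X 1) * h) =
      affineIntersectionNumber f (C a * X 0 + C b * X 1) + affineIntersectionNumber f h := by
  refine affineIntersectionNumber_mul_of_prime (prime_linear hab) ?_ h
  rintro ⟨g, rfl⟩
  apply hf
  simp
  left
  ring

end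

section

open MvPolynomial

/-! ### Complex conics and their intersections near a point at infinity -/

/-- The conic `xx X² + xy X Y + yy Y² + xz X Z + yz Y Z + zz Z²`. -/
@[ext]
structure Conic where
  /-- the coefficient of `Z²` -/
  zz : ℂ
  /-- the coefficient of `X Z` -/
  xz : ℂ
  /-- the coefficient of `Y Z` -/
  yz : ℂ
  /-- the coefficient of `X²` -/
  xx : ℂ
  /-- the coefficient of `X Y` -/
  xy : ℂ
  /-- the coefficient of `Y²` -/
  yy : ℂ

namespace Conic

/-- The equation of a conic. -/
def poly (P : Conic) : MvPolynomial (Fin 3) ℂ :=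
  C P.zz * X 2 ^ 2 + C P.xz * X 0 * X 2 + C P.yz * X 1 * X 2
    + C P.xx * X 0 ^ 2 + C P.xy * X 0 * X 1 + C P.yy * X 1 ^ 2

/-- The equation of a conic in the affine chart around `[1 : 0 : 0]`. -/
def loc (P : Conic) : MvPolynomial (Fin 2) ℂ :=
  C P.xx + C P.xy * X 0 + C P.yy * X 0 ^ 2 + C P.xz * X 1 + C P.yz * X 0 * X 1
    + C P.zz * X 1 ^ 2

/-- A member of the pencil spanned by two conics. -/
def comb (a b : ℂ) (P Q : Conic) : Conic :=
  ⟨a * P.zz + b * Q.zz, a * P.xz + b * Q.xz, a * P.yz + b * Q.yz, a * P.xx + b * Q.xx,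
    a * P.xy + b * Q.xy, a * P.yy + b * Q.yy⟩

/-- The linear change of coordinates `X = x₀ s + e₁ u`, `Y = y₀ s + e₂ u`. -/
def subst (x₀ y₀ e₁ e₂ : ℂ) (P : Conic) : Conic :=
  ⟨P.zz, P.xz * x₀ + P.yz * y₀, P.xz * e₁ + P.yz * e₂,
    P.xx * x₀ ^ 2 + P.xy * x₀ * y₀ + P.yy * y₀ ^ 2,
    2 * P.xx * x₀ * e₁ + P.xy * (x₀ * e₂ + y₀ * e₁) + 2 * P.yy * y₀ * e₂,
    P.xx * e₁ ^ 2 + P.xy * e₁ * e₂ + P.yy * e₂ ^ 2⟩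

/-- The quadratic part `xx X² + xy X Y + yy Y²`. -/
def quad (P : Conic) (x y : ℂ) : ℂ := P.xx * x ^ 2 + P.xy * x * y + P.yy * y ^ 2

/-- The linear part `xz X + yz Y`. -/
def lin (P : Conic) (x y : ℂ) : ℂ := P.xz * x + P.yz * y

end Conic

open Conic

/-- The resultant of the binary quadratic forms `a X² + b X Y + e Y²` and
`a' X² + b' X Y + e' Y²`. -/
def quadRes {R : Type*} [CommRing R] (a b e a' b' e' : R) : R :=
  (a * e' - a' * e) ^ 2 - (a * b' - a' * b) * (b * e' - b' * e)

/-! ### The resultant on the lines Z = t (x Y - y X) and its invariance. -/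

section Phi

open Polynomial

/-- The coefficient of `X²` of the restriction of a conic to `Z = t (x Y - y X)`. -/
def restrA (P : Conic) (_x y : ℂ) : Polynomial ℂ :=
  Polynomial.C P.xx + Polynomial.C (-y * P.xz) * Polynomial.X
    + Polynomial.C (y ^ 2 * P.zz) * Polynomial.X ^ 2

/-- The coefficient of `X Y` of the restriction of a conic to `Z = t (x Y - y X)`. -/
def restrB (P : Conic) (x y : ℂ) : Polynomial ℂ :=
  Polynomial.C P.xy + Polynomial.C (x * P.xz - y * P.yz) * Polynomial.X
    + Polynomial.C (-2 * x * y * P.zz) * Polynomial.X ^ 2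

/-- The coefficient of `Y²` of the restriction of a conic to `Z = t (x Y - y X)`. -/
def restrE (P : Conic) (x _y : ℂ) : Polynomial ℂ :=
  Polynomial.C P.yy + Polynomial.C (x * P.yz) * Polynomial.X
    + Polynomial.C (x ^ 2 * P.zz) * Polynomial.X ^ 2

/-- The resultant of the restrictions of two conics to the line `Z = t (x Y - y X)`, as a
polynomial in `t`. -/
def lineRes (P Q : Conic) (x y : ℂ) : Polynomial ℂ :=
  quadRes (restrA P x y) (restrB P x y) (restrE P x y)
    (restrA Q x y) (restrB Q x y) (restrE Q x y)

/-- The first `m` coefficients of `lineRes` vanish identically, and the next one does not. -/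
def HasOrder (P Q : Conic) (m : ℕ) : Prop :=
  (∀ i < m, ∀ x y, (lineRes P Q x y).coeff i = 0) ∧ ∃ x y, (lineRes P Q x y).coeff m ≠ 0

theorem HasOrder.unique {P Q : Conic} {m n : ℕ} (hm : HasOrder P Q m) (hn : HasOrder P Q n) :
    m = n := by
  obtain ⟨h1, x, y, h2⟩ := hm
  obtain ⟨h3, x', y', h4⟩ := hn
  rcases lt_trichotomy m n with h | h | h
  · exact absurd (h3 m h x y) h2
  · exact h
  · exact absurd (h1 n h x' y') h4

/-- The resultant is quadratic in the 2 × 2 minors of the two rows of coefficients, and each minor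
is multiplied by a d - b c. -/
theorem lineRes_comb (P Q : Conic) (a b c d x y : ℂ) :
    lineRes (comb a b P Q) (comb c d P Q) x y =
      Polynomial.C ((a * d - b * c) ^ 2) * lineRes P Q x y := by
  simp only [lineRes, quadRes, restrA, restrB, restrE, comb, map_add, map_mul, map_neg, map_sub,
    map_pow, map_ofNat]
  ring

theorem HasOrder.comb_iff {P Q : Conic} {a b c d : ℂ} (hD : a * d - b * c ≠ 0) {m : ℕ} :
    HasOrder (comb a b P Q) (comb c d P Q) m ↔ HasOrder P Q m := by
  simp only [HasOrder, lineRes_comb, Polynomial.coeff_C_mul, mul_eq_zero,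
    pow_eq_zero_iff two_ne_zero, hD, false_or, ne_eq]

theorem quadRes_subst {R : Type*} [CommRing R] (a b e a' b' e' x₀ y₀ e₁ e₂ : R) :
    quadRes (a * x₀ ^ 2 + b * x₀ * y₀ + e * y₀ ^ 2)
      (2 * a * x₀ * e₁ + b * (x₀ * e₂ + y₀ * e₁) + 2 * e * y₀ * e₂)
      (a * e₁ ^ 2 + b * e₁ * e₂ + e * e₂ ^ 2)
      (a' * x₀ ^ 2 + b' * x₀ * y₀ + e' * y₀ ^ 2)
      (2 * a' * x₀ * e₁ + b' * (x₀ * e₂ + y₀ * e₁) + 2 * e' * y₀ * e₂)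
      (a' * e₁ ^ 2 + b' * e₁ * e₂ + e' * e₂ ^ 2) =
    (x₀ * e₂ - y₀ * e₁) ^ 4 * quadRes a b e a' b' e' := by
  unfold quadRes
  ring

/-- In the new coordinates s, u the form x' Y - y' X, taken at the image (x', y') of (x, y), equals
D (x u - y s), where D is the determinant. So t is rescaled by D, and the resultant of two binary
quadratic forms by D⁴. -/
theorem lineRes_subst (P Q : Conic) (x₀ y₀ e₁ e₂ x y : ℂ) :
    (lineRes (subst x₀ y₀ e₁ e₂ P) (subst x₀ y₀ e₁ e₂ Q) x y).comp
        (Polynomial.C (x₀ * e₂ - y₀ * e₁) * Polynomial.X) =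
      Polynomial.C ((x₀ * e₂ - y₀ * e₁) ^ 4) *
        lineRes P Q (x₀ * x + e₁ * y) (y₀ * x + e₂ * y) := by
  have hA : ∀ P : Conic, (restrA (subst x₀ y₀ e₁ e₂ P) x y).comp
      (Polynomial.C (x₀ * e₂ - y₀ * e₁) * Polynomial.X) =
      restrA P (x₀ * x + e₁ * y) (y₀ * x + e₂ * y) * Polynomial.C x₀ ^ 2
        + restrB P (x₀ * x + e₁ * y) (y₀ * x + e₂ * y) * Polynomial.C x₀ * Polynomial.C y₀
        + restrE P (x₀ * x + e₁ * y) (y₀ * x + e₂ * y) * Polynomial.C y₀ ^ 2 := by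
    intro P
    simp only [restrA, restrB, restrE, subst, map_add, map_mul, map_neg, map_sub, map_pow,
      map_ofNat, Polynomial.add_comp, Polynomial.mul_comp, Polynomial.neg_comp,
      Polynomial.pow_comp, Polynomial.C_comp, Polynomial.X_comp]
    ring
  have hB : ∀ P : Conic, (restrB (subst x₀ y₀ e₁ e₂ P) x y).comp
      (Polynomial.C (x₀ * e₂ - y₀ * e₁) * Polynomial.X) =
      2 * restrA P (x₀ * x + e₁ * y) (y₀ * x + e₂ * y) * Polynomial.C x₀ * Polynomial.C e₁
        + restrB P (x₀ * x + e₁ * y) (y₀ * x + e₂ * y) *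
          (Polynomial.C x₀ * Polynomial.C e₂ + Polynomial.C y₀ * Polynomial.C e₁)
        + 2 * restrE P (x₀ * x + e₁ * y) (y₀ * x + e₂ * y) * Polynomial.C y₀
          * Polynomial.C e₂ := by
    intro P
    simp only [restrA, restrB, restrE, subst, map_add, map_mul, map_neg, map_sub, map_pow,
      map_ofNat, Polynomial.add_comp, Polynomial.mul_comp, Polynomial.neg_comp, Polynomial.neg_comp,
      Polynomial.sub_comp, Polynomial.pow_comp, Polynomial.C_comp, Polynomial.X_comp,
      Polynomial.ofNat_comp]
    ring
  have hE : ∀ P : Conic, (restrE (subst x₀ y₀ e₁ e₂ P) x y).comp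
      (Polynomial.C (x₀ * e₂ - y₀ * e₁) * Polynomial.X) =
      restrA P (x₀ * x + e₁ * y) (y₀ * x + e₂ * y) * Polynomial.C e₁ ^ 2
        + restrB P (x₀ * x + e₁ * y) (y₀ * x + e₂ * y) * Polynomial.C e₁ * Polynomial.C e₂
        + restrE P (x₀ * x + e₁ * y) (y₀ * x + e₂ * y) * Polynomial.C e₂ ^ 2 := by
    intro P
    simp only [restrA, restrB, restrE, subst, map_add, map_mul, map_neg, map_sub, map_pow,
      map_ofNat, Polynomial.add_comp, Polynomial.mul_comp,
      Polynomial.pow_comp, Polynomial.C_comp, Polynomial.X_comp]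
    ring
  have hcomp : ∀ a b e a' b' e' r : Polynomial ℂ, (quadRes a b e a' b' e').comp r =
      quadRes (a.comp r) (b.comp r) (e.comp r) (a'.comp r) (b'.comp r) (e'.comp r) := by
    intros
    simp only [quadRes, Polynomial.sub_comp, Polynomial.pow_comp, Polynomial.mul_comp]
  rw [lineRes, hcomp, hA, hA, hB, hB, hE, hE, quadRes_subst, lineRes]
  simp only [map_pow, map_sub, map_mul]

theorem HasOrder.subst_iff {P Q : Conic} {x₀ y₀ e₁ e₂ : ℂ} (hD : x₀ * e₂ - y₀ * e₁ ≠ 0) {m : ℕ} :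
    HasOrder (subst x₀ y₀ e₁ e₂ P) (subst x₀ y₀ e₁ e₂ Q) m ↔ HasOrder P Q m := by
  have hc : ∀ i x y,
      (lineRes (subst x₀ y₀ e₁ e₂ P) (subst x₀ y₀ e₁ e₂ Q) x y).coeff i = 0 ↔
        (lineRes P Q (x₀ * x + e₁ * y) (y₀ * x + e₂ * y)).coeff i = 0 := by
    intro i x y
    have h := congrArg (fun p => Polynomial.coeff p i) (lineRes_subst P Q x₀ y₀ e₁ e₂ x y)
    simp only [Polynomial.comp_C_mul_X_coeff, Polynomial.coeff_C_mul] at h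
    constructor
    · intro h0
      rw [h0, zero_mul] at h
      exact (mul_eq_zero.1 h.symm).resolve_left (pow_ne_zero _ hD)
    · intro h0
      rw [h0, mul_zero] at h
      exact (mul_eq_zero.1 h).resolve_right (pow_ne_zero _ hD)
  have hs : ∀ X Y : ℂ, ∃ x y, x₀ * x + e₁ * y = X ∧ y₀ * x + e₂ * y = Y := by
    intro X Y
    refine ⟨(e₂ * X - e₁ * Y) * (x₀ * e₂ - y₀ * e₁)⁻¹,
      (x₀ * Y - y₀ * X) * (x₀ * e₂ - y₀ * e₁)⁻¹, ?_, ?_⟩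
    · linear_combination X * mul_inv_cancel₀ hD
    · linear_combination Y * mul_inv_cancel₀ hD
  constructor
  · rintro ⟨h1, x, y, h2⟩
    refine ⟨fun i hi X Y => ?_, _, _, (hc m x y).not.1 h2⟩
    obtain ⟨x, y, rfl, rfl⟩ := hs X Y
    exact (hc i x y).1 (h1 i hi x y)
  · rintro ⟨h1, X, Y, h2⟩
    obtain ⟨x, y, rfl, rfl⟩ := hs X Y
    exact ⟨fun i hi x y => (hc i x y).2 (h1 i hi _ _), x, y, (hc m x y).not.2 h2⟩

end Phi

/-! ### Local intersection numbers of conics in normal form -/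

section Local

theorem exists_quadratic_ne_zero {e₁ e₂ : ℂ} (h : e₁ ≠ 0 ∨ e₂ ≠ 0) :
    ∃ v, e₁ * v + e₂ * v ^ 2 ≠ 0 := by
  by_contra! hcon
  have h1 := hcon 1
  have h2 := hcon (-1)
  rcases h with h | h
  · exact h (by linear_combination (h1 - h2) / 2)
  · exact h (by linear_combination (h1 + h2) / 2)

theorem constantCoeff_loc (P : Conic) : constantCoeff P.loc = P.xx := by
  simp [loc]

/-- The restriction of a conic to the line `a u + b z = 0`, first coefficient. -/
def restr1 (P : Conic) (a b : ℂ) : ℂ := P.xy * b - P.xz * a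

/-- The restriction of a conic to the line `a u + b z = 0`, second coefficient. -/
def restr2 (P : Conic) (a b : ℂ) : ℂ := P.yy * b ^ 2 - P.yz * a * b + P.zz * a ^ 2

theorem eval_loc (P : Conic) (hP : P.xx = 0) (a b v : ℂ) :
    eval ![b * v, -a * v] P.loc = restr1 P a b * v + restr2 P a b * v ^ 2 := by
  simp [loc, hP, restr1, restr2]
  ring

theorem affineIntersectionNumber_linear_mul' {P : Conic} (hP : P.xx = 0) {a b : ℂ}
    (hab : a ≠ 0 ∨ b ≠ 0) (h12 : restr1 P a b ≠ 0 ∨ restr2 P a b ≠ 0)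
    (h : MvPolynomial (Fin 2) ℂ) :
    affineIntersectionNumber P.loc ((C a * X 0 + C b * X 1) * h) =
      affineIntersectionNumber P.loc (C a * X 0 + C b * X 1)
        + affineIntersectionNumber P.loc h := by
  obtain ⟨v, hv⟩ := exists_quadratic_ne_zero h12
  exact affineIntersectionNumber_linear_mul hab (v := v) (by rwa [eval_loc P hP]) h

theorem affineIntersectionNumber_linear_of_ne {P : Conic} (hP : P.xx = 0) {a b : ℂ}
    (h1 : restr1 P a b ≠ 0) :
    affineIntersectionNumber P.loc (C a * X 0 + C b * X 1) = 1 := by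
  refine affineIntersectionNumber_eq_one (a := C P.xy + C P.yy * X 0)
    (b := C P.xz + C P.yz * X 0 + C P.zz * X 1) (c := C a) (d := C b) ?_ rfl ?_
  · simp only [loc, hP, map_zero]
    ring
  · simpa [restr1] using h1

theorem affineIntersectionNumber_linear_of_eq {P : Conic} (hP : P.xx = 0) {a b : ℂ}
    (hab : a ≠ 0 ∨ b ≠ 0) (h1 : restr1 P a b = 0) (h2 : restr2 P a b ≠ 0) :
    affineIntersectionNumber P.loc (C a * X 0 + C b * X 1) = 2 := by
  unfold restr1 at h1
  unfold restr2 at h2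
  -- Modulo the line, a conic tangent to it reduces to e times the square of a transversal linear
  -- form, u if a = 0 and z otherwise; each factor of the square contributes 1.
  have key : ∀ c d e : ℂ, e ≠ 0 → a * d - b * c ≠ 0 →
      affineIntersectionNumber (C a * X 0 + C b * X 1)
        (C e * ((C c * X 0 + C d * X 1) * (C c * X 0 + C d * X 1))) = 2 := by
    intro c d e he hcd
    have hcd' : c ≠ 0 ∨ d ≠ 0 := by
      by_contra! hcon
      exact hcd (by rw [hcon.1, hcon.2]; ring)
    rw [affineIntersectionNumber_unit_mul (by simpa using he),
      affineIntersectionNumber_linear_mul (v := 1) hcd',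
      affineIntersectionNumber_eq_one (a := C a) (b := C b) (c := C c) (d := C d) rfl rfl
        (by simpa using hcd)]
    · norm_num
    · simp only [map_add, map_mul, eval_C, eval_X]
      simp
      contrapose! hcd
      linear_combination hcd
  rw [affineIntersectionNumber_comm]
  by_cases ha : a = 0
  · subst ha
    have hb : b ≠ 0 := by simpa using hab
    have hxy : P.xy = 0 := by simpa [hb] using h1
    have hyy : P.yy ≠ 0 := by
      rintro h
      simp [h] at h2
    rw [← key 1 0 P.yy hyy (by simpa using hb)]
    refine affineIntersectionNumber_eq_of_linear (a := 1) (b := 0)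
      (c := - C b⁻¹ * (C P.xz + C P.yz * X 0 + C P.zz * X 1)) (d := 1) (by ring) ?_ (by simp)
    have hbb : (C b * C b⁻¹ : MvPolynomial (Fin 2) ℂ) = 1 := by
      rw [← C_mul, mul_inv_cancel₀ hb, C_1]
    simp only [loc, hP, hxy, map_zero, map_one]
    linear_combination (X 1 * (C P.xz + C P.yz * X 0 + C P.zz * X 1)) * hbb
  · have hxz : P.xz = P.xy * b / a := by
      field_simp
      linear_combination -h1
    rw [← key 0 1 ((P.yy * b ^ 2 - P.yz * a * b + P.zz * a ^ 2) / a ^ 2)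
      (div_ne_zero h2 (pow_ne_zero _ ha)) (by simpa using ha)]
    refine affineIntersectionNumber_eq_of_linear (a := 1) (b := 0)
      (c := - (C (P.xy / a) + C (P.yy / a) * X 0 + C ((P.yz * a - P.yy * b) / a ^ 2) * X 1))
      (d := 1) (by ring) ?_ (by simp)
    have haa : ∀ r : ℂ, (C (r / a) * C a : MvPolynomial (Fin 2) ℂ) = C r := by
      intro r
      rw [← C_mul, div_mul_cancel₀ _ ha]
    have e1 : (C ((P.yy * b ^ 2 - P.yz * a * b + P.zz * a ^ 2) / a ^ 2) :
        MvPolynomial (Fin 2) ℂ) = C P.zz - C ((P.yz * a - P.yy * b) / a ^ 2) * C b := by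
      rw [← C_mul, ← C_sub]
      congr 1
      field_simp
      ring
    have e2 : (C ((P.yz * a - P.yy * b) / a ^ 2) * C a : MvPolynomial (Fin 2) ℂ) =
        C P.yz - C (P.yy / a) * C b := by
      rw [← C_mul, ← C_mul, ← C_sub]
      congr 1
      field_simp
    have e3 : (C P.xz : MvPolynomial (Fin 2) ℂ) = C (P.xy / a) * C b := by
      rw [hxz, ← C_mul]
      congr 1
      ring
    simp only [loc, hP, map_zero, map_one, e1, e3]
    linear_combination X 0 * haa P.xy + X 0 ^ 2 * haa P.yy + X 0 * X 1 * e2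

theorem affineIntersectionNumber_one_right (f : MvPolynomial (Fin 2) ℂ) :
    affineIntersectionNumber f 1 = 0 :=
  affineIntersectionNumber_eq_zero (by simp)

end Local

end

section

open MvPolynomial Conic

/-! ### The first coefficients of the restricted resultant -/

/-- The `2 × 2` minors of two sequences of pairs, convolved. -/
def minorConv (p q p' q' : ℕ → ℂ) (n : ℕ) : ℂ :=
  ∑ i ∈ Finset.HasAntidiagonal.antidiagonal n, (p i.1 * q' i.2 - p' i.1 * q i.2)

theorem coeff_quadRes (A B E A' B' E' : Polynomial ℂ) (n : ℕ) :
    (quadRes A B E A' B' E').coeff n = ∑ i ∈ Finset.HasAntidiagonal.antidiagonal n,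
      (minorConv A.coeff E.coeff A'.coeff E'.coeff i.1
          * minorConv A.coeff E.coeff A'.coeff E'.coeff i.2
        - minorConv A.coeff B.coeff A'.coeff B'.coeff i.1
          * minorConv B.coeff E.coeff B'.coeff E'.coeff i.2) := by
  have h : ∀ p q p' q' : Polynomial ℂ, ∀ n,
      (p * q' - p' * q).coeff n = minorConv p.coeff q.coeff p'.coeff q'.coeff n := by
    intro p q p' q' n
    rw [Polynomial.coeff_sub, Polynomial.coeff_mul, Polynomial.coeff_mul, minorConv,
      Finset.sum_sub_distrib]
  rw [quadRes, sq, Polynomial.coeff_sub, Polynomial.coeff_mul, Polynomial.coeff_mul,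
    ← Finset.sum_sub_distrib]
  simp only [h]

theorem coeff_quadratic (a b c : ℂ) (n : ℕ) :
    (Polynomial.C a + Polynomial.C b * Polynomial.X + Polynomial.C c * Polynomial.X ^ 2).coeff n =
      if n = 0 then a else if n = 1 then b else if n = 2 then c else 0 := by
  rcases n with _ | _ | _ | n <;>
    simp [Polynomial.coeff_X, Polynomial.coeff_C, Polynomial.coeff_X_pow]

theorem HasOrder.of_coeff {P Q : Conic} {m : ℕ}
    (h : ∀ i < m, ∀ x y, (lineRes P Q x y).coeff i = 0) (x y : ℂ)
    (hm : (lineRes P Q x y).coeff m ≠ 0) : HasOrder P Q m := ⟨h, x, y, hm⟩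


theorem coeff_restrA (P : Conic) (x y : ℂ) (n : ℕ) : (restrA P x y).coeff n =
    if n = 0 then P.xx else if n = 1 then -y * P.xz else if n = 2 then y ^ 2 * P.zz else 0 :=
  coeff_quadratic _ _ _ _

theorem coeff_restrB (P : Conic) (x y : ℂ) (n : ℕ) : (restrB P x y).coeff n =
    if n = 0 then P.xy else if n = 1 then x * P.xz - y * P.yz
      else if n = 2 then -2 * x * y * P.zz else 0 :=
  coeff_quadratic _ _ _ _

theorem coeff_restrE (P : Conic) (x y : ℂ) (n : ℕ) : (restrE P x y).coeff n =
    if n = 0 then P.yy else if n = 1 then x * P.yz else if n = 2 then x ^ 2 * P.zz else 0 :=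
  coeff_quadratic _ _ _ _

theorem not_isUnit_linear (a b c : ℂ) :
    ¬ IsUnit (C a * X 0 + C b * X 1 + C c * X 2 : MvPolynomial (Fin 3) ℂ) := by
  intro h
  have := h.map (constantCoeff (σ := Fin 3) (R := ℂ))
  simp at this

theorem not_isUnit_poly (P : Conic) : ¬ IsUnit P.poly := by
  intro h
  have := h.map (constantCoeff (σ := Fin 3) (R := ℂ))
  simp [poly] at this

/-- If the line `a u + b z = 0` is contained in two conics through `[1 : 0 : 0]`, then they are
not relatively prime. -/
theorem linear_dvd_poly {P : Conic} (hP : P.xx = 0) {a b : ℂ} (hab : a ≠ 0 ∨ b ≠ 0)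
    (h1 : restr1 P a b = 0) (h2 : restr2 P a b = 0) :
    (C 0 * X 0 + C a * X 1 + C b * X 2 : MvPolynomial (Fin 3) ℂ) ∣ P.poly := by
  unfold restr1 at h1
  unfold restr2 at h2
  by_cases ha : a = 0
  · subst ha
    have hb : b ≠ 0 := by simpa using hab
    have hxy : P.xy = 0 := by simpa [hb] using h1
    have hyy : P.yy = 0 := by simpa [hb] using h2
    refine ⟨C b⁻¹ * (C P.xz * X 0 + C P.yz * X 1 + C P.zz * X 2), ?_⟩
    have hbb : (C b * C b⁻¹ : MvPolynomial (Fin 3) ℂ) = 1 := by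
      rw [← C_mul, mul_inv_cancel₀ hb, C_1]
    simp only [poly, hP, hxy, hyy, map_zero]
    linear_combination (-X 2 * (C P.xz * X 0 + C P.yz * X 1 + C P.zz * X 2)) * hbb
  · refine ⟨C a⁻¹ * (C P.xy * X 0 + C P.yy * X 1 + C (P.yz - a⁻¹ * P.yy * b) * X 2), ?_⟩
    have haa : (C a * C a⁻¹ : MvPolynomial (Fin 3) ℂ) = 1 := by
      rw [← C_mul, mul_inv_cancel₀ ha, C_1]
    have e1 : (C P.xz : MvPolynomial (Fin 3) ℂ) = C b * C a⁻¹ * C P.xy := by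
      rw [← C_mul, ← C_mul]
      congr 1
      field_simp
      linear_combination -h1
    have e2 : (C P.zz : MvPolynomial (Fin 3) ℂ) =
        C b * C a⁻¹ * C (P.yz - a⁻¹ * P.yy * b) := by
      rw [← C_mul, ← C_mul]
      congr 1
      field_simp
      linear_combination h2
    have e3 : (C P.yz : MvPolynomial (Fin 3) ℂ) =
        C (P.yz - a⁻¹ * P.yy * b) + C b * C a⁻¹ * C P.yy := by
      rw [← C_mul, ← C_mul, ← C_add]
      congr 1
      ring
    simp only [poly, hP, map_zero]
    linear_combination X 2 ^ 2 * e2 + X 0 * X 2 * e1 + X 1 * X 2 * e3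
      - (C P.xy * X 0 * X 1 + C P.yy * X 1 ^ 2 + C (P.yz - a⁻¹ * P.yy * b) * X 1 * X 2) * haa


theorem affineIntersectionNumber_loc_transversal {P Q : Conic} (hP : P.xx = 0) (hQ : Q.xx = 0)
    (h : P.xy * Q.xz - P.xz * Q.xy ≠ 0) : affineIntersectionNumber P.loc Q.loc = 1 := by
  refine affineIntersectionNumber_eq_one (a := C P.xy + C P.yy * X 0)
    (b := C P.xz + C P.yz * X 0 + C P.zz * X 1) (c := C Q.xy + C Q.yy * X 0)
    (d := C Q.xz + C Q.yz * X 0 + C Q.zz * X 1) ?_ ?_ ?_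
  · simp only [loc, hP, map_zero]
    ring
  · simp only [loc, hQ, map_zero]
    ring
  · simpa using h

/-! ### Normal form with quadratic parts s u and u². -/

section SimpleNormal

theorem coeff_zero_simple {P Q : Conic} (hP1 : P.xx = 0) (hP2 : P.xy = 1)
    (hP3 : P.yy = 0) (hQ1 : Q.xx = 0) (hQ2 : Q.xy = 0) (hQ3 : Q.yy = 1) (x y : ℂ) : (lineRes P Q x y).coeff 0 = 0 := by
  simp [*, lineRes, coeff_quadRes, minorConv, coeff_restrA, coeff_restrB, coeff_restrE]

theorem coeff_one_simple {P Q : Conic} (hP1 : P.xx = 0) (hP2 : P.xy = 1)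
    (hP3 : P.yy = 0) (hQ1 : Q.xx = 0) (hQ2 : Q.xy = 0) (hQ3 : Q.yy = 1) (x y : ℂ) : (lineRes P Q x y).coeff 1 = -(Q.xz * y) := by
  simp [*, lineRes, coeff_quadRes, minorConv, coeff_restrA, coeff_restrB, coeff_restrE,
    Finset.Nat.antidiagonal_succ]
  ring

theorem coeff_two_simple {P Q : Conic} (hP1 : P.xx = 0) (hP2 : P.xy = 1)
    (hP3 : P.yy = 0) (hQ1 : Q.xx = 0) (hQ2 : Q.xy = 0) (hQ3 : Q.yy = 1) (h : Q.xz = 0) (x y : ℂ) :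
    (lineRes P Q x y).coeff 2 = (P.xz ^ 2 - P.xz * Q.yz + Q.zz) * y ^ 2 := by
  simp [*, lineRes, coeff_quadRes, minorConv, coeff_restrA, coeff_restrB, coeff_restrE,
    Finset.Nat.antidiagonal_succ]
  ring

theorem coeff_three_simple {P Q : Conic} (hP1 : P.xx = 0) (hP2 : P.xy = 1)
    (hP3 : P.yy = 0) (hQ1 : Q.xx = 0) (hQ2 : Q.xy = 0) (hQ3 : Q.yy = 1) (h : Q.xz = 0)
    (h' : Q.zz = P.xz * Q.yz - P.xz ^ 2) (x y : ℂ) :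
    (lineRes P Q x y).coeff 3 = (P.zz - P.xz * P.yz) * (Q.yz - 2 * P.xz) * y ^ 3 := by
  simp [*, lineRes, coeff_quadRes, minorConv, coeff_restrA, coeff_restrB, coeff_restrE,
    Finset.Nat.antidiagonal_succ]
  ring

theorem coeff_four_simple {P Q : Conic} (hP1 : P.xx = 0) (hP2 : P.xy = 1)
    (hP3 : P.yy = 0) (hQ1 : Q.xx = 0) (hQ2 : Q.xy = 0) (hQ3 : Q.yy = 1) (h : Q.xz = 0)
    (h' : Q.zz = P.xz * Q.yz - P.xz ^ 2) (h'' : Q.yz = 2 * P.xz) (x y : ℂ) :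
    (lineRes P Q x y).coeff 4 = (P.zz - P.xz * P.yz) ^ 2 * y ^ 4 := by
  simp [*, lineRes, coeff_quadRes, minorConv, coeff_restrA, coeff_restrB, coeff_restrE,
    Finset.Nat.antidiagonal_succ]
  ring

/-- Two conics with quadratic parts `s u` and `u²`, which meet at `[1 : 0 : 0]` and nowhere else
on `Z = 0`. -/
theorem exists_order_of_simple_normal {P Q : Conic} (hP1 : P.xx = 0) (hP2 : P.xy = 1)
    (hP3 : P.yy = 0) (hQ1 : Q.xx = 0) (hQ2 : Q.xy = 0) (hQ3 : Q.yy = 1)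
    (hPQ : IsRelPrime P.poly Q.poly) :
    ∃ m : ℕ, 1 ≤ m ∧ m ≤ 4 ∧ HasOrder P Q m ∧
      affineIntersectionNumber P.loc Q.loc = m := by
  have c0 := coeff_zero_simple hP1 hP2 hP3 hQ1 hQ2 hQ3
  have c1 := coeff_one_simple hP1 hP2 hP3 hQ1 hQ2 hQ3
  by_cases ha : Q.xz = 0
  · have c2 := coeff_two_simple hP1 hP2 hP3 hQ1 hQ2 hQ3 ha
    -- The tangent line of P at the point is u + P.xz z = 0. The equation says that Q vanishes on
    -- it, so that Q is the product of this line and another one.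
    by_cases hr : Q.zz = P.xz * Q.yz - P.xz ^ 2
    · have c3 := coeff_three_simple hP1 hP2 hP3 hQ1 hQ2 hQ3 ha hr
      have hQloc : Q.loc = (C 1 * X 0 + C P.xz * X 1) * (C 1 * X 0 + C (Q.yz - P.xz) * X 1) := by
        simp only [loc, hQ1, hQ2, hQ3, ha, hr, map_sub, map_mul, map_pow, map_zero, map_one]
        ring
      have hQpoly : (C 0 * X 0 + C 1 * X 1 + C P.xz * X 2 : MvPolynomial (Fin 3) ℂ) ∣ Q.poly :=
        linear_dvd_poly hQ1 (Or.inl one_ne_zero) (by simp [restr1, hQ2, ha])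
          (by simp only [restr2, hQ3, hr]; ring)
      have r1 : restr1 P 1 P.xz = 0 := by simp [restr1, hP2]
      have r2 : restr2 P 1 P.xz = P.zz - P.xz * P.yz := by
        simp only [restr2, hP3]
        ring
      -- Otherwise the tangent line would be a component of both conics.
      have r2' : P.zz - P.xz * P.yz ≠ 0 := by
        intro h
        exact not_isUnit_linear _ _ _
          (hPQ (linear_dvd_poly hP1 (Or.inl one_ne_zero) r1 (r2.trans h)) hQpoly)
      have hI : affineIntersectionNumber P.loc Q.loc = 2 +
          affineIntersectionNumber P.loc (C 1 * X 0 + C (Q.yz - P.xz) * X 1) := by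
        rw [hQloc, affineIntersectionNumber_linear_mul' hP1 (Or.inl one_ne_zero)
          (Or.inr (r2.trans_ne r2')), affineIntersectionNumber_linear_of_eq hP1
          (Or.inl one_ne_zero) r1 (r2.trans_ne r2')]
      -- The equation says that the second line of Q is the tangent line too: the intersection
      -- number is 2 + 2 if it holds and 2 + 1 if not.
      by_cases hd : Q.yz = 2 * P.xz
      · have c4 := coeff_four_simple hP1 hP2 hP3 hQ1 hQ2 hQ3 ha hr hd
        refine ⟨4, by norm_num, le_rfl, HasOrder.of_coeff ?_ 0 1 ?_, ?_⟩
        · intro i hi x y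
          interval_cases i <;> simp [c0, c1, c2, c3, ha, hr, hd]
        · rw [c4]
          simpa using r2'
        · rw [hI, show Q.yz - P.xz = P.xz by rw [hd]; ring,
            affineIntersectionNumber_linear_of_eq hP1 (Or.inl one_ne_zero) r1 (r2.trans_ne r2')]
          norm_num
      · refine ⟨3, by norm_num, by norm_num, HasOrder.of_coeff ?_ 0 1 ?_, ?_⟩
        · intro i hi x y
          interval_cases i <;> simp [c0, c1, c2, ha, hr]
        · rw [c3]
          simpa [sub_eq_zero, hd] using r2'
        · rw [hI, affineIntersectionNumber_linear_of_ne hP1]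
          · norm_num
          · simp only [restr1, hP2]
            contrapose! hd
            linear_combination hd
    -- Over ℂ the conic Q splits into two lines through the point. Neither is tangent to P, because
    -- -P.xz is not a root of r² + Q.yz r + Q.zz, so each contributes 1.
    · obtain ⟨r, hr0⟩ : ∃ r : ℂ, r * r + Q.yz * r + Q.zz = 0 := by
        obtain ⟨r, hr⟩ := IsAlgClosed.exists_pow_nat_eq ((Q.yz / 2) ^ 2 - Q.zz) (n := 2)
          (by norm_num)
        exact ⟨r - Q.yz / 2, by linear_combination hr⟩
      have hQloc : Q.loc = (C 1 * X 0 + C (-r) * X 1) * (C 1 * X 0 + C (Q.yz + r) * X 1) := by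
        have hzz : Q.zz = -(r * r + Q.yz * r) := by linear_combination hr0
        simp only [loc, hQ1, hQ2, hQ3, ha, hzz, map_add, map_mul, map_neg, map_zero, map_one]
        ring
      have r1 : restr1 P 1 (-r) ≠ 0 := by
        simp only [restr1, hP2]
        contrapose! hr
        obtain rfl : r = -P.xz := by linear_combination -hr
        linear_combination hr0
      have r1' : restr1 P 1 (Q.yz + r) ≠ 0 := by
        simp only [restr1, hP2]
        contrapose! hr
        linear_combination hr0 + (-r - P.xz) * hr
      refine ⟨2, by norm_num, by norm_num, HasOrder.of_coeff ?_ 0 1 ?_, ?_⟩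
      · intro i hi x y
        interval_cases i <;> simp [c0, c1, ha]
      · rw [c2]
        contrapose! hr
        linear_combination hr
      · rw [hQloc, affineIntersectionNumber_linear_mul' hP1 (Or.inl one_ne_zero) (Or.inl r1),
          affineIntersectionNumber_linear_of_ne hP1 r1,
          affineIntersectionNumber_linear_of_ne hP1 r1']
        norm_num
  · refine ⟨1, le_rfl, by norm_num, HasOrder.of_coeff ?_ 0 1 ?_, ?_⟩
    · intro i hi x y
      interval_cases i
      exact c0 x y
    · rw [c1]
      simpa using ha
    · rw [affineIntersectionNumber_loc_transversal hP1 hQ1 (by simpa [hP2, hQ2] using ha)]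
      norm_num

end SimpleNormal

/-! ### Normal form in which Q contains the line at infinity. -/

section ProportionalNormal

theorem coeff_zero_proportional {P Q : Conic} (hP1 : P.xx = 0) (hQ1 : Q.xx = 0) (hQ2 : Q.xy = 0)
    (hQ3 : Q.yy = 0) (x y : ℂ) : (lineRes P Q x y).coeff 0 = 0 := by
  simp [*, lineRes, coeff_quadRes, minorConv, coeff_restrA, coeff_restrB, coeff_restrE]

theorem coeff_one_proportional {P Q : Conic} (hP1 : P.xx = 0) (hQ1 : Q.xx = 0) (hQ2 : Q.xy = 0)
    (hQ3 : Q.yy = 0) (x y : ℂ) : (lineRes P Q x y).coeff 1 = 0 := by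
  simp [*, lineRes, coeff_quadRes, minorConv, coeff_restrA, coeff_restrB, coeff_restrE,
    Finset.Nat.antidiagonal_succ]

theorem coeff_two_proportional {P Q : Conic} (hP1 : P.xx = 0) (hQ1 : Q.xx = 0) (hQ2 : Q.xy = 0)
    (hQ3 : Q.yy = 0) (x y : ℂ) :
    (lineRes P Q x y).coeff 2 =
      (P.xy * x * y + P.yy * y ^ 2) * Q.xz * (P.yy * Q.xz - P.xy * Q.yz) := by
  simp [*, lineRes, coeff_quadRes, minorConv, coeff_restrA, coeff_restrB, coeff_restrE,
    Finset.Nat.antidiagonal_succ]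
  ring

theorem coeff_three_proportional {P Q : Conic} (hP1 : P.xx = 0) (hQ1 : Q.xx = 0) (hQ2 : Q.xy = 0)
    (hQ3 : Q.yy = 0) (h : Q.xz = 0) (x y : ℂ) :
    (lineRes P Q x y).coeff 3 =
      (P.xy * x * y + P.yy * y ^ 2) * y * Q.yz * restr1 P Q.yz Q.zz := by
  simp [*, lineRes, coeff_quadRes, minorConv, coeff_restrA, coeff_restrB, coeff_restrE,
    Finset.Nat.antidiagonal_succ]
  unfold restr1
  ring

theorem coeff_four_proportional {P Q : Conic} (hP1 : P.xx = 0) (hQ1 : Q.xx = 0) (hQ2 : Q.xy = 0)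
    (hQ3 : Q.yy = 0) (h : Q.xz = 0) (x y : ℂ) :
    (lineRes P Q x y).coeff 4 = (P.xy * x * y + P.yy * y ^ 2) *
      (Q.zz * x * y * restr1 P Q.yz Q.zz + y ^ 2 * restr2 P Q.yz Q.zz) := by
  simp [*, lineRes, coeff_quadRes, minorConv, coeff_restrA, coeff_restrB, coeff_restrE,
    Finset.Nat.antidiagonal_succ]
  unfold restr1 restr2
  ring

/-- The line `Z = 0` contributes to an intersection number as follows. -/
def lineContribution (P : Conic) : ℕ := if P.xy = 0 then 2 else 1

/-- Q is Z times the line Q.xz X + Q.yz Y + Q.zz Z. The factor Z contributes `lineContribution P`.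
The other line misses the point if Q.xz ≠ 0; if Q.xz = 0 and Q.yz ≠ 0 it passes through it and
contributes 1, or 2 if tangent to P; otherwise it is Z = 0 once more. The extra inequality in the
first case says that it also misses the other zero (P.yy, -P.xy) of the quadratic part of P; without
it the coefficient of t² vanishes identically. -/
theorem exists_order_of_proportional_normal {P Q : Conic} (hP1 : P.xx = 0) (hQ1 : Q.xx = 0) (hQ2 : Q.xy = 0)
    (hQ3 : Q.yy = 0)
    (hP : P.xy ≠ 0 ∨ P.yy ≠ 0) (hPQ : IsRelPrime P.poly Q.poly) :
    (Q.xz ≠ 0 → affineIntersectionNumber P.loc Q.loc = lineContribution P ∧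
      (P.yy * Q.xz - P.xy * Q.yz ≠ 0 → HasOrder P Q 2)) ∧
    (Q.xz = 0 → Q.yz ≠ 0 → ∃ k : ℕ, (k = 1 ∨ k = 2) ∧
      affineIntersectionNumber P.loc Q.loc = (lineContribution P + k : ℕ) ∧
        HasOrder P Q (2 + k)) ∧
    (Q.xz = 0 → Q.yz = 0 →
      affineIntersectionNumber P.loc Q.loc = (2 * lineContribution P : ℕ) ∧ HasOrder P Q 4) := by
  have c0 := coeff_zero_proportional hP1 hQ1 hQ2 hQ3
  have c1 := coeff_one_proportional hP1 hQ1 hQ2 hQ3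
  have c2 := coeff_two_proportional hP1 hQ1 hQ2 hQ3
  -- One direction at which neither y nor the quadratic part of P vanishes detects the leading
  -- coefficient in every case below.
  obtain ⟨x₀, y₀, hx₀⟩ : ∃ x y, (P.xy * x * y + P.yy * y ^ 2) * y ^ 2 ≠ 0 := by
    by_contra! hcon
    have h1 := hcon 0 1
    have h2 := hcon 1 1
    simp at h1 h2
    rcases hP with h | h
    · exact h (by linear_combination h2 - h1)
    · exact h h1
  have hy₀ : y₀ ≠ 0 := by
    rintro rfl
    simp at hx₀
  have hx₀' : P.xy * x₀ * y₀ + P.yy * y₀ ^ 2 ≠ 0 := left_ne_zero_of_mul hx₀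
  have hz : restr1 P 0 1 ≠ 0 ∨ restr2 P 0 1 ≠ 0 := by simpa [restr1, restr2] using hP
  have hIz : affineIntersectionNumber P.loc (C 0 * X 0 + C 1 * X 1) = lineContribution P := by
    unfold lineContribution
    split_ifs with h
    · rw [affineIntersectionNumber_linear_of_eq hP1 (Or.inr one_ne_zero)]
      · norm_num
      · simp [restr1, h]
      · simpa [restr2, h] using hP
    · rw [affineIntersectionNumber_linear_of_ne hP1]
      · norm_num
      · simpa [restr1] using h
  have hQloc : Q.loc = (C 0 * X 0 + C 1 * X 1) * (C Q.xz + C Q.yz * X 0 + C Q.zz * X 1) := by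
    simp only [loc, hQ1, hQ2, hQ3, map_zero, map_one]
    ring
  have hI : affineIntersectionNumber P.loc Q.loc = lineContribution P +
      affineIntersectionNumber P.loc (C Q.xz + C Q.yz * X 0 + C Q.zz * X 1) := by
    rw [hQloc, affineIntersectionNumber_linear_mul' hP1 (Or.inr one_ne_zero) hz, hIz]
  refine ⟨fun h => ⟨?_, fun h' => HasOrder.of_coeff ?_ x₀ y₀ ?_⟩, fun h h' => ?_, fun h h' => ?_⟩
  · rw [hI, affineIntersectionNumber_eq_zero (by simpa using h), add_zero]
  · intro i hi x y
    interval_cases i <;> simp [c0, c1]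
  · rw [c2]
    exact mul_ne_zero (mul_ne_zero hx₀' h) h'
  · have c3 := coeff_three_proportional hP1 hQ1 hQ2 hQ3 h
    have hI' : affineIntersectionNumber P.loc Q.loc = lineContribution P +
      affineIntersectionNumber P.loc (C Q.yz * X 0 + C Q.zz * X 1) := by
      rw [hI, h, map_zero, zero_add]
    by_cases r1 : restr1 P Q.yz Q.zz = 0
    · have r2 : restr2 P Q.yz Q.zz ≠ 0 := by
        intro r2
        exact not_isUnit_linear _ _ _ (hPQ (linear_dvd_poly hP1 (Or.inl h') r1 r2)
          (linear_dvd_poly hQ1 (Or.inl h') (by simp [restr1, hQ2, h])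
            (by simp only [restr2, hQ3]; ring)))
      refine ⟨2, Or.inr rfl, ?_, HasOrder.of_coeff ?_ x₀ y₀ ?_⟩
      · rw [hI', affineIntersectionNumber_linear_of_eq hP1 (Or.inl h') r1 r2]
        norm_num
      · intro i hi x y
        interval_cases i <;> simp [c0, c1, c2, c3, h, r1]
      · rw [coeff_four_proportional hP1 hQ1 hQ2 hQ3 h _ _, r1, mul_zero,
          zero_add]
        exact mul_ne_zero hx₀' (mul_ne_zero (pow_ne_zero _ hy₀) r2)
    · refine ⟨1, Or.inl rfl, ?_, HasOrder.of_coeff ?_ x₀ y₀ ?_⟩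
      · rw [hI', affineIntersectionNumber_linear_of_ne hP1 r1]
        norm_num
      · intro i hi x y
        interval_cases i <;> simp [c0, c1, c2, h]
      · rw [c3]
        exact mul_ne_zero (mul_ne_zero (mul_ne_zero hx₀' hy₀) h') r1
  · have hzz : Q.zz ≠ 0 := by
      intro hzz
      have hQ0 : Q.poly = 0 := by simp [poly, hQ1, hQ2, hQ3, h, h', hzz]
      rw [hQ0] at hPQ
      exact not_isUnit_poly P (hPQ dvd_rfl (dvd_zero _))
    have hI' : affineIntersectionNumber P.loc Q.loc =
        lineContribution P + lineContribution P := by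
      rw [hI, h, h', show (C 0 + C 0 * X 0 + C Q.zz * X 1 : MvPolynomial (Fin 2) ℂ) =
        C Q.zz * (C 0 * X 0 + C 1 * X 1) by simp,
        affineIntersectionNumber_unit_mul (by simpa using hzz), hIz]
    refine ⟨?_, HasOrder.of_coeff ?_ x₀ y₀ ?_⟩
    · rw [hI']
      norm_num [two_mul]
    · intro i hi x y
      have c3 := coeff_three_proportional hP1 hQ1 hQ2 hQ3 h
      interval_cases i <;> simp [c0, c1, c2, c3, h, h']
    · rw [coeff_four_proportional hP1 hQ1 hQ2 hQ3 h _ _]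
      have : Q.zz * x₀ * y₀ * restr1 P Q.yz Q.zz + y₀ ^ 2 * restr2 P Q.yz Q.zz =
          Q.zz ^ 2 * (P.xy * x₀ * y₀ + P.yy * y₀ ^ 2) := by
        simp only [restr1, restr2, h']
        ring
      rw [this]
      exact mul_ne_zero hx₀' (mul_ne_zero (pow_ne_zero _ hzz) hx₀')

end ProportionalNormal

end

section

open MvPolynomial Conic

/-! ### Points of the line at infinity and local coordinates -/

theorem vec_ne_zero {x y : ℂ} (h : x ≠ 0 ∨ y ≠ 0) : (![x, y, 0] : Fin 3 → ℂ) ≠ 0 := by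
  intro h0
  have h1 := congrFun h0 0
  have h2 := congrFun h0 1
  simp at h1 h2
  exact h.elim (fun h => h h1) (fun h => h h2)

/-- The point `[x : y : 0]`. -/
def pt (x y : ℂ) (h : x ≠ 0 ∨ y ≠ 0) : LineAtInfinity :=
  ⟨Projectivization.mk ℂ ![x, y, 0] (vec_ne_zero h), by
    obtain ⟨a, ha⟩ := Projectivization.exists_smul_eq_mk_rep ℂ ![x, y, 0] (vec_ne_zero h)
    rw [← ha]
    simp⟩

theorem exists_pt (w : LineAtInfinity) : ∃ x y h, w = pt x y h := by
  have hw : ![(w : Plane).rep 0, (w : Plane).rep 1, 0] = (w : Plane).rep := by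
    ext i
    fin_cases i
    · rfl
    · rfl
    · exact w.2.symm
  have h : (w : Plane).rep 0 ≠ 0 ∨ (w : Plane).rep 1 ≠ 0 := by
    by_contra! hcon
    apply (w : Plane).rep_nonzero
    rw [← hw, hcon.1, hcon.2]
    simp
  refine ⟨_, _, h, Subtype.ext ?_⟩
  simp only [pt, hw, Projectivization.mk_rep]

theorem pt_eq_iff {x y x' y' : ℂ} {h : x ≠ 0 ∨ y ≠ 0} {h' : x' ≠ 0 ∨ y' ≠ 0} :
    pt x y h = pt x' y' h' ↔ x * y' - y * x' = 0 := by
  rw [← Subtype.coe_inj]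
  simp only [pt]
  rw [Projectivization.mk_eq_mk_iff']
  constructor
  · rintro ⟨a, ha⟩
    have h1 := congrFun ha 0
    have h2 := congrFun ha 1
    simp at h1 h2
    rw [← h1, ← h2]
    ring
  · intro hd
    rcases h' with h0 | h0
    · refine ⟨x / x', ?_⟩
      ext i
      fin_cases i
      · simp [h0]
      · simp
        field_simp
        linear_combination hd
      · simp
    · refine ⟨y / y', ?_⟩
      ext i
      fin_cases i
      · simp
        field_simp
        linear_combination -hd
      · simp [h0]
      · simp

theorem exists_smul_of_pt_eq {x y x' y' : ℂ} {h : x ≠ 0 ∨ y ≠ 0} {h' : x' ≠ 0 ∨ y' ≠ 0}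
    (he : pt x y h = pt x' y' h') : ∃ c : ℂ, c ≠ 0 ∧ x = c * x' ∧ y = c * y' := by
  have he' := congrArg Subtype.val he
  simp only [pt] at he'
  rw [Projectivization.mk_eq_mk_iff] at he'
  obtain ⟨c, hc⟩ := he'
  have h1 := congrFun hc 0
  have h2 := congrFun hc 1
  simp [Units.smul_def] at h1 h2
  exact ⟨c, c.ne_zero, h1.symm, h2.symm⟩

/-- Coordinates around a point of the line at infinity. -/
def frameHom (x₀ y₀ e₁ e₂ : ℂ) : MvPolynomial (Fin 3) ℂ →ₐ[ℂ] MvPolynomial (Fin 2) ℂ :=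
  aeval ![C x₀ + C e₁ * X 0, C y₀ + C e₂ * X 0, X 1]

/-- `localEquation` normalizes one coordinate of the point to 1: c is the scalar that does so, and
(e₁, e₂) is the direction of the chart coordinate along Z = 0. From here on all charts are treated
as one linear change of coordinates. -/
theorem exists_frame {x y : ℂ} (h : x ≠ 0 ∨ y ≠ 0) :
    ∃ c e₁ e₂ : ℂ, c ≠ 0 ∧ c * x * e₂ - c * y * e₁ ≠ 0 ∧
      ∀ F, localEquation F (pt x y h : Plane) = frameHom (c * x) (c * y) e₁ e₂ F := by
  set w := pt x y h with hw
  have hrep : ∃ a : ℂ, a ≠ 0 ∧ (w : Plane).rep 0 = a * x ∧ (w : Plane).rep 1 = a * y := by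
    obtain ⟨a, ha⟩ := Projectivization.exists_smul_eq_mk_rep ℂ ![x, y, 0] (vec_ne_zero h)
    have h0 := congrFun ha 0
    have h1 := congrFun ha 1
    simp [Units.smul_def] at h0 h1
    exact ⟨a, a.ne_zero, h0.symm, h1.symm⟩
  obtain ⟨a, ha, h0, h1⟩ := hrep
  have h2 : (w : Plane).rep 2 = 0 := w.2
  by_cases hx : x = 0
  · have hy : y ≠ 0 := by simpa [hx] using h
    have hr0 : (w : Plane).rep 0 = 0 := by rw [h0, hx, mul_zero]
    have hr1 : (w : Plane).rep 1 ≠ 0 := by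
      rw [h1]
      exact mul_ne_zero ha hy
    have hci : chartIndex (w : Plane) = 1 := by simp [chartIndex, hr0, hr1]
    refine ⟨y⁻¹, 1, 0, inv_ne_zero hy, by simp [hx, hy], fun F => ?_⟩
    unfold localEquation frameHom
    rw [hci]
    congr 2
    ext1 i
    fin_cases i
    · change X 0 + C ((w : Plane).rep 0 / _) = _
      simp [hr0, hx]
    · simp [hy]
    · change X 1 + C ((w : Plane).rep 2 / _) = _
      simp [h2]
  · have hr0 : (w : Plane).rep 0 ≠ 0 := by
      rw [h0]
      exact mul_ne_zero ha hx
    have hci : chartIndex (w : Plane) = 0 := by simp [chartIndex, hr0]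
    refine ⟨x⁻¹, 0, 1, inv_ne_zero hx, by simp [hx], fun F => ?_⟩
    unfold localEquation frameHom
    rw [hci]
    congr 2
    ext1 i
    fin_cases i
    · simp [hx]
    · change X 0 + C ((w : Plane).rep 1 / (w : Plane).rep 0) = _
      rw [h0, h1, mul_div_mul_left _ _ ha]
      simp [div_eq_inv_mul]
      ring
    · change X 1 + C ((w : Plane).rep 2 / _) = _
      simp [h2]

theorem frameHom_poly (P : Conic) (x₀ y₀ e₁ e₂ : ℂ) :
    frameHom x₀ y₀ e₁ e₂ P.poly = (subst x₀ y₀ e₁ e₂ P).loc := by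
  simp only [frameHom, poly, loc, subst, map_add, map_mul, map_pow, aeval_X, algHom_C,
    algebraMap_eq, map_ofNat]
  simp
  ring

theorem loc_comb (a b : ℂ) (P Q : Conic) : (comb a b P Q).loc = C a * P.loc + C b * Q.loc := by
  simp only [loc, comb, map_add, map_mul]
  ring

theorem poly_comb (a b : ℂ) (P Q : Conic) :
    (comb a b P Q).poly = C a * P.poly + C b * Q.poly := by
  simp only [poly, comb, map_add, map_mul]
  ring

theorem subst_comb (a b : ℂ) (P Q : Conic) (x₀ y₀ e₁ e₂ : ℂ) :
    subst x₀ y₀ e₁ e₂ (comb a b P Q) = comb a b (subst x₀ y₀ e₁ e₂ P) (subst x₀ y₀ e₁ e₂ Q) := by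
  ext <;> simp only [subst, comb] <;> ring

theorem affineIntersectionNumber_comb {P Q : Conic} {a b c d : ℂ} (hD : a * d - b * c ≠ 0) :
    affineIntersectionNumber (comb a b P Q).loc (comb c d P Q).loc =
      affineIntersectionNumber P.loc Q.loc :=
  (affineIntersectionNumber_eq_of_linear (loc_comb a b P Q) (loc_comb c d P Q)
    (by simpa using hD)).symm

theorem isRelPrime_comb {P Q : Conic} {a b c d : ℂ} (hD : a * d - b * c ≠ 0)
    (h : IsRelPrime P.poly Q.poly) : IsRelPrime (comb a b P Q).poly (comb c d P Q).poly := by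
  intro F h1 h2
  rw [poly_comb] at h1 h2
  have hCD : (C (a * d - b * c)⁻¹ * (C a * C d - C b * C c) : MvPolynomial (Fin 3) ℂ) = 1 := by
    rw [← C_mul, ← C_mul, ← C_sub, ← C_mul, inv_mul_cancel₀ hD, C_1]
  apply h
  · have : P.poly = C (a * d - b * c)⁻¹ * C d * (C a * P.poly + C b * Q.poly)
        - C (a * d - b * c)⁻¹ * C b * (C c * P.poly + C d * Q.poly) := by
      linear_combination -P.poly * hCD
    rw [this]
    exact dvd_sub (h1.mul_left _) (h2.mul_left _)
  · have : Q.poly = C (a * d - b * c)⁻¹ * C a * (C c * P.poly + C d * Q.poly)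
        - C (a * d - b * c)⁻¹ * C c * (C a * P.poly + C b * Q.poly) := by
      linear_combination -Q.poly * hCD
    rw [this]
    exact dvd_sub (h2.mul_left _) (h1.mul_left _)

/-- The linear change of coordinates, on polynomials. -/
def substHom (x₀ y₀ e₁ e₂ : ℂ) : MvPolynomial (Fin 3) ℂ →ₐ[ℂ] MvPolynomial (Fin 3) ℂ :=
  aeval ![C x₀ * X 0 + C e₁ * X 1, C y₀ * X 0 + C e₂ * X 1, X 2]

theorem substHom_poly (P : Conic) (x₀ y₀ e₁ e₂ : ℂ) :
    substHom x₀ y₀ e₁ e₂ P.poly = (subst x₀ y₀ e₁ e₂ P).poly := by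
  simp only [substHom, poly, subst, map_add, map_mul, map_pow, aeval_X, algHom_C,
    algebraMap_eq, map_ofNat]
  simp
  ring

theorem subst_subst (P : Conic) (x₀ y₀ e₁ e₂ x₁ y₁ f₁ f₂ : ℂ) :
    subst x₁ y₁ f₁ f₂ (subst x₀ y₀ e₁ e₂ P) =
      subst (x₀ * x₁ + e₁ * y₁) (y₀ * x₁ + e₂ * y₁) (x₀ * f₁ + e₁ * f₂) (y₀ * f₁ + e₂ * f₂) P := by
  ext <;> simp only [subst] <;> ring

theorem subst_id (P : Conic) : subst 1 0 0 1 P = P := by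
  ext <;> simp [subst]

theorem substHom_comp_inv {x₀ y₀ e₁ e₂ : ℂ} (hD : x₀ * e₂ - y₀ * e₁ ≠ 0)
    (F : MvPolynomial (Fin 3) ℂ) :
    substHom x₀ y₀ e₁ e₂ (substHom (e₂ * (x₀ * e₂ - y₀ * e₁)⁻¹) (-y₀ * (x₀ * e₂ - y₀ * e₁)⁻¹)
      (-e₁ * (x₀ * e₂ - y₀ * e₁)⁻¹) (x₀ * (x₀ * e₂ - y₀ * e₁)⁻¹) F) = F := by
  have hCD : ((C x₀ * C e₂ - C y₀ * C e₁) * C (x₀ * e₂ - y₀ * e₁)⁻¹ :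
      MvPolynomial (Fin 3) ℂ) = 1 := by
    rw [← C_mul, ← C_mul, ← C_sub, ← C_mul, mul_inv_cancel₀ hD, C_1]
  rw [← AlgHom.comp_apply]
  conv_rhs => rw [← AlgHom.id_apply (R := ℂ) F]
  congr 1
  ext1 i
  fin_cases i
  · simp only [substHom, AlgHom.comp_apply, aeval_X, AlgHom.id_apply]
    simp [-map_inv₀]
    linear_combination X 0 * hCD
  · simp only [substHom, AlgHom.comp_apply, aeval_X, AlgHom.id_apply]
    simp [-map_inv₀]
    linear_combination X 1 * hCD
  · simp [substHom]

/-- The change of coordinates is an automorphism of the polynomial ring; common divisors are carried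
back by the inverse matrix, and units forward again. -/
theorem isRelPrime_subst {P Q : Conic} {x₀ y₀ e₁ e₂ : ℂ} (hD : x₀ * e₂ - y₀ * e₁ ≠ 0)
    (h : IsRelPrime P.poly Q.poly) :
    IsRelPrime (subst x₀ y₀ e₁ e₂ P).poly (subst x₀ y₀ e₁ e₂ Q).poly := by
  set D := x₀ * e₂ - y₀ * e₁ with hDdef
  have hD' : e₂ * D⁻¹ * (x₀ * D⁻¹) - -y₀ * D⁻¹ * (-e₁ * D⁻¹) ≠ 0 := by
    have : e₂ * D⁻¹ * (x₀ * D⁻¹) - -y₀ * D⁻¹ * (-e₁ * D⁻¹) = D * D⁻¹ * D⁻¹ := by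
      rw [hDdef]
      ring
    rw [this, mul_inv_cancel₀ hD, one_mul]
    exact inv_ne_zero hD
  have hback : ∀ P : Conic, substHom (e₂ * D⁻¹) (-y₀ * D⁻¹) (-e₁ * D⁻¹) (x₀ * D⁻¹)
      (subst x₀ y₀ e₁ e₂ P).poly = P.poly := by
    intro P
    rw [substHom_poly, subst_subst]
    have hDD := mul_inv_cancel₀ hD
    have e1 : x₀ * (e₂ * D⁻¹) + e₁ * (-y₀ * D⁻¹) = 1 := by
      rw [← hDD, hDdef]; ring
    have e2 : y₀ * (e₂ * D⁻¹) + e₂ * (-y₀ * D⁻¹) = 0 := by ring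
    have e3 : x₀ * (-e₁ * D⁻¹) + e₁ * (x₀ * D⁻¹) = 0 := by ring
    have e4 : y₀ * (-e₁ * D⁻¹) + e₂ * (x₀ * D⁻¹) = 1 := by
      rw [← hDD, hDdef]; ring
    rw [e1, e2, e3, e4, subst_id]
  intro F h1 h2
  have h1' := map_dvd (substHom (e₂ * D⁻¹) (-y₀ * D⁻¹) (-e₁ * D⁻¹) (x₀ * D⁻¹)) h1
  have h2' := map_dvd (substHom (e₂ * D⁻¹) (-y₀ * D⁻¹) (-e₁ * D⁻¹) (x₀ * D⁻¹)) h2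
  rw [hback] at h1' h2'
  have hu := (h h1' h2').map (substHom x₀ y₀ e₁ e₂)
  rwa [substHom_comp_inv hD] at hu

theorem intersectionNumber_comb {P Q : Conic} {a b c d : ℂ} (hD : a * d - b * c ≠ 0)
    (w : LineAtInfinity) :
    intersectionNumber (comb a b P Q).poly (comb c d P Q).poly w =
      intersectionNumber P.poly Q.poly w := by
  obtain ⟨x, y, h, rfl⟩ := exists_pt w
  obtain ⟨k, e₁, e₂, -, -, hF⟩ := exists_frame h
  simp only [intersectionNumber, hF, frameHom_poly, subst_comb]
  exact affineIntersectionNumber_comb hD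

end

section

open MvPolynomial Conic

/-! ### Intersection numbers of two conics along the line at infinity -/

theorem quad_smul (P : Conic) (c x y : ℂ) : P.quad (c * x) (c * y) = c ^ 2 * P.quad x y := by
  simp only [quad]
  ring

theorem lin_smul (P : Conic) (c x y : ℂ) : P.lin (c * x) (c * y) = c * P.lin x y := by
  simp only [lin]
  ring

theorem subst_xx (P : Conic) (x₀ y₀ e₁ e₂ : ℂ) : (subst x₀ y₀ e₁ e₂ P).xx = P.quad x₀ y₀ := rfl

theorem quad_subst (P : Conic) (x₀ y₀ e₁ e₂ s u : ℂ) :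
    (subst x₀ y₀ e₁ e₂ P).quad s u = P.quad (x₀ * s + e₁ * u) (y₀ * s + e₂ * u) := by
  simp only [quad, subst]
  ring

/-- The quadratic parts of two conics are proportional. -/
def Proportional (P Q : Conic) : Prop :=
  ∃ a b : ℂ, (a ≠ 0 ∨ b ≠ 0) ∧ ∀ x y, b * P.quad x y = a * Q.quad x y

theorem intersectionNumber_eq_zero_of_quad_ne {P Q : Conic} {x y : ℂ} (h : x ≠ 0 ∨ y ≠ 0)
    (hPQ : P.quad x y ≠ 0 ∨ Q.quad x y ≠ 0) :
    intersectionNumber P.poly Q.poly (pt x y h) = 0 := by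
  obtain ⟨c, e₁, e₂, hc, -, hF⟩ := exists_frame h
  rw [intersectionNumber, hF, hF, frameHom_poly, frameHom_poly]
  rcases hPQ with h' | h'
  · apply affineIntersectionNumber_eq_zero_left
    rw [constantCoeff_loc, subst_xx, quad_smul]
    exact mul_ne_zero (pow_ne_zero _ hc) h'
  · apply affineIntersectionNumber_eq_zero
    rw [constantCoeff_loc, subst_xx, quad_smul]
    exact mul_ne_zero (pow_ne_zero _ hc) h'

/-- Two conics whose quadratic parts have exactly one common zero, which is simple. -/
theorem exists_order_of_not_proportional {P Q : Conic} (hPQ : IsRelPrime P.poly Q.poly)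
    (hprop : ¬ Proportional P Q) {x y : ℂ} (h : x ≠ 0 ∨ y ≠ 0) (hP : P.quad x y = 0)
    (hQ : Q.quad x y = 0) :
    ∃ m : ℕ, 1 ≤ m ∧ m ≤ 4 ∧ HasOrder P Q m ∧
      intersectionNumber P.poly Q.poly (pt x y h) = m := by
  obtain ⟨c, e₁, e₂, hc, hD, hF⟩ := exists_frame h
  rw [intersectionNumber, hF, hF, frameHom_poly, frameHom_poly]
  set P' := subst (c * x) (c * y) e₁ e₂ P with hP'
  set Q' := subst (c * x) (c * y) e₁ e₂ Q with hQ'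
  have hPxx : P'.xx = 0 := by rw [hP', subst_xx, quad_smul, hP, mul_zero]
  have hQxx : Q'.xx = 0 := by rw [hQ', subst_xx, quad_smul, hQ, mul_zero]
  set δ := P'.xy * Q'.yy - P'.yy * Q'.xy with hδ
  -- In the frame both quadratic parts are divisible by u. If δ = 0 the remaining factors P'.xy s +
  -- P'.yy u and Q'.xy s + Q'.yy u are proportional, hence so are the quadratic parts.
  have hδ0 : δ ≠ 0 := by
    intro h0
    apply hprop
    obtain ⟨a, b, hab, h1, h2⟩ : ∃ a b : ℂ, (a ≠ 0 ∨ b ≠ 0) ∧ b * P'.xy = a * Q'.xy ∧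
        b * P'.yy = a * Q'.yy := by
      by_cases hxy : P'.xy = 0 ∧ Q'.xy = 0
      · by_cases hyy : P'.yy = 0 ∧ Q'.yy = 0
        · exact ⟨1, 0, by simp, by simp [hxy.2], by simp [hyy.2]⟩
        · exact ⟨P'.yy, Q'.yy, by tauto, by simp [hxy], by ring⟩
      · exact ⟨P'.xy, Q'.xy, by tauto, by ring, by linear_combination -h0⟩
    refine ⟨a, b, hab, fun X Y => ?_⟩
    have hs := fun s u => quad_subst P (c * x) (c * y) e₁ e₂ s u
    have hs' := fun s u => quad_subst Q (c * x) (c * y) e₁ e₂ s u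
    set D := c * x * e₂ - c * y * e₁ with hDdef
    have hX : c * x * ((e₂ * X - e₁ * Y) * D⁻¹) + e₁ * ((c * x * Y - c * y * X) * D⁻¹) = X := by
      linear_combination X * mul_inv_cancel₀ hD
    have hY : c * y * ((e₂ * X - e₁ * Y) * D⁻¹) + e₂ * ((c * x * Y - c * y * X) * D⁻¹) = Y := by
      linear_combination Y * mul_inv_cancel₀ hD
    have k1 := hs ((e₂ * X - e₁ * Y) * D⁻¹) ((c * x * Y - c * y * X) * D⁻¹)
    have k2 := hs' ((e₂ * X - e₁ * Y) * D⁻¹) ((c * x * Y - c * y * X) * D⁻¹)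
    rw [hX, hY, ← hP'] at k1
    rw [hX, hY, ← hQ'] at k2
    rw [← k1, ← k2]
    generalize (e₂ * X - e₁ * Y) * D⁻¹ = s
    generalize (c * x * Y - c * y * X) * D⁻¹ = u
    simp only [quad, hPxx, hQxx]
    linear_combination s * u * h1 + u ^ 2 * h2
  have hdet : Q'.yy / δ * (P'.xy / δ) - -P'.yy / δ * (-Q'.xy / δ) ≠ 0 := by
    have : Q'.yy / δ * (P'.xy / δ) - -P'.yy / δ * (-Q'.xy / δ) = 1 / δ := by
      field_simp
      rw [hδ]
      ring
    rw [this]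
    exact one_div_ne_zero hδ0
  -- Combining P' and Q' with the inverse of the matrix of the remaining factors produces the
  -- quadratic parts s u and u².
  obtain ⟨m, h1, h4, hm, hI⟩ := exists_order_of_simple_normal
    (P := comb (Q'.yy / δ) (-P'.yy / δ) P' Q') (Q := comb (-Q'.xy / δ) (P'.xy / δ) P' Q')
    (by simp [comb, hPxx, hQxx]) (by simp only [comb]; field_simp; rw [hδ]; ring)
    (by simp only [comb]; field_simp; ring) (by simp [comb, hPxx, hQxx])
    (by simp only [comb]; field_simp; ring) (by simp only [comb]; field_simp; rw [hδ]; ring)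
    (isRelPrime_comb hdet (isRelPrime_subst hD hPQ))
  refine ⟨m, h1, h4, ?_, ?_⟩
  · rw [HasOrder.comb_iff hdet, HasOrder.subst_iff hD] at hm
    exact hm
  · rw [← hI, affineIntersectionNumber_comb hdet]

/-- A conic with quadratic part `c (y₀ x - x₀ y) (y₁ x - x₁ y)` and a conic that contains the line
at infinity. -/
theorem order_of_factor [DecidableEq LineAtInfinity] {P Q : Conic} (hPQ : IsRelPrime P.poly Q.poly)
    (hQ1 : Q.xx = 0) (hQ2 : Q.xy = 0) (hQ3 : Q.yy = 0) {x₀ y₀ x₁ y₁ c : ℂ}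
    (h₀ : x₀ ≠ 0 ∨ y₀ ≠ 0) (h₁ : x₁ ≠ 0 ∨ y₁ ≠ 0) (hc : c ≠ 0)
    (hP : ∀ x y, P.quad x y = c * (y₀ * x - x₀ * y) * (y₁ * x - x₁ * y)) {k : ℕ}
    (hk : k = if pt x₀ y₀ h₀ = pt x₁ y₁ h₁ then 2 else 1) :
    (Q.lin x₀ y₀ ≠ 0 → intersectionNumber P.poly Q.poly (pt x₀ y₀ h₀) = k ∧
      (Q.lin x₁ y₁ ≠ 0 → HasOrder P Q 2)) ∧
    (Q.lin x₀ y₀ = 0 → (∃ x y, Q.lin x y ≠ 0) → ∃ k' : ℕ, (k' = 1 ∨ k' = 2) ∧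
      intersectionNumber P.poly Q.poly (pt x₀ y₀ h₀) = (k + k' : ℕ) ∧ HasOrder P Q (2 + k')) ∧
    ((∀ x y, Q.lin x y = 0) →
      intersectionNumber P.poly Q.poly (pt x₀ y₀ h₀) = (2 * k : ℕ) ∧ HasOrder P Q 4) := by
  obtain ⟨d, e₁, e₂, hd, hD, hF⟩ := exists_frame h₀
  rw [intersectionNumber, hF, hF, frameHom_poly, frameHom_poly]
  set P' := subst (d * x₀) (d * y₀) e₁ e₂ P with hP'
  set Q' := subst (d * x₀) (d * y₀) e₁ e₂ Q with hQ'
  have hq1 : P.xx = c * y₀ * y₁ := by simpa [quad] using hP 1 0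
  have hq3 : P.yy = c * x₀ * x₁ := by simpa [quad] using hP 0 1
  have hq2 : P.xy = -c * (x₀ * y₁ + y₀ * x₁) := by
    have := hP 1 1
    simp only [quad] at this
    linear_combination this - hq1 - hq3
  have hPxx : P'.xx = 0 := by rw [hP', subst_xx, quad_smul, hP]; ring
  have hPxy : P'.xy = -c * (d * x₀ * e₂ - d * y₀ * e₁) * (y₁ * x₀ - x₁ * y₀) := by
    simp only [hP', subst, hq1, hq2, hq3]
    ring
  have hPyy : P'.yy = -c * (x₀ * e₂ - y₀ * e₁) * (y₁ * e₁ - x₁ * e₂) := by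
    simp only [hP', subst, hq1, hq2, hq3]
    ring
  have hQxx : Q'.xx = 0 := by simp [hQ', subst, hQ1, hQ2, hQ3]
  have hQxy : Q'.xy = 0 := by simp [hQ', subst, hQ1, hQ2, hQ3]
  have hQyy : Q'.yy = 0 := by simp [hQ', subst, hQ1, hQ2, hQ3]
  have hQxz : Q'.xz = d * Q.lin x₀ y₀ := by
    simp only [hQ', subst, lin]
    ring
  have hQyz : Q'.yz = Q.lin e₁ e₂ := rfl
  have hD' : x₀ * e₂ - y₀ * e₁ ≠ 0 := fun h => hD (by linear_combination d * h)
  have hpt : pt x₀ y₀ h₀ = pt x₁ y₁ h₁ ↔ P'.xy = 0 := by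
    rw [pt_eq_iff, hPxy]
    constructor
    · intro h
      linear_combination -c * (d * x₀ * e₂ - d * y₀ * e₁) * h
    · intro h
      have := (mul_eq_zero.1 h).resolve_left (mul_ne_zero (neg_ne_zero.2 hc) hD)
      linear_combination this
  have hk' : k = lineContribution P' := by
    rw [hk]
    exact if_congr hpt rfl rfl
  have hne : P'.xy ≠ 0 ∨ P'.yy ≠ 0 := by
    by_contra! hcon
    rw [hPxy, hPyy] at hcon
    have k1 := (mul_eq_zero.1 hcon.1).resolve_left (mul_ne_zero (neg_ne_zero.2 hc) hD)
    have k2 := (mul_eq_zero.1 hcon.2).resolve_left (mul_ne_zero (neg_ne_zero.2 hc) hD')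
    rcases h₁ with h | h
    · exact mul_ne_zero h hD' (by linear_combination e₁ * k1 - x₀ * k2)
    · exact mul_ne_zero h hD' (by linear_combination e₂ * k1 - y₀ * k2)
  obtain ⟨g1, g2, g3⟩ := exists_order_of_proportional_normal hPxx hQxx hQxy hQyy hne
    (isRelPrime_subst hD hPQ)
  have hO : ∀ m, HasOrder P' Q' m ↔ HasOrder P Q m := fun m => HasOrder.subst_iff hD
  simp only [hO] at g1 g2 g3
  rw [← hk'] at g1 g2 g3
  -- Cramer's rule, for (x, y) written in the basis (d x₀, d y₀), (e₁, e₂). It translates the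
  -- conditions on Q'.xz and Q'.yz into values of `Q.lin`.
  have hlin : ∀ x y, (d * x₀ * e₂ - d * y₀ * e₁) * Q.lin x y =
      (x * e₂ - y * e₁) * (d * Q.lin x₀ y₀) + d * (x₀ * y - y₀ * x) * Q.lin e₁ e₂ := by
    intro x y
    simp only [lin]
    ring
  refine ⟨fun h => ?_, fun h h' => ?_, fun h => ?_⟩
  · obtain ⟨g, g'⟩ := g1 (by rw [hQxz]; exact mul_ne_zero hd h)
    refine ⟨g, fun h1 => g' ?_⟩
    have : P'.yy * Q'.xz - P'.xy * Q'.yz = c * (x₀ * e₂ - y₀ * e₁) *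
        ((d * x₀ * e₂ - d * y₀ * e₁) * Q.lin x₁ y₁) := by
      rw [hlin, hPxy, hPyy, hQxz, hQyz]
      ring
    rw [this]
    exact mul_ne_zero (mul_ne_zero hc hD') (mul_ne_zero hD h1)
  · refine g2 (by rw [hQxz, h, mul_zero]) fun h0 => ?_
    obtain ⟨x, y, hxy⟩ := h'
    apply mul_ne_zero hD hxy
    rw [hlin, h, ← hQyz, h0]
    ring
  · exact g3 (by rw [hQxz, h, mul_zero]) (by rw [hQyz, h])

/-! ### The divisor cut out on the line at infinity by `Y P - X Q` -/

/-- The divisor of the intersection of `Y P - X Q` with the line at infinity. -/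
theorem intersectionNumber_cubic [DecidableEq LineAtInfinity] {P Q : Conic} {x₁ y₁ x₂ y₂ x₃ y₃ c : ℂ}
    (h₁ : x₁ ≠ 0 ∨ y₁ ≠ 0) (h₂ : x₂ ≠ 0 ∨ y₂ ≠ 0) (h₃ : x₃ ≠ 0 ∨ y₃ ≠ 0) (hc : c ≠ 0)
    (hC : ∀ x y, y * P.quad x y - x * Q.quad x y =
      c * (y₁ * x - x₁ * y) * (y₂ * x - x₂ * y) * (y₃ * x - x₃ * y)) (w : LineAtInfinity) :
    intersectionNumber (X 1 * P.poly - X 0 * Q.poly) (X 2) w =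
      (if w = pt x₁ y₁ h₁ then 1 else 0) + (if w = pt x₂ y₂ h₂ then 1 else 0)
        + (if w = pt x₃ y₃ h₃ then 1 else 0) := by
  obtain ⟨x, y, h, rfl⟩ := exists_pt w
  obtain ⟨d, e₁, e₂, hd, hD, hF⟩ := exists_frame h
  rw [intersectionNumber, hF, hF, map_sub, map_mul, map_mul, frameHom_poly, frameHom_poly]
  set P' := subst (d * x) (d * y) e₁ e₂ P with hP'
  set Q' := subst (d * x) (d * y) e₁ e₂ Q with hQ'
  -- In the chart the linear form y' X - x' Y is a nonzero multiple of u if the point is its zero,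
  -- and a unit at the origin otherwise.
  have hfac : ∀ {x' y' : ℂ} (h' : x' ≠ 0 ∨ y' ≠ 0) (f : MvPolynomial (Fin 2) ℂ),
      affineIntersectionNumber (X 1)
        ((C (y' * (d * x) - x' * (d * y)) + C (y' * e₁ - x' * e₂) * X 0) * f) =
      (if pt x y h = pt x' y' h' then 1 else 0) + affineIntersectionNumber (X 1) f := by
    intro x' y' h' f
    split_ifs with hxy
    · rw [pt_eq_iff] at hxy
      have e0 : y' * (d * x) - x' * (d * y) = 0 := by linear_combination d * hxy
      have hne : y' * e₁ - x' * e₂ ≠ 0 := by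
        intro h0
        rcases h' with h1 | h1
        · exact mul_ne_zero h1 hD (by linear_combination -d * x * h0 + e₁ * e0)
        · exact mul_ne_zero h1 hD (by linear_combination e₂ * e0 - d * y * h0)
      rw [e0, map_zero, zero_add]
      have := affineIntersectionNumber_linear_mul (a := y' * e₁ - x' * e₂) (b := 0) (v := 1)
        (Or.inl hne) (f := X 1) (by simpa [sub_eq_zero, eq_comm] using hne) f
      rw [map_zero, zero_mul, add_zero] at this
      rw [this, affineIntersectionNumber_comm, affineIntersectionNumber_eq_one
        (a := C (y' * e₁ - x' * e₂)) (b := 0) (c := 0) (d := 1) (by ring) (by ring)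
        (by simpa using hne)]
    · rw [pt_eq_iff] at hxy
      rw [affineIntersectionNumber_unit_mul, zero_add]
      simp only [map_add, map_mul, constantCoeff_C, constantCoeff_X, mul_zero, add_zero]
      intro h0
      apply hxy
      refine (mul_eq_zero.1 (?_ : d * (x * y' - y * x') = 0)).resolve_left hd
      linear_combination h0
  have hX0 : frameHom (d * x) (d * y) e₁ e₂ (X 0) = C (d * x) + C e₁ * X 0 := by simp [frameHom]
  have hX1 : frameHom (d * x) (d * y) e₁ e₂ (X 1) = C (d * y) + C e₂ * X 0 := by simp [frameHom]
  have hX2 : frameHom (d * x) (d * y) e₁ e₂ (X 2) = X 1 := by simp [frameHom]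
  have hprod : (C (d * y) + C e₂ * X 0) * (C P'.xx + C P'.xy * X 0 + C P'.yy * X 0 ^ 2)
      - (C (d * x) + C e₁ * X 0) * (C Q'.xx + C Q'.xy * X 0 + C Q'.yy * X 0 ^ 2) =
      (C c * ((C (y₁ * (d * x) - x₁ * (d * y)) + C (y₁ * e₁ - x₁ * e₂) * X 0) *
        ((C (y₂ * (d * x) - x₂ * (d * y)) + C (y₂ * e₁ - x₂ * e₂) * X 0) *
        ((C (y₃ * (d * x) - x₃ * (d * y)) + C (y₃ * e₁ - x₃ * e₂) * X 0) * 1))) :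
          MvPolynomial (Fin 2) ℂ) := by
    apply MvPolynomial.funext
    intro v
    have := hC (d * x + e₁ * v 0) (d * y + e₂ * v 0)
    simp only [map_add, map_sub, map_mul, map_pow, map_one, eval_C, eval_X, hP', hQ', subst]
    simp only [quad] at this
    linear_combination this
  rw [hX0, hX1, hX2]
  -- Modulo Z only the quadratic parts of P and Q survive; all other terms are multiples of `X 1`.
  have hsplit : (C (d * y) + C e₂ * X 0) * P'.loc - (C (d * x) + C e₁ * X 0) * Q'.loc =
      ((C (d * y) + C e₂ * X 0) * (C P'.xx + C P'.xy * X 0 + C P'.yy * X 0 ^ 2)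
      - (C (d * x) + C e₁ * X 0) * (C Q'.xx + C Q'.xy * X 0 + C Q'.yy * X 0 ^ 2))
      + ((C (d * y) + C e₂ * X 0) * (C P'.xz + C P'.yz * X 0 + C P'.zz * X 1)
      - (C (d * x) + C e₁ * X 0) * (C Q'.xz + C Q'.yz * X 0 + C Q'.zz * X 1)) * X 1 := by
    simp only [loc]
    ring
  rw [hsplit, ← affineIntersectionNumber_add_mul, hprod, affineIntersectionNumber_comm,
    affineIntersectionNumber_unit_mul (by simpa using hc), hfac h₁, hfac h₂, hfac h₃,
    affineIntersectionNumber_one_right]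
  ring

end

section

open MvPolynomial Conic

/-! ### The comitants in terms of conics -/

/-- The conic `P = 0` of a system. -/
def conicP (S : QSystem) : Conic :=
  ⟨S .a00, S .a10, S .a01, S .a20, 2 * S .a11, S .a02⟩

/-- The conic `Q = 0` of a system. -/
def conicQ (S : QSystem) : Conic :=
  ⟨S .b00, S .b10, S .b01, S .b20, 2 * S .b11, S .b02⟩

theorem curveP_eq (S : QSystem) : curveP S = (conicP S).poly := rfl

theorem curveQ_eq (S : QSystem) : curveQ S = (conicQ S).poly := rfl

theorem pderiv_two {σ R : Type*} [CommRing R] (i : σ) : pderiv i (2 : MvPolynomial σ R) = 0 := by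
  rw [← map_ofNat C 2, pderiv_C]

/-- The value of a comitant at complex `x`, `y`. -/
def valueC (S : QSystem) (U : PolyRing) (x y : ℂ) : ℂ :=
  aeval (Sum.elim (fun c => (S c : ℂ)) ![x, y]) U

theorem valueC_ofReal (S : QSystem) (U : PolyRing) (x y : ℝ) :
    valueC S U x y = (value S U x y : ℂ) := by
  unfold valueC value
  have : (Sum.elim (fun c => (S c : ℂ)) ![(x : ℂ), (y : ℂ)]) =
      algebraMap ℝ ℂ ∘ (Sum.elim S ![x, y]) := by
    ext i
    rcases i with c | i
    · rfl
    · fin_cases i <;> rfl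
  rw [this, aeval_algebraMap_apply]
  rfl

/-- A polynomial vanishing on ℝ² is the zero polynomial, hence vanishes on ℂ². This makes the
complex zeros of the binary forms available. -/
theorem vanishes_iff (S : QSystem) (U : PolyRing) :
    Vanishes S U ↔ ∀ x y : ℂ, valueC S U x y = 0 := by
  constructor
  · intro h
    let V : MvPolynomial (Fin 2) ℝ := aeval (Sum.elim (fun c => C (S c)) X) U
    have hV : V = 0 := by
      apply MvPolynomial.funext
      intro v
      rw [map_zero, ← h (v 0) (v 1)]
      unfold value
      rw [← coe_aeval_eq_eval, RingHom.coe_coe, ← AlgHom.comp_apply, ← coe_aeval_eq_eval, RingHom.coe_coe]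
      congr 1
      ext1 i
      rcases i with c | i
      · simp
      · fin_cases i <;> simp
    intro x y
    have : valueC S U x y = aeval ![x, y] V := by
      unfold valueC
      rw [← AlgHom.comp_apply]
      congr 1
      ext1 i
      rcases i with c | i
      · simp
      · fin_cases i <;> simp
    rw [this, hV, map_zero]
  · intro h x y
    have := h x y
    rw [valueC_ofReal] at this
    exact_mod_cast this

/-! ### The operator `𝓛` as a derivative -/

/-- The coefficients of the system obtained by `Z ↦ Z + t (x Y - y X)`. -/
def shiftedCoef (S : QSystem) (x y : ℂ) : Coef → Polynomial ℂ
  | .a00 => Polynomial.C (S .a00 : ℂ)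
  | .a10 => Polynomial.C (S .a10 : ℂ) + Polynomial.C (-2 * y * S .a00) * Polynomial.X
  | .a01 => Polynomial.C (S .a01 : ℂ) + Polynomial.C (2 * x * S .a00) * Polynomial.X
  | .a20 => restrA (conicP S) x y
  | .a11 => Polynomial.C (1 / 2 : ℂ) * restrB (conicP S) x y
  | .a02 => restrE (conicP S) x y
  | .b00 => Polynomial.C (S .b00 : ℂ)
  | .b10 => Polynomial.C (S .b10 : ℂ) + Polynomial.C (-2 * y * S .b00) * Polynomial.X
  | .b01 => Polynomial.C (S .b01 : ℂ) + Polynomial.C (2 * x * S .b00) * Polynomial.X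
  | .b20 => restrA (conicQ S) x y
  | .b11 => Polynomial.C (1 / 2 : ℂ) * restrB (conicQ S) x y
  | .b02 => restrE (conicQ S) x y

/-- Evaluation of a comitant along `Z ↦ Z + t (x Y - y X)`, as a polynomial in `t`. -/
def shiftHom (S : QSystem) (x y : ℂ) : PolyRing →ₐ[ℝ] Polynomial ℂ :=
  aeval (Sum.elim (shiftedCoef S x y) ![Polynomial.C x, Polynomial.C y])

theorem opL_C (r : ℝ) : opL (C r) = 0 := by
  simp [opL, opL1, opL2, dco]

theorem opL_add (U V : PolyRing) : opL (U + V) = opL U + opL V := by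
  simp only [opL, opL1, opL2, dco, map_add]
  ring

theorem opL_mul (U V : PolyRing) : opL (U * V) = opL U * V + U * opL V := by
  simp only [opL, opL1, opL2, dco, Derivation.leibniz, smul_eq_mul]
  ring

/-- The shifted coefficients are an integral curve of the vector field 𝓛; this is checked on each of
the twelve coefficients, while x and y stay constant. -/
theorem derivative_shiftHom_X (S : QSystem) (x y : ℂ) (i : Coef ⊕ Fin 2) :
    Polynomial.derivative (shiftHom S x y (X i)) = shiftHom S x y (opL (X i)) := by
  classical
  have hhalf : (2 : Polynomial ℂ) * Polynomial.C (1 / 2) = 1 := by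
    rw [← map_ofNat Polynomial.C 2, ← map_mul]
    norm_num
  have hC : ∀ r : ℝ, shiftHom S x y (C r) = Polynomial.C (r : ℂ) := fun r => algHom_C _ r
  have hco : ∀ c, shiftHom S x y (X (Sum.inl c)) = shiftedCoef S x y c := fun c => by
    simp [shiftHom]
  have hx : shiftHom S x y (X (Sum.inr 0)) = Polynomial.C x := by simp [shiftHom]
  have hy : shiftHom S x y (X (Sum.inr 1)) = Polynomial.C y := by simp [shiftHom]
  have hhalf' : shiftHom S x y (C (1 / 2)) = Polynomial.C (1 / 2) := by
    rw [hC]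
    norm_num
  rcases i with c | i
  · rw [hco]
    cases c <;>
      simp only [shiftedCoef, restrA, restrB, restrE, Polynomial.derivative_add,
        Polynomial.derivative_C_mul, Polynomial.derivative_C, Polynomial.derivative_X,
        Polynomial.derivative_X_pow, Nat.cast_ofNat, Nat.add_one_sub_one, pow_one] <;>
      simp only [opL, opL1, opL2, dco, co, vx, vy, pderiv_X, Pi.single_apply, Sum.inl.injEq,
        reduceCtorEq, if_true, if_false, mul_zero, mul_one, add_zero, zero_add, sub_zero, zero_sub,
        map_zero, map_sub, map_neg, map_mul, hco, hx, hy, hhalf', map_ofNat,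
        shiftedCoef, conicP, conicQ, map_pow] <;>
      ring
  · fin_cases i <;>
      simp [shiftHom, opL, opL1, opL2, dco, pderiv_X]

/-- Both sides are additive, vanish on constants and obey the Leibniz rule along `shiftHom`, so
agreement on the variables is enough. -/
theorem derivative_shiftHom (S : QSystem) (x y : ℂ) (U : PolyRing) :
    Polynomial.derivative (shiftHom S x y U) = shiftHom S x y (opL U) := by
  induction U using MvPolynomial.induction_on with
  | C r =>
    rw [opL_C, map_zero, algHom_C]
    exact Polynomial.derivative_C
  | add U V hU hV => rw [opL_add, map_add, map_add, map_add, hU, hV]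
  | mul_X U i hU =>
    rw [opL_mul, map_mul, Polynomial.derivative_mul, hU, derivative_shiftHom_X, map_add, map_mul,
      map_mul]

theorem resultant_quadratic {R : Type*} [CommRing R] (a b e a' b' e' : R) :
    Polynomial.resultant
      (Polynomial.C a * Polynomial.X ^ 2 + Polynomial.C b * Polynomial.X + Polynomial.C e)
      (Polynomial.C a' * Polynomial.X ^ 2 + Polynomial.C b' * Polynomial.X + Polynomial.C e')
      2 2 = quadRes a b e a' b' e' := by
  simp only [Polynomial.resultant, Polynomial.sylvester]
  rw [Matrix.det_succ_row_zero]
  simp [Matrix.det_fin_three, Fin.sum_univ_succ, Fin.addCases, Fin.succAbove, Polynomial.coeff_X, Polynomial.coeff_C, quadRes]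
  ring

theorem shiftHom_mu0 (S : QSystem) (x y : ℂ) :
    shiftHom S x y mu0 = lineRes (conicP S) (conicQ S) x y := by
  rw [mu0, resultant_quadratic]
  simp only [quadRes, lineRes, map_sub, map_mul, map_pow, map_ofNat]
  have h2 : ∀ p : Polynomial ℂ, 2 * (Polynomial.C (1 / 2 : ℂ) * p) = p := by
    intro p
    rw [← mul_assoc, ← map_ofNat Polynomial.C 2, ← map_mul]
    norm_num
  simp only [shiftHom, co, aeval_X, Sum.elim_inl, shiftedCoef, h2]

theorem eval_zero_shiftHom (S : QSystem) (x y : ℂ) (U : PolyRing) :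
    (shiftHom S x y U).eval 0 = valueC S U x y := by
  rw [valueC, shiftHom, ← Polynomial.coe_aeval_eq_eval, ← AlgHom.restrictScalars_apply ℝ,
    ← AlgHom.comp_apply]
  congr 1
  ext1 i
  rcases i with c | i
  · cases c <;> simp [shiftedCoef, restrA, restrB, restrE, conicP, conicQ]
  · fin_cases i <;> simp

/-- `shiftHom` sends `mu0` to the resultant on the line Z = t (x Y - y X), and 𝓛 to d/dt; dividing
the i-th derivative at t = 0 by i! leaves the i-th Taylor coefficient. -/
theorem valueC_mu (S : QSystem) (i : ℕ) (x y : ℂ) :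
    valueC S (mu i) x y = (lineRes (conicP S) (conicQ S) x y).coeff i := by
  have h1 : ∀ U, shiftHom S x y (opL^[i] U) = Polynomial.derivative^[i] (shiftHom S x y U) := by
    induction i with
    | zero => intro U; rfl
    | succ i ih => intro U; rw [Function.iterate_succ_apply, Function.iterate_succ_apply, ih,
        derivative_shiftHom]
  have h2 : valueC S (mu i) x y = (1 / (i.factorial : ℂ)) * valueC S (opL^[i] mu0) x y := by
    simp [mu, valueC]
  rw [h2, ← eval_zero_shiftHom, h1, shiftHom_mu0, ← Polynomial.coeff_zero_eq_eval_zero,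
    Polynomial.coeff_iterate_derivative, zero_add, Nat.descFactorial_self, nsmul_eq_mul,
    ← mul_assoc, one_div, inv_mul_cancel₀ (by exact_mod_cast i.factorial_ne_zero), one_mul]

theorem firstMu_iff (S : QSystem) (m : ℕ) : FirstMu S m ↔ HasOrder (conicP S) (conicQ S) m := by
  simp only [FirstMu, HasOrder, vanishes_iff, valueC_mu, not_forall, ne_eq]

/-! ### Explicit values of the comitants -/

section Values

variable (S : QSystem)

/-- First coefficient of `M / 8`. -/
def hess0 (P Q : Conic) : ℂ := -3 * Q.xx * (P.xy - Q.yy) - (P.xx - Q.xy) ^ 2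

/-- Second coefficient of `M / 8`. -/
def hess1 (P Q : Conic) : ℂ := -9 * Q.xx * P.yy - (P.xx - Q.xy) * (P.xy - Q.yy)

/-- Third coefficient of `M / 8`. -/
def hess2 (P Q : Conic) : ℂ := 3 * (P.xx - Q.xy) * P.yy - (P.xy - Q.yy) ^ 2

theorem valueC_M (x y : ℂ) : valueC S M x y =
    8 * (hess0 (conicP S) (conicQ S) * x ^ 2 + hess1 (conicP S) (conicQ S) * x * y
      + hess2 (conicP S) (conicQ S) * y ^ 2) := by
  classical
  simp [valueC, M, hess, C2, p2, q2, dx, dy, co, vx, vy, pderiv_X, pderiv_two,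
    hess0, hess1, hess2, conicP, conicQ, Derivation.leibniz]
  ring

theorem valueC_K (x y : ℂ) : valueC S K x y =
    2 * (((conicP S).xx * (conicQ S).xy - (conicQ S).xx * (conicP S).xy) * x ^ 2
      + 2 * ((conicP S).xx * (conicQ S).yy - (conicQ S).xx * (conicP S).yy) * x * y
      + ((conicP S).xy * (conicQ S).yy - (conicQ S).xy * (conicP S).yy) * y ^ 2) := by
  classical
  simp [valueC, K, jacob, p2, q2, dx, dy, co, vx, vy, pderiv_X, pderiv_two,
    conicP, conicQ, Derivation.leibniz]
  ring

theorem valueC_H (x y : ℂ) : valueC S H x y =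
    -((y * (conicP S).xy - x * (conicQ S).xy) ^ 2
      - 4 * (y * (conicP S).xx - x * (conicQ S).xx) * (y * (conicP S).yy - x * (conicQ S).yy)) := by
  simp [valueC, H, discrim, co, vx, vy, conicP, conicQ]

theorem valueC_L (x y : ℂ) : valueC S L x y =
    4 * valueC S K x y + 8 * valueC S H x y - valueC S M x y := by
  simp [valueC, L]

theorem valueC_K1 (x y : ℂ) : valueC S K1 x y =
    (conicP S).lin x y * (conicQ S).quad x y - (conicP S).quad x y * (conicQ S).lin x y := by
  simp [valueC, K1, p1, q1, p2, q2, co, vx, vy, conicP, conicQ, lin, quad]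

theorem valueC_kappa (x y : ℂ) : valueC S kappa x y =
    64 * (hess0 (conicP S) (conicQ S) *
        ((conicP S).xy * (conicQ S).yy - (conicQ S).xy * (conicP S).yy)
      - hess1 (conicP S) (conicQ S) *
        ((conicP S).xx * (conicQ S).yy - (conicQ S).xx * (conicP S).yy)
      + hess2 (conicP S) (conicQ S) *
        ((conicP S).xx * (conicQ S).xy - (conicQ S).xx * (conicP S).xy)) := by
  classical
  simp [valueC, kappa, transvectant2, M, hess, K, jacob, C2, p2, q2, dx, dy, co, vx, vy, pderiv_X,
    pderiv_two, hess0, hess1, hess2, conicP, conicQ, Derivation.leibniz]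
  ring

theorem valueC_kappa1 (x y : ℂ) : valueC S kappa1 x y =
    16 * (2 * hess0 (conicP S) (conicQ S) * (conicP S).yz
      - hess1 (conicP S) (conicQ S) * ((conicP S).xz - (conicQ S).yz)
      - 2 * hess2 (conicP S) (conicQ S) * (conicQ S).xz) := by
  classical
  simp [valueC, kappa1, transvectant2, M, hess, C1, C2, p1, q1, p2, q2, dx, dy, co, vx, vy,
    pderiv_X, pderiv_two, hess0, hess1, hess2, conicP, conicQ, Derivation.leibniz]
  ring

end Values

end

section

open Conic ComplexConjugate

/-! ### Real points -/

/-- The equation says that the point equals its complex conjugate. A real representative is then [1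
: y/x : 0], or [0 : 1 : 0] if x = 0. -/
theorem isRealPoint_pt_iff {x y : ℂ} (h : x ≠ 0 ∨ y ≠ 0) :
    IsRealPoint (pt x y h) ↔ x * conj y - y * conj x = 0 := by
  constructor
  · rintro ⟨v, hv, he⟩
    simp only [pt] at he
    rw [Projectivization.mk_eq_mk_iff] at he
    obtain ⟨a, ha⟩ := he
    have h0 := congrFun ha 0
    have h1 := congrFun ha 1
    simp [Units.smul_def] at h0 h1
    rw [← h0, ← h1]
    simp
    ring
  · intro h0
    by_cases hx : x = 0
    · have hy : y ≠ 0 := by simpa [hx] using h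
      refine ⟨![0, 1, 0], fun h => by simpa using congrFun h 1, ?_⟩
      simp only [pt]
      rw [Projectivization.mk_eq_mk_iff']
      refine ⟨y, ?_⟩
      ext i
      fin_cases i <;> simp [hx]
    · have hreal : conj (y / x) = y / x := by
        rw [map_div₀]
        have : conj x ≠ 0 := by simpa using hx
        field_simp
        linear_combination h0
      refine ⟨![1, (y / x).re, 0], fun h => by simpa using congrFun h 0, ?_⟩
      simp only [pt]
      rw [Projectivization.mk_eq_mk_iff']
      refine ⟨x, ?_⟩
      ext i
      fin_cases i
      · simp
      · have := Complex.conj_eq_iff_re.1 hreal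
        simp [this]
        field_simp
      · simp

theorem isRealPoint_ofReal {x y : ℝ} (h : (x : ℂ) ≠ 0 ∨ (y : ℂ) ≠ 0) :
    IsRealPoint (pt x y h) := by
  rw [isRealPoint_pt_iff]
  simp
  ring

/-! ### The roots of the cubic form `y p₂ - x q₂` -/

/-- The zeros of `y p₂ - x q₂` are `w₁`, `w₂`, `w₃`, with multiplicities. -/
def CubicRoots (P Q : Conic) (w₁ w₂ w₃ : LineAtInfinity) : Prop :=
  ∃ (x₁ y₁ x₂ y₂ x₃ y₃ c : ℂ) (h₁ : x₁ ≠ 0 ∨ y₁ ≠ 0) (h₂ : x₂ ≠ 0 ∨ y₂ ≠ 0)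
    (h₃ : x₃ ≠ 0 ∨ y₃ ≠ 0), c ≠ 0 ∧ w₁ = pt x₁ y₁ h₁ ∧ w₂ = pt x₂ y₂ h₂ ∧ w₃ = pt x₃ y₃ h₃ ∧
      ∀ x y, y * P.quad x y - x * Q.quad x y =
        c * (y₁ * x - x₁ * y) * (y₂ * x - x₂ * y) * (y₃ * x - x₃ * y)

namespace CubicRoots

variable {P Q : Conic} {w₁ w₂ w₃ : LineAtInfinity}

theorem perm132 (h : CubicRoots P Q w₁ w₂ w₃) : CubicRoots P Q w₁ w₃ w₂ := by
  obtain ⟨x₁, y₁, x₂, y₂, x₃, y₃, c, h₁, h₂, h₃, hc, e₁, e₂, e₃, hC⟩ := h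
  exact ⟨x₁, y₁, x₃, y₃, x₂, y₂, c, h₁, h₃, h₂, hc, e₁, e₃, e₂,
    fun x y => by rw [hC]; ring⟩

theorem perm213 (h : CubicRoots P Q w₁ w₂ w₃) : CubicRoots P Q w₂ w₁ w₃ := by
  obtain ⟨x₁, y₁, x₂, y₂, x₃, y₃, c, h₁, h₂, h₃, hc, e₁, e₂, e₃, hC⟩ := h
  exact ⟨x₂, y₂, x₁, y₁, x₃, y₃, c, h₂, h₁, h₃, hc, e₂, e₁, e₃,
    fun x y => by rw [hC]; ring⟩

theorem divisor [DecidableEq LineAtInfinity] (h : CubicRoots P Q w₁ w₂ w₃) (w : LineAtInfinity) :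
    intersectionNumber (MvPolynomial.X 1 * P.poly - MvPolynomial.X 0 * Q.poly)
      (MvPolynomial.X 2) w =
      (if w = w₁ then 1 else 0) + (if w = w₂ then 1 else 0) + (if w = w₃ then 1 else 0) := by
  obtain ⟨x₁, y₁, x₂, y₂, x₃, y₃, c, h₁, h₂, h₃, hc, rfl, rfl, rfl, hC⟩ := h
  exact intersectionNumber_cubic h₁ h₂ h₃ hc hC w

/-- Both factorizations compute the divisor of the same curve on Z = 0, and a multiset is determined
by its counts. -/
theorem unique (h : CubicRoots P Q w₁ w₂ w₃) {v₁ v₂ v₃ : LineAtInfinity}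
    (h' : CubicRoots P Q v₁ v₂ v₃) :
    ({w₁, w₂, w₃} : Multiset LineAtInfinity) = {v₁, v₂, v₃} := by
  classical
  have hcount : ∀ a b c w : LineAtInfinity,
      ((({a, b, c} : Multiset LineAtInfinity).count w : ℕ) : ℕ∞) =
        (if w = a then 1 else 0) + (if w = b then 1 else 0) + (if w = c then 1 else 0) := by
    intro a b c w
    simp only [Multiset.insert_eq_cons, Multiset.count_cons, Multiset.count_singleton]
    push_cast
    ring
  ext w
  have := (h.divisor w).symm.trans (h'.divisor w)
  rw [← hcount, ← hcount] at this
  exact_mod_cast this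

end CubicRoots

/-! ### Factorization of binary forms -/

section Factor

variable {F : Type*} [Field F]

theorem exists_quadratic_factor {a b e x₀ y₀ : F} (h : x₀ ≠ 0 ∨ y₀ ≠ 0)
    (h0 : a * x₀ ^ 2 + b * x₀ * y₀ + e * y₀ ^ 2 = 0) :
    ∃ x₁ y₁ : F, a = y₀ * y₁ ∧ b = -(y₀ * x₁ + x₀ * y₁) ∧ e = x₀ * x₁ := by
  by_cases hx : x₀ = 0
  · have hy : y₀ ≠ 0 := by simpa [hx] using h
    have he : e = 0 := by simpa [hx, hy] using h0
    refine ⟨-b / y₀, a / y₀, ?_, ?_, ?_⟩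
    · field_simp
    · rw [hx]
      field_simp
      ring
    · rw [hx, he, zero_mul]
  · refine ⟨e / x₀, -(b + y₀ * (e / x₀)) / x₀, ?_, ?_, ?_⟩
    · field_simp
      linear_combination h0
    · field_simp
      ring
    · field_simp

theorem exists_quadratic_split [NeZero (2 : F)] {a b e s : F} (h : s ^ 2 = b ^ 2 - 4 * a * e) :
    ∃ x₁ y₁ x₂ y₂ : F, a = y₁ * y₂ ∧ b = -(y₁ * x₂ + x₁ * y₂) ∧ e = x₁ * x₂ := by
  have h2 : (2 : F) ≠ 0 := two_ne_zero
  by_cases ha : a = 0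
  · exact ⟨-1, 0, -e, b, by rw [ha]; ring, by ring, by ring⟩
  · refine ⟨(-b + s) / 2, a, (-b - s) / (2 * a), 1, by ring, ?_, ?_⟩
    · field_simp
      ring
    · field_simp
      linear_combination h

theorem exists_cubic_factor {k₀ k₁ k₂ k₃ x₀ y₀ : F} (h : x₀ ≠ 0 ∨ y₀ ≠ 0)
    (h0 : k₀ * x₀ ^ 3 + k₁ * x₀ ^ 2 * y₀ + k₂ * x₀ * y₀ ^ 2 + k₃ * y₀ ^ 3 = 0) :
    ∃ a b e : F, k₀ = y₀ * a ∧ k₁ = y₀ * b - x₀ * a ∧ k₂ = y₀ * e - x₀ * b ∧ k₃ = -x₀ * e := by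
  by_cases hx : x₀ = 0
  · have hy : y₀ ≠ 0 := by simpa [hx] using h
    have he : k₃ = 0 := by simpa [hx, hy] using h0
    refine ⟨k₀ / y₀, k₁ / y₀, k₂ / y₀, ?_, ?_, ?_, ?_⟩
    · field_simp
    · rw [hx]
      field_simp
      ring
    · rw [hx]
      field_simp
      ring
    · rw [hx, he]
      ring
  · refine ⟨(y₀ * ((y₀ * (-k₃ / x₀) - k₂) / x₀) - k₁) / x₀, (y₀ * (-k₃ / x₀) - k₂) / x₀,
      -k₃ / x₀, ?_, ?_, ?_, ?_⟩
    · field_simp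
      linear_combination h0
    · field_simp
      ring
    · field_simp
      ring
    · field_simp

end Factor

theorem exists_real_root_cubic (k₀ k₁ k₂ k₃ : ℝ) : ∃ x y : ℝ, (x ≠ 0 ∨ y ≠ 0) ∧
    k₀ * x ^ 3 + k₁ * x ^ 2 * y + k₂ * x * y ^ 2 + k₃ * y ^ 3 = 0 := by
  by_cases h0 : k₀ = 0
  · exact ⟨1, 0, by simp, by simp [h0]⟩
  · obtain ⟨a, ha⟩ : ∃ a, a = k₁ / k₀ := ⟨_, rfl⟩
    obtain ⟨b, hb⟩ : ∃ b, b = k₂ / k₀ := ⟨_, rfl⟩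
    obtain ⟨d, hd⟩ : ∃ d, d = k₃ / k₀ := ⟨_, rfl⟩
    -- A bound of Cauchy type: at x = ± B the cubic term dominates, so the intermediate value
    -- theorem applies on [-B, B].
    set B := 1 + |a| + |b| + |d| with hB
    have hB1 : 1 ≤ B := by
      rw [hB]
      linarith [abs_nonneg a, abs_nonneg b, abs_nonneg d]
    have hbound : ∀ x : ℝ, |x| = B → |a * x ^ 2 + b * x + d| < B ^ 3 := by
      intro x hx
      have h1 : |a * x ^ 2 + b * x + d| ≤ |a| * B ^ 2 + |b| * B + |d| := by
        refine (abs_add_three _ _ _).trans ?_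
        rw [abs_mul, abs_mul, abs_pow, hx]
      have h2 : |b| * B ≤ |b| * B ^ 2 :=
        mul_le_mul_of_nonneg_left (by nlinarith) (abs_nonneg b)
      have h3 : |d| ≤ |d| * B ^ 2 := by
        have := mul_le_mul_of_nonneg_left (show 1 ≤ B ^ 2 by nlinarith) (abs_nonneg d)
        linarith
      have h4 : B ^ 3 = B ^ 2 + (|a| + |b| + |d|) * B ^ 2 := by
        rw [hB]
        ring
      nlinarith
    have hcont : ContinuousOn (fun x : ℝ => x ^ 3 + (a * x ^ 2 + b * x + d)) (Set.Icc (-B) B) := by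
      fun_prop
    have h1 := abs_lt.1 (hbound B (abs_of_pos (by linarith)))
    have h2 := abs_lt.1 (hbound (-B) (by rw [abs_neg]; exact abs_of_pos (by linarith)))
    have hlow : (-B) ^ 3 + (a * (-B) ^ 2 + b * (-B) + d) ≤ 0 := by
      have : (-B) ^ 3 = -B ^ 3 := by ring
      linarith [h2.2]
    have hhigh : 0 ≤ B ^ 3 + (a * B ^ 2 + b * B + d) := by linarith [h1.1]
    obtain ⟨x, -, hx⟩ := intermediate_value_Icc (by linarith : -B ≤ B) hcont
      (show (0 : ℝ) ∈ _ from ⟨hlow, hhigh⟩)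
    refine ⟨x, 1, by simp, ?_⟩
    have hx' : x ^ 3 + (a * x ^ 2 + b * x + d) = 0 := hx
    rw [ha, hb, hd] at hx'
    field_simp at hx'
    linear_combination hx'

end

section

open Conic ComplexConjugate

/-! ### The type of the cubic form `y p₂ - x q₂` of a real system -/

section CubicType

variable {S : QSystem}

theorem cubic_eq (S : QSystem) (x y : ℂ) :
    y * (conicP S).quad x y - x * (conicQ S).quad x y =
      -(S .b20) * x ^ 3 + (S .a20 - 2 * S .b11) * x ^ 2 * y
        + (2 * S .a11 - S .b02) * x * y ^ 2 + S .a02 * y ^ 3 := by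
  simp only [quad, conicP, conicQ]
  ring

theorem value_eta (S : QSystem) : value S eta 0 0 =
    (S .a20 - 2 * S .b11) ^ 2 * (2 * S .a11 - S .b02) ^ 2
      - 4 * (-S .b20) * (2 * S .a11 - S .b02) ^ 3 - 4 * (S .a20 - 2 * S .b11) ^ 3 * S .a02
      - 27 * (-S .b20) ^ 2 * S .a02 ^ 2
      + 18 * (-S .b20) * (S .a20 - 2 * S .b11) * (2 * S .a11 - S .b02) * S .a02 := by
  simp [value, eta, Cubic.discr, co]

theorem vanishes_M_iff (S : QSystem) : Vanishes S M ↔ hess0 (conicP S) (conicQ S) = 0 ∧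
    hess1 (conicP S) (conicQ S) = 0 ∧ hess2 (conicP S) (conicQ S) = 0 := by
  rw [vanishes_iff]
  simp only [valueC_M]
  constructor
  · intro h
    have h1 := h 1 0
    have h2 := h 0 1
    have h3 := h 1 1
    simp at h1 h2 h3
    exact ⟨h1, by linear_combination h3 - h1 - h2, h2⟩
  · rintro ⟨h1, h2, h3⟩ x y
    rw [h1, h2, h3]
    ring

/-- The discriminant of the Hessian form of a binary cubic is -3 times the discriminant of the cubic
(for M / 8, in this normalization). -/
theorem value_eta_of_vanishes_M (h : Vanishes S M) : value S eta 0 0 = 0 := by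
  obtain ⟨h0, h1, h2⟩ := (vanishes_M_iff S).1 h
  have key : (3 * (value S eta 0 0 : ℝ) : ℂ) =
      4 * hess0 (conicP S) (conicQ S) * hess2 (conicP S) (conicQ S)
        - hess1 (conicP S) (conicQ S) ^ 2 := by
    rw [value_eta]
    simp only [hess0, hess1, hess2, conicP, conicQ]
    push_cast
    ring
  rw [h0, h1, h2] at key
  have : (value S eta 0 0 : ℂ) = 0 := by linear_combination key / 3
  exact_mod_cast this

/-- Comparison of the coefficients of two binary cubic forms. -/
theorem cubic_coeff_eq {k₀ k₁ k₂ k₃ l₀ l₁ l₂ l₃ : ℂ}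
    (h : ∀ x y : ℂ, k₀ * x ^ 3 + k₁ * x ^ 2 * y + k₂ * x * y ^ 2 + k₃ * y ^ 3 =
      l₀ * x ^ 3 + l₁ * x ^ 2 * y + l₂ * x * y ^ 2 + l₃ * y ^ 3) :
    k₀ = l₀ ∧ k₁ = l₁ ∧ k₂ = l₂ ∧ k₃ = l₃ := by
  have h1 := h 1 0
  have h2 := h 0 1
  have h3 := h 1 1
  have h4 := h 1 (-1)
  simp at h1 h2
  exact ⟨h1, by linear_combination (h3 - h4) / 2 - h2, by linear_combination (h3 + h4) / 2 - h1, h2⟩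

/-- For a cubic ℓ² m the Hessian is a nonzero constant times [ℓ, m]² ℓ², where [ℓ, m] is the
determinant of the two linear forms; it vanishes exactly when m is proportional to ℓ. -/
theorem vanishes_M_iff_of_double {p r : LineAtInfinity}
    (h : CubicRoots (conicP S) (conicQ S) p p r) : Vanishes S M ↔ p = r := by
  obtain ⟨x₁, y₁, x₂, y₂, x₃, y₃, c, h₁, h₂, h₃, hc, e₁, e₂, rfl, hC⟩ := h
  obtain ⟨d, hd, rfl, rfl⟩ := exists_smul_of_pt_eq (e₂.symm.trans e₁)
  rw [e₁, pt_eq_iff, vanishes_M_iff]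
  have hk : ∀ x y, -(S .b20 : ℂ) * x ^ 3 + (S .a20 - 2 * S .b11) * x ^ 2 * y
        + (2 * S .a11 - S .b02) * x * y ^ 2 + S .a02 * y ^ 3 =
      (c * d * y₁ ^ 2 * y₃) * x ^ 3 + (-c * d * (2 * x₁ * y₁ * y₃ + y₁ ^ 2 * x₃)) * x ^ 2 * y
        + (c * d * (x₁ ^ 2 * y₃ + 2 * x₁ * y₁ * x₃)) * x * y ^ 2
        + (-c * d * x₁ ^ 2 * x₃) * y ^ 3 := by
    intro x y
    rw [← cubic_eq, hC]
    ring
  obtain ⟨k0, k1, k2, k3⟩ := cubic_coeff_eq hk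
  have e0 : hess0 (conicP S) (conicQ S) = -(c * d * y₁ * (x₁ * y₃ - y₁ * x₃)) ^ 2 := by
    have : hess0 (conicP S) (conicQ S) = 3 * (-(S .b20 : ℂ)) * (2 * S .a11 - S .b02)
      - (S .a20 - 2 * S .b11) ^ 2 := by
      simp only [hess0, conicP, conicQ]
      ring
    rw [this, k0, k1, k2]
    ring
  have e1 : hess1 (conicP S) (conicQ S) =
      2 * (c * d * (x₁ * y₃ - y₁ * x₃)) ^ 2 * x₁ * y₁ := by
    have : hess1 (conicP S) (conicQ S) = 9 * (-(S .b20 : ℂ)) * S .a02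
      - (S .a20 - 2 * S .b11) * (2 * S .a11 - S .b02) := by
      simp only [hess1, conicP, conicQ]
      ring
    rw [this, k0, k1, k2, k3]
    ring
  have e2 : hess2 (conicP S) (conicQ S) = -(c * d * x₁ * (x₁ * y₃ - y₁ * x₃)) ^ 2 := by
    have : hess2 (conicP S) (conicQ S) = 3 * (S .a20 - 2 * S .b11) * (S .a02 : ℂ)
      - (2 * S .a11 - S .b02) ^ 2 := by
      simp only [hess2, conicP, conicQ]
    rw [this, k1, k2, k3]
    ring
  rw [e0, e1, e2]
  constructor
  · rintro ⟨g0, -, g2⟩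
    rcases h₁ with h | h
    · simpa [hc, hd, h] using g2
    · simpa [hc, hd, h] using g0
  · intro h
    rw [h]
    simp

/-- A real linear factor of `y p₂ - x q₂` and its complement. -/
theorem exists_real_factor (S : QSystem)
    (hne : ¬ (S .b20 = 0 ∧ S .a20 = 2 * S .b11 ∧ S .b02 = 2 * S .a11 ∧ S .a02 = 0)) :
    ∃ x₀ y₀ a b e : ℝ, (x₀ ≠ 0 ∨ y₀ ≠ 0) ∧ ¬ (a = 0 ∧ b = 0 ∧ e = 0) ∧
      (∀ x y : ℂ, y * (conicP S).quad x y - x * (conicQ S).quad x y =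
        (y₀ * x - x₀ * y) * (a * x ^ 2 + b * x * y + e * y ^ 2)) ∧
      value S eta 0 0 = (b ^ 2 - 4 * a * e) * (a * x₀ ^ 2 + b * x₀ * y₀ + e * y₀ ^ 2) ^ 2 := by
  obtain ⟨x₀, y₀, h₀, hr⟩ := exists_real_root_cubic (-S .b20) (S .a20 - 2 * S .b11)
    (2 * S .a11 - S .b02) (S .a02)
  obtain ⟨a, b, e, k0, k1, k2, k3⟩ := exists_cubic_factor h₀ hr
  refine ⟨x₀, y₀, a, b, e, h₀, ?_, ?_, ?_⟩
  · rintro ⟨rfl, rfl, rfl⟩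
    apply hne
    simp only [mul_zero, sub_zero] at k0 k1 k2 k3
    exact ⟨by linarith, by linarith, by linarith, k3⟩
  · intro x y
    have k0' : (-(S .b20) : ℂ) = y₀ * a := by exact_mod_cast congrArg (fun t : ℝ => (t : ℂ)) k0
    have k1' : (S .a20 - 2 * S .b11 : ℂ) = y₀ * b - x₀ * a := by
      exact_mod_cast congrArg (fun t : ℝ => (t : ℂ)) k1
    have k2' : (2 * S .a11 - S .b02 : ℂ) = y₀ * e - x₀ * b := by
      exact_mod_cast congrArg (fun t : ℝ => (t : ℂ)) k2
    have k3' : (S .a02 : ℂ) = -x₀ * e := by exact_mod_cast congrArg (fun t : ℝ => (t : ℂ)) k3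
    rw [cubic_eq, k0', k1', k2', k3']
    ring
  -- For a linear form ℓ with zero (x₀, y₀) and a quadratic form g, the discriminant of ℓ g is that
  -- of g times the square of their resultant g(x₀, y₀).
  · rw [value_eta, k0, k1, k2, k3]
    ring

theorem cubicRoots_of_factor {x₀ y₀ x₁ y₁ x₂ y₂ : ℂ} {a b e : ℂ} {P Q : Conic}
    (h₀ : x₀ ≠ 0 ∨ y₀ ≠ 0) (h₁ : x₁ ≠ 0 ∨ y₁ ≠ 0) (h₂ : x₂ ≠ 0 ∨ y₂ ≠ 0)
    (hC : ∀ x y : ℂ, y * P.quad x y - x * Q.quad x y =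
        (y₀ * x - x₀ * y) * (a * x ^ 2 + b * x * y + e * y ^ 2))
    (ha : a = y₁ * y₂) (hb : b = -(y₁ * x₂ + x₁ * y₂)) (he : e = x₁ * x₂) :
    CubicRoots P Q (pt x₀ y₀ h₀) (pt x₁ y₁ h₁) (pt x₂ y₂ h₂) := by
  refine ⟨x₀, y₀, x₁, y₁, x₂, y₂, 1, h₀, h₁, h₂, one_ne_zero, rfl, rfl, rfl, fun x y => ?_⟩
  rw [hC, ha, hb, he]
  ring

theorem ne_zero_of_quadratic_split {F : Type*} [Field F] {a b e x₁ y₁ x₂ y₂ : F}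
    (hne : ¬ (a = 0 ∧ b = 0 ∧ e = 0))
    (ha : a = y₁ * y₂) (hb : b = -(y₁ * x₂ + x₁ * y₂)) (he : e = x₁ * x₂) :
    (x₁ ≠ 0 ∨ y₁ ≠ 0) ∧ (x₂ ≠ 0 ∨ y₂ ≠ 0) := by
  constructor
  · by_contra! hcon
    exact hne ⟨by rw [ha, hcon.2]; ring, by rw [hb, hcon.1, hcon.2]; ring,
      by rw [he, hcon.1]; ring⟩
  · by_contra! hcon
    exact hne ⟨by rw [ha, hcon.2]; ring, by rw [hb, hcon.1, hcon.2]; ring,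
      by rw [he, hcon.1]; ring⟩

theorem ofReal_ne_zero_or {x y : ℝ} (h : x ≠ 0 ∨ y ≠ 0) : (x : ℂ) ≠ 0 ∨ (y : ℂ) ≠ 0 := by
  simpa using h

variable (hne : ¬ (S .b20 = 0 ∧ S .a20 = 2 * S .b11 ∧ S .b02 = 2 * S .a11 ∧ S .a02 = 0))
include hne

/-- The quadratic cofactor of a real linear factor then has positive discriminant and does not
vanish at the zero of that factor. -/
theorem exists_roots_of_eta_pos (h : 0 < value S eta 0 0) :
    ∃ p q r, IsRealPoint p ∧ IsRealPoint q ∧ IsRealPoint r ∧ p ≠ q ∧ p ≠ r ∧ q ≠ r ∧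
      CubicRoots (conicP S) (conicQ S) p q r := by
  obtain ⟨x₀, y₀, a, b, e, h₀, hg, hC, hη⟩ := exists_real_factor S hne
  rw [hη] at h
  have hdisc : 0 < b ^ 2 - 4 * a * e := pos_of_mul_pos_left h (sq_nonneg _)
  have hres : a * x₀ ^ 2 + b * x₀ * y₀ + e * y₀ ^ 2 ≠ 0 := by
    intro h0
    rw [h0] at h
    simp at h
  obtain ⟨x₁, y₁, x₂, y₂, ha, hb, he⟩ :=
    exists_quadratic_split (Real.sq_sqrt hdisc.le)
  obtain ⟨h₁, h₂⟩ := ne_zero_of_quadratic_split hg ha hb he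
  refine ⟨pt x₀ y₀ (ofReal_ne_zero_or h₀), pt x₁ y₁ (ofReal_ne_zero_or h₁),
    pt x₂ y₂ (ofReal_ne_zero_or h₂), isRealPoint_ofReal _, isRealPoint_ofReal _,
    isRealPoint_ofReal _, ?_, ?_, ?_, cubicRoots_of_factor _ _ _ hC (by rw [ha]; push_cast; ring)
    (by rw [hb]; push_cast; ring) (by rw [he]; push_cast; ring)⟩
  all_goals
    rw [Ne, pt_eq_iff]
    norm_cast
    intro h0
  · apply hres
    rw [ha, hb, he]
    linear_combination (x₀ * y₂ - y₀ * x₂) * h0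
  · apply hres
    rw [ha, hb, he]
    linear_combination (x₀ * y₁ - y₀ * x₁) * h0
  · apply hdisc.ne'
    rw [ha, hb, he]
    linear_combination (x₁ * y₂ - y₁ * x₂) * h0

/-- The quadratic cofactor of a real linear factor then has negative discriminant, hence two
distinct non-real zeros. -/
theorem exists_roots_of_eta_neg (h : value S eta 0 0 < 0) :
    ∃ p q r, IsRealPoint p ∧ ¬ IsRealPoint q ∧ ¬ IsRealPoint r ∧ p ≠ q ∧ p ≠ r ∧ q ≠ r ∧
      CubicRoots (conicP S) (conicQ S) p q r := by
  obtain ⟨x₀, y₀, a, b, e, h₀, hg, hC, hη⟩ := exists_real_factor S hne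
  rw [hη] at h
  have hdisc : b ^ 2 - 4 * a * e < 0 := by
    by_contra! hcon
    exact absurd h (not_lt.2 (mul_nonneg hcon (sq_nonneg _)))
  have ha0 : a ≠ 0 := by
    rintro rfl
    nlinarith [sq_nonneg b]
  set t := Real.sqrt (-(b ^ 2 - 4 * a * e)) with ht
  have ht0 : 0 < t := Real.sqrt_pos.2 (by linarith)
  have ht2 : t ^ 2 = -(b ^ 2 - 4 * a * e) := Real.sq_sqrt (by linarith)
  have ht2' : (t : ℂ) ^ 2 = -(b ^ 2 - 4 * a * e) := by exact_mod_cast ht2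
  have hac : (a : ℂ) ≠ 0 := by exact_mod_cast ha0
  have htc : (t : ℂ) ≠ 0 := by exact_mod_cast ht0.ne'
  set x₁ : ℂ := (-b + t * Complex.I) / 2 with hx₁
  set x₂ : ℂ := (-b - t * Complex.I) / (2 * a) with hx₂
  have hx₁c : conj x₁ = (-b - t * Complex.I) / 2 := by
    rw [hx₁]
    simp [sub_eq_add_neg, map_ofNat]
  have hx₂c : conj x₂ = (-b + t * Complex.I) / (2 * a) := by
    rw [hx₂]
    simp [map_ofNat]
  have h₁ : x₁ ≠ 0 ∨ (a : ℂ) ≠ 0 := Or.inr hac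
  have h₂ : x₂ ≠ 0 ∨ (1 : ℂ) ≠ 0 := Or.inr one_ne_zero
  have hq : ¬ IsRealPoint (pt x₁ a h₁) := by
    rw [isRealPoint_pt_iff, hx₁c, hx₁, Complex.conj_ofReal]
    intro h0
    have : (a : ℂ) * (t * Complex.I) = 0 := by linear_combination h0
    simp [hac, htc] at this
  have hr : ¬ IsRealPoint (pt x₂ 1 h₂) := by
    rw [isRealPoint_pt_iff, hx₂c, hx₂, map_one]
    intro h0
    field_simp at h0
    have : (t * Complex.I) = 0 := by linear_combination -h0 / 2
    simp [htc] at this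
  have hp : IsRealPoint (pt x₀ y₀ (ofReal_ne_zero_or h₀)) := isRealPoint_ofReal _
  refine ⟨_, _, _, hp, hq, hr, ?_, ?_, ?_, cubicRoots_of_factor _ _ _ hC (by ring) ?_ ?_⟩
  · intro h0
    exact hq (h0 ▸ hp)
  · intro h0
    exact hr (h0 ▸ hp)
  · rw [Ne, pt_eq_iff, hx₁, hx₂]
    intro h0
    field_simp at h0
    have : (t * Complex.I) = 0 := by linear_combination h0 / 2
    simp [htc] at this
  · rw [hx₁, hx₂]
    field_simp
    ring
  · rw [hx₁, hx₂]
    field_simp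
    linear_combination -ht2' + t ^ 2 * Complex.I_sq

/-- Either the quadratic cofactor has a double zero, or it vanishes at the real zero already split
off; in both cases it splits over ℝ. -/
theorem exists_roots_of_eta_zero (h : value S eta 0 0 = 0) :
    ∃ p r, IsRealPoint p ∧ IsRealPoint r ∧ CubicRoots (conicP S) (conicQ S) r p p := by
  obtain ⟨x₀, y₀, a, b, e, h₀, hg, hC, hη⟩ := exists_real_factor S hne
  rw [hη, mul_eq_zero, pow_eq_zero_iff two_ne_zero] at h
  rcases h with h | h
  · obtain ⟨x₁, y₁, x₂, y₂, ha, hb, he⟩ :=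
      exists_quadratic_split (show (0 : ℝ) ^ 2 = b ^ 2 - 4 * a * e by rw [h]; ring)
    obtain ⟨h₁, h₂⟩ := ne_zero_of_quadratic_split hg ha hb he
    have he : pt x₁ y₁ (ofReal_ne_zero_or h₁) = pt x₂ y₂ (ofReal_ne_zero_or h₂) := by
      rw [pt_eq_iff]
      norm_cast
      rw [ha, hb, he] at h
      exact pow_eq_zero_iff (two_ne_zero) |>.1 (by linear_combination h)
    refine ⟨pt x₁ y₁ (ofReal_ne_zero_or h₁), pt x₀ y₀ (ofReal_ne_zero_or h₀),
      isRealPoint_ofReal _, isRealPoint_ofReal _, ?_⟩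
    nth_rewrite 2 [he]
    exact cubicRoots_of_factor _ _ _ hC (by rw [ha]; push_cast; ring)
      (by rw [hb]; push_cast; ring) (by simp [*])
  · obtain ⟨x₁, y₁, ha, hb, he⟩ := exists_quadratic_factor h₀ h
    obtain ⟨-, h₁⟩ := ne_zero_of_quadratic_split hg ha hb he
    refine ⟨pt x₀ y₀ (ofReal_ne_zero_or h₀), pt x₁ y₁ (ofReal_ne_zero_or h₁),
      isRealPoint_ofReal _, isRealPoint_ofReal _, (CubicRoots.perm132 ?_).perm213⟩
    exact cubicRoots_of_factor _ _ _ hC (by rw [ha]; push_cast; ring)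
      (by rw [hb]; push_cast; ring) (by rw [he]; push_cast; ring)

end CubicType

end

section

open Conic ComplexConjugate

/-! ### The line at infinity as a component of `C = 0` -/

theorem not_X_dvd_curveC_iff (S : QSystem) :
    ¬ (MvPolynomial.X 2 : MvPolynomial (Fin 3) ℂ) ∣ curveC S ↔
      ¬ (S .b20 = 0 ∧ S .a20 = 2 * S .b11 ∧ S .b02 = 2 * S .a11 ∧ S .a02 = 0) := by
  rw [not_iff_not]
  constructor
  · rintro ⟨F, hF⟩
    have h : ∀ x y : ℂ, -(S .b20 : ℂ) * x ^ 3 + (S .a20 - 2 * S .b11) * x ^ 2 * y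
        + (2 * S .a11 - S .b02) * x * y ^ 2 + S .a02 * y ^ 3 =
        0 * x ^ 3 + 0 * x ^ 2 * y + 0 * x * y ^ 2 + 0 * y ^ 3 := by
      intro x y
      have := congrArg (MvPolynomial.eval ![x, y, 0]) hF
      simp [curveC, curveP, curveQ, homogenized] at this
      linear_combination this
    obtain ⟨h1, h2, h3, h4⟩ := cubic_coeff_eq h
    norm_cast at h1 h2 h3 h4
    exact ⟨by linarith, by linarith, by linarith, h4⟩
  · rintro ⟨h1, h2, h3, h4⟩
    refine ⟨MvPolynomial.X 1 * (MvPolynomial.C (S .a00 : ℂ) * MvPolynomial.X 2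
      + MvPolynomial.C (S .a10 : ℂ) * MvPolynomial.X 0
      + MvPolynomial.C (S .a01 : ℂ) * MvPolynomial.X 1) - MvPolynomial.X 0 *
      (MvPolynomial.C (S .b00 : ℂ) * MvPolynomial.X 2
      + MvPolynomial.C (S .b10 : ℂ) * MvPolynomial.X 0
      + MvPolynomial.C (S .b01 : ℂ) * MvPolynomial.X 1), ?_⟩
    simp only [curveC, curveP, curveQ, homogenized, h1, h2, h3, h4, Complex.ofReal_zero, map_zero,
      Complex.ofReal_mul, Complex.ofReal_ofNat]
    ring

/-! ### Common zeros at infinity -/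

theorem exists_split (P : Conic) : ∃ x₁ y₁ x₂ y₂ : ℂ,
    P.xx = y₁ * y₂ ∧ P.xy = -(y₁ * x₂ + x₁ * y₂) ∧ P.yy = x₁ * x₂ := by
  obtain ⟨s, hs⟩ := IsAlgClosed.exists_pow_nat_eq (P.xy ^ 2 - 4 * P.xx * P.yy) two_pos
  exact exists_quadratic_split hs

/-- If the quadratic part of P splits into two linear forms, μ₀ is the product of the values of the
quadratic part of Q at their zeros. A vanishing quadratic part of P or Q imposes no condition. -/
theorem hasOrder_zero_or_exists_common_zero (P Q : Conic) :
    HasOrder P Q 0 ∨ ∃ x y, (x ≠ 0 ∨ y ≠ 0) ∧ P.quad x y = 0 ∧ Q.quad x y = 0 := by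
  by_cases hP : P.xx = 0 ∧ P.xy = 0 ∧ P.yy = 0
  · right
    by_cases hQ : Q.xx = 0 ∧ Q.xy = 0 ∧ Q.yy = 0
    · exact ⟨1, 0, by simp, by simp [quad, hP], by simp [quad, hQ]⟩
    · obtain ⟨x₁, y₁, x₂, y₂, h1, h2, h3⟩ := exists_split Q
      exact ⟨x₁, y₁, (ne_zero_of_quadratic_split hQ h1 h2 h3).1, by simp [quad, hP], by
        simp only [quad, h1, h2, h3]; ring⟩
  · obtain ⟨x₁, y₁, x₂, y₂, h1, h2, h3⟩ := exists_split P
    obtain ⟨g1, g2⟩ := ne_zero_of_quadratic_split hP h1 h2 h3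
    by_cases hq : Q.quad x₁ y₁ * Q.quad x₂ y₂ = 0
    · right
      rcases mul_eq_zero.1 hq with hq | hq
      · exact ⟨x₁, y₁, g1, by simp only [quad, h1, h2, h3]; ring, hq⟩
      · exact ⟨x₂, y₂, g2, by simp only [quad, h1, h2, h3]; ring, hq⟩
    · left
      refine ⟨fun i hi => absurd hi (Nat.not_lt_zero i), 0, 0, ?_⟩
      convert hq using 1
      simp only [Polynomial.coeff_zero_eq_eval_zero, lineRes, quadRes, restrA, restrB, restrE, quad]
      simp [h1, h2, h3]
      ring

/-- Conics without common zero at infinity. -/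
theorem intersectionNumber_eq_zero_of_no_common_zero {P Q : Conic}
    (h : ¬ ∃ x y, (x ≠ 0 ∨ y ≠ 0) ∧ P.quad x y = 0 ∧ Q.quad x y = 0) (w : LineAtInfinity) :
    intersectionNumber P.poly Q.poly w = 0 := by
  obtain ⟨x, y, hxy, rfl⟩ := exists_pt w
  apply intersectionNumber_eq_zero_of_quad_ne
  by_contra! hcon
  exact h ⟨x, y, hxy, hcon.1, hcon.2⟩

/-- The value of `κ / 64`. -/
def kappaVal (P Q : Conic) : ℂ :=
  hess0 P Q * (P.xy * Q.yy - Q.xy * P.yy) - hess1 P Q * (P.xx * Q.yy - Q.xx * P.yy)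
    + hess2 P Q * (P.xx * Q.xy - Q.xx * P.xy)

/-- The value of `L`. -/
def LVal (P Q : Conic) (x y : ℂ) : ℂ :=
  4 * (2 * ((P.xx * Q.xy - Q.xx * P.xy) * x ^ 2 + 2 * (P.xx * Q.yy - Q.xx * P.yy) * x * y
      + (P.xy * Q.yy - Q.xy * P.yy) * y ^ 2))
    + 8 * (-((y * P.xy - x * Q.xy) ^ 2 - 4 * (y * P.xx - x * Q.xx) * (y * P.yy - x * Q.yy)))
    - 8 * (hess0 P Q * x ^ 2 + hess1 P Q * x * y + hess2 P Q * y ^ 2)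

/-- The value of `κ₁ / 16`. -/
def kappa1Val (P Q : Conic) : ℂ :=
  2 * hess0 P Q * P.yz - hess1 P Q * (P.xz - Q.yz) - 2 * hess2 P Q * Q.xz

theorem vanishes_kappa_iff (S : QSystem) :
    Vanishes S kappa ↔ kappaVal (conicP S) (conicQ S) = 0 := by
  simp [vanishes_iff, valueC_kappa, kappaVal]

theorem vanishes_L_iff (S : QSystem) :
    Vanishes S L ↔ ∀ x y, LVal (conicP S) (conicQ S) x y = 0 := by
  simp only [vanishes_iff, valueC_L, valueC_K, valueC_H, valueC_M, LVal]

theorem vanishes_kappa1_iff (S : QSystem) :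
    Vanishes S kappa1 ↔ kappa1Val (conicP S) (conicQ S) = 0 := by
  simp [vanishes_iff, valueC_kappa1, kappa1Val]

theorem quad_conj_eq_zero {P : Conic} (h1 : conj P.xx = P.xx) (h2 : conj P.xy = P.xy)
    (h3 : conj P.yy = P.yy) {x y : ℂ} (h : P.quad x y = 0) : P.quad (conj x) (conj y) = 0 := by
  have := congrArg conj h
  simp only [quad, map_add, map_mul, map_pow, h1, h2, h3, map_zero] at this
  exact this

theorem divisorPQ_eq (S : QSystem) (w : LineAtInfinity) :
    divisorPQ S w = intersectionNumber (conicP S).poly (conicQ S).poly w := rfl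

/-- Two real conics with exactly one common zero at infinity, which is simple for the quadratic
parts. -/
theorem structure_of_not_proportional {S : QSystem} (hS : IsEssentiallyQuadratic S)
    (hprop : ¬ Proportional (conicP S) (conicQ S))
    (hzero : ∃ x y, (x ≠ 0 ∨ y ≠ 0) ∧ (conicP S).quad x y = 0 ∧ (conicQ S).quad x y = 0) :
    ∃ (w w₂ w₃ : LineAtInfinity) (m : ℕ), CubicRoots (conicP S) (conicQ S) w w₂ w₃ ∧
      IsRealPoint w ∧ 1 ≤ m ∧ m ≤ 4 ∧ FirstMu S m ∧ divisorPQ S w = m ∧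
      (∀ v, v ≠ w → divisorPQ S v = 0) ∧ (Vanishes S kappa ↔ w = w₂) ∧
      (w = w₃ → w = w₂) ∧ (w = w₂ → w ≠ w₃ → ¬ Vanishes S L) := by
  classical
  obtain ⟨x₀, y₀, h₀, hP, hQ⟩ := hzero
  have hrel : IsRelPrime (conicP S).poly (conicQ S).poly := hS.1
  obtain ⟨m, hm1, hm4, hm, hI⟩ := exists_order_of_not_proportional hrel hprop h₀ hP hQ
  obtain ⟨x₁, y₁, p1, p2, p3⟩ := exists_quadratic_factor (a := (conicP S).xx)
    (b := (conicP S).xy) (e := (conicP S).yy) h₀ hP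
  obtain ⟨x₂, y₂, q1, q2, q3⟩ := exists_quadratic_factor (a := (conicQ S).xx)
    (b := (conicQ S).xy) (e := (conicQ S).yy) h₀ hQ
  -- This is the resultant of the factors left after removing y₀ x - x₀ y from the two quadratic
  -- parts.
  have hδ : y₁ * x₂ - x₁ * y₂ ≠ 0 := by
    intro h0
    apply hprop
    by_cases hz : x₁ = 0 ∧ x₂ = 0
    · by_cases hz' : y₁ = 0 ∧ y₂ = 0
      · exact ⟨1, 0, by simp, fun x y => by simp [quad, q1, q2, q3, hz, hz']⟩
      · refine ⟨y₁, y₂, by tauto, fun x y => ?_⟩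
        simp only [quad, p1, p2, p3, q1, q2, q3, hz.1, hz.2]
        ring
    · refine ⟨x₁, x₂, by tauto, fun x y => ?_⟩
      simp only [quad, p1, p2, p3, q1, q2, q3]
      linear_combination (y₀ * x - x₀ * y) * x * h0
  have huniq : ∀ x y, (x ≠ 0 ∨ y ≠ 0) → (conicP S).quad x y = 0 → (conicQ S).quad x y = 0 →
      x₀ * y - y₀ * x = 0 := by
    intro x y hxy h1 h2
    simp only [quad, p1, p2, p3, q1, q2, q3] at h1 h2
    by_contra h3
    have g1 : y₁ * x - x₁ * y = 0 := by
      apply (mul_eq_zero.1 (_ : (x₀ * y - y₀ * x) * _ = 0)).resolve_left h3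
      linear_combination -h1
    have g2 : y₂ * x - x₂ * y = 0 := by
      apply (mul_eq_zero.1 (_ : (x₀ * y - y₀ * x) * _ = 0)).resolve_left h3
      linear_combination -h2
    rcases hxy with h | h
    · apply mul_ne_zero hδ h
      linear_combination x₂ * g1 - x₁ * g2
    · apply mul_ne_zero hδ h
      linear_combination y₂ * g1 - y₁ * g2
  -- The cofactor of y₀ x - x₀ y in C₂ is -y₂ x² + (y₁ + x₂) x y - x₁ y². Its zeros are ordered so
  -- that the common zero [x₀ : y₀], if among them, is the first.
  obtain ⟨u₁, v₁, u₂, v₂, k1, k2, k3, hsw⟩ : ∃ u₁ v₁ u₂ v₂ : ℂ,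
      -y₂ = v₁ * v₂ ∧ y₁ + x₂ = -(v₁ * u₂ + u₁ * v₂) ∧ -x₁ = u₁ * u₂ ∧
        (x₀ * v₂ - y₀ * u₂ = 0 → x₀ * v₁ - y₀ * u₁ = 0) := by
    obtain ⟨u₁, v₁, u₂, v₂, k1, k2, k3⟩ := exists_split ⟨0, 0, 0, -y₂, y₁ + x₂, -x₁⟩
    by_cases hw : x₀ * v₂ - y₀ * u₂ = 0
    · exact ⟨u₂, v₂, u₁, v₁, by linear_combination k1, by linear_combination k2,
        by linear_combination k3, fun _ => hw⟩
    · exact ⟨u₁, v₁, u₂, v₂, k1, k2, k3, fun h => absurd h hw⟩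
  have hk : ¬ (-y₂ = 0 ∧ y₁ + x₂ = 0 ∧ -x₁ = 0) := by
    rintro ⟨g1, g2, g3⟩
    apply (not_X_dvd_curveC_iff S).1 hS.2
    have e : ∀ x y : ℂ, -(S .b20 : ℂ) * x ^ 3 + (S .a20 - 2 * S .b11) * x ^ 2 * y
        + (2 * S .a11 - S .b02) * x * y ^ 2 + S .a02 * y ^ 3 =
        0 * x ^ 3 + 0 * x ^ 2 * y + 0 * x * y ^ 2 + 0 * y ^ 3 := by
      intro x y
      rw [← cubic_eq]
      simp only [quad, p1, p2, p3, q1, q2, q3]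
      linear_combination (y₀ * x - x₀ * y) * (x ^ 2 * g1 + x * y * g2 + y ^ 2 * g3)
    obtain ⟨h1, h2, h3, h4⟩ := cubic_coeff_eq e
    norm_cast at h1 h2 h3 h4
    exact ⟨by linarith, by linarith, by linarith, h4⟩
  obtain ⟨hu₁, hu₂⟩ := ne_zero_of_quadratic_split hk k1 k2 k3
  have hx₁ : x₁ = -(u₁ * u₂) := by linear_combination -k3
  have hy₂ : y₂ = -(v₁ * v₂) := by linear_combination -k1
  refine ⟨pt x₀ y₀ h₀, pt u₁ v₁ hu₁, pt u₂ v₂ hu₂, m, ⟨x₀, y₀, u₁, v₁, u₂, v₂, 1, h₀, hu₁, hu₂,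
    one_ne_zero, rfl, rfl, rfl, fun x y => ?_⟩, ?_, hm1, hm4, (firstMu_iff S m).2 hm, by rw [divisorPQ_eq, hI], ?_, ?_,
    by rwa [pt_eq_iff, pt_eq_iff], ?_⟩
  · simp only [quad, p1, p2, p3, q1, q2, q3]
    linear_combination (y₀ * x - x₀ * y) * (x ^ 2 * k1 + x * y * k2 + y ^ 2 * k3)
  · rw [isRealPoint_pt_iff]
    refine huniq _ _ (by simpa using h₀) (quad_conj_eq_zero ?_ ?_ ?_ hP)
      (quad_conj_eq_zero ?_ ?_ ?_ hQ) <;> simp [conicP, conicQ, map_ofNat]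
  · intro v hv
    obtain ⟨x, y, hxy, rfl⟩ := exists_pt v
    rw [divisorPQ_eq]
    apply intersectionNumber_eq_zero_of_quad_ne
    by_contra! hcon
    apply hv
    rw [pt_eq_iff]
    linear_combination -huniq x y hxy hcon.1 hcon.2
  -- κ / 64 is the nonzero resultant of `hδ` times the square of the cofactor of C₂ evaluated at the
  -- common zero; it vanishes exactly when that zero is multiple.
  · rw [vanishes_kappa_iff, pt_eq_iff]
    have hx₂ : x₂ = -(v₁ * u₂ + u₁ * v₂) - y₁ := by linear_combination k2
    have e : kappaVal (conicP S) (conicQ S) = (y₁ * x₂ - x₁ * y₂) *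
        ((x₀ * v₁ - y₀ * u₁) * (x₀ * v₂ - y₀ * u₂)) ^ 2 := by
      simp only [kappaVal, hess0, hess1, hess2, p1, p2, p3, q1, q2, q3, hx₁, hx₂, hy₂]
      ring
    rw [e, mul_eq_zero, or_iff_right hδ, pow_eq_zero_iff two_ne_zero, mul_eq_zero]
    tauto
  · intro hw hw' hL
    obtain ⟨d, hd, e1, e2⟩ := exists_smul_of_pt_eq hw.symm
    rw [Ne, pt_eq_iff] at hw'
    rw [vanishes_L_iff] at hL
    -- With (u₁, v₁) = d (x₀, y₀), the relation `k2` reads y₁ + d x₀ v₂ = -(x₂ + d y₀ u₂). This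
    -- common value e divides the resultant of `hδ`, so it is nonzero, and it appears as a factor of
    -- L.
    obtain ⟨e, he⟩ : ∃ e, e = y₁ + d * x₀ * v₂ := ⟨_, rfl⟩
    have hy₁ : y₁ = e - d * x₀ * v₂ := by linear_combination -he
    have hx₂ : x₂ = -e - d * y₀ * u₂ := by
      rw [e1, e2] at k2
      linear_combination k2 + he
    have he0 : e ≠ 0 := by
      intro h0
      apply hδ
      rw [hy₁, hx₂, hx₁, hy₂, h0, e1, e2]
      ring
    have key : ∀ x y, LVal (conicP S) (conicQ S) x y =
        8 * e * d * (x₀ * v₂ - y₀ * u₂) * (y₀ * x - x₀ * y) ^ 2 := by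
      intro x y
      simp only [LVal, hess0, hess1, hess2, p1, p2, p3, q1, q2, q3, hx₁, hy₁, hx₂, hy₂, e1, e2]
      ring
    have h1 := hL 1 0
    have h2 := hL 0 1
    rw [key] at h1 h2
    simp [he0, hd, hw'] at h1 h2
    simp [h1, h2] at h₀

end

section

open Conic ComplexConjugate

/-! ### Systems whose quadratic parts are proportional -/

/-- A linear form whose product with a nonzero quadratic form vanishes. -/
theorem linear_eq_zero_of_mul {x₁ y₁ x₂ y₂ α β : ℂ} (h₁ : x₁ ≠ 0 ∨ y₁ ≠ 0)
    (h₂ : x₂ ≠ 0 ∨ y₂ ≠ 0)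
    (h : ∀ x y, (y₁ * x - x₁ * y) * (y₂ * x - x₂ * y) * (α * x + β * y) = 0) :
    α = 0 ∧ β = 0 := by
  by_contra hcon
  have hl : ∀ a b : ℂ, (a ≠ 0 ∨ b ≠ 0) →
      (MvPolynomial.C a * MvPolynomial.X 0 + MvPolynomial.C b * MvPolynomial.X 1 :
        MvPolynomial (Fin 2) ℂ) ≠ 0 := by
    intro a b hab h0
    have h1 := congrArg (MvPolynomial.eval ![1, 0]) h0
    have h2 := congrArg (MvPolynomial.eval ![0, 1]) h0
    simp at h1 h2
    tauto
  refine mul_ne_zero (mul_ne_zero (hl y₁ (-x₁) ?_) (hl y₂ (-x₂) ?_)) (hl α β (by tauto)) ?_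
  · simpa using h₁.symm
  · simpa using h₂.symm
  · apply MvPolynomial.funext
    intro v
    simp only [map_mul, map_add, MvPolynomial.eval_C, MvPolynomial.eval_X, map_zero]
    linear_combination h (v 0) (v 1)

/-- The common factor of proportional quadratic parts. -/
theorem Proportional.exists_factor {P Q : Conic} (h : Proportional P Q) :
    ∃ a b x₁ y₁ x₂ y₂ : ℂ, (a ≠ 0 ∨ b ≠ 0) ∧
      P.xx = a * (y₁ * y₂) ∧ P.xy = a * (-(y₁ * x₂ + x₁ * y₂)) ∧ P.yy = a * (x₁ * x₂) ∧
      Q.xx = b * (y₁ * y₂) ∧ Q.xy = b * (-(y₁ * x₂ + x₁ * y₂)) ∧ Q.yy = b * (x₁ * x₂) := by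
  obtain ⟨a, b, hab, hPQ⟩ := h
  have h1 : b * P.xx = a * Q.xx := by simpa [quad] using hPQ 1 0
  have h3 : b * P.yy = a * Q.yy := by simpa [quad] using hPQ 0 1
  have h2 : b * P.xy = a * Q.xy := by
    have := hPQ 1 1
    simp only [quad] at this
    linear_combination this - h1 - h3
  by_cases ha : a = 0
  · subst ha
    have hb : b ≠ 0 := by simpa using hab
    obtain ⟨x₁, y₁, x₂, y₂, e1, e2, e3⟩ := exists_split (comb 0 (1 / b) P Q)
    simp only [comb, zero_mul, zero_add, mul_eq_zero, hb, false_or] at e1 e2 e3 h1 h2 h3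
    refine ⟨0, b, x₁, y₁, x₂, y₂, hab, by simp [h1], by simp [h2], by simp [h3], ?_, ?_, ?_⟩
    · rw [← e1]; field_simp
    · rw [← e2]; field_simp
    · rw [← e3]; field_simp
  · obtain ⟨x₁, y₁, x₂, y₂, e1, e2, e3⟩ := exists_split (comb (1 / a) 0 P Q)
    simp only [comb, zero_mul, add_zero] at e1 e2 e3
    refine ⟨a, b, x₁, y₁, x₂, y₂, hab, ?_, ?_, ?_, ?_, ?_, ?_⟩
    · rw [← e1]; field_simp
    · rw [← e2]; field_simp
    · rw [← e3]; field_simp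
    · rw [← e1]; field_simp; linear_combination -h1
    · rw [← e2]; field_simp; linear_combination -h2
    · rw [← e3]; field_simp; linear_combination -h3

/-- Intersection numbers and order of a pencil of conics with quadratic parts
`a (y₁ x - x₁ y) (y₂ x - x₂ y)` and `b (y₁ x - x₁ y) (y₂ x - x₂ y)`. -/
theorem order_of_proportional [DecidableEq LineAtInfinity] {P Q : Conic}
    (hPQ : IsRelPrime P.poly Q.poly) {a b x₁ y₁ x₂ y₂ : ℂ} (hab : a ≠ 0 ∨ b ≠ 0)
    (h₁ : x₁ ≠ 0 ∨ y₁ ≠ 0) (h₂ : x₂ ≠ 0 ∨ y₂ ≠ 0)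
    (p1 : P.xx = a * (y₁ * y₂)) (p2 : P.xy = a * (-(y₁ * x₂ + x₁ * y₂))) (p3 : P.yy = a * (x₁ * x₂))
    (q1 : Q.xx = b * (y₁ * y₂)) (q2 : Q.xy = b * (-(y₁ * x₂ + x₁ * y₂))) (q3 : Q.yy = b * (x₁ * x₂))
    {k : ℕ} (hk : k = if pt x₁ y₁ h₁ = pt x₂ y₂ h₂ then 2 else 1) :
    (b * P.lin x₁ y₁ - a * Q.lin x₁ y₁ ≠ 0 →
      intersectionNumber P.poly Q.poly (pt x₁ y₁ h₁) = k ∧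
      (b * P.lin x₂ y₂ - a * Q.lin x₂ y₂ ≠ 0 → HasOrder P Q 2)) ∧
    (b * P.lin x₁ y₁ - a * Q.lin x₁ y₁ = 0 → (∃ x y, b * P.lin x y - a * Q.lin x y ≠ 0) →
      ∃ k' : ℕ, (k' = 1 ∨ k' = 2) ∧
      intersectionNumber P.poly Q.poly (pt x₁ y₁ h₁) = (k + k' : ℕ) ∧ HasOrder P Q (2 + k')) ∧
    ((∀ x y, b * P.lin x y - a * Q.lin x y = 0) →
      intersectionNumber P.poly Q.poly (pt x₁ y₁ h₁) = (2 * k : ℕ) ∧ HasOrder P Q 4) := by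
  -- The combination b P - a Q has no quadratic part; c P + d Q completes it to an invertible change
  -- of the pencil.
  obtain ⟨c, d, hcd⟩ : ∃ c d : ℂ, c * a + d * b ≠ 0 := by
    rcases hab with h | h
    · exact ⟨1, 0, by simpa using h⟩
    · exact ⟨0, 1, by simpa using h⟩
  have hD : c * (-a) - d * b ≠ 0 := by
    intro h0
    exact hcd (by linear_combination -h0)
  have hlin : ∀ x y, (comb b (-a) P Q).lin x y = b * P.lin x y - a * Q.lin x y := by
    intro x y
    simp only [comb, lin]
    ring
  have := order_of_factor (P := comb c d P Q) (Q := comb b (-a) P Q) (isRelPrime_comb hD hPQ)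
    (by simp only [comb, p1, q1]; ring) (by simp only [comb, p2, q2]; ring)
    (by simp only [comb, p3, q3]; ring) h₁ h₂ hcd
    (by intro x y; simp only [quad, comb, p1, q1, p2, q2, p3, q3]; ring) hk
  simpa only [hlin, intersectionNumber_comb hD, HasOrder.comb_iff hD] using this

/-! ### Comitants of systems with p₂ = a g and q₂ = b g. -/

section

variable {S : QSystem} {a b x₁ y₁ x₂ y₂ : ℂ}

/-- The system `S` has quadratic parts `a (y₁ x - x₁ y) (y₂ x - x₂ y)` and
`b (y₁ x - x₁ y) (y₂ x - x₂ y)`. -/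
def HasFactor (S : QSystem) (a b x₁ y₁ x₂ y₂ : ℂ) : Prop :=
  (conicP S).xx = a * (y₁ * y₂) ∧ (conicP S).xy = a * (-(y₁ * x₂ + x₁ * y₂)) ∧
    (conicP S).yy = a * (x₁ * x₂) ∧ (conicQ S).xx = b * (y₁ * y₂) ∧
    (conicQ S).xy = b * (-(y₁ * x₂ + x₁ * y₂)) ∧ (conicQ S).yy = b * (x₁ * x₂)

theorem HasFactor.symm (h : HasFactor S a b x₁ y₁ x₂ y₂) : HasFactor S a b x₂ y₂ x₁ y₁ := by
  obtain ⟨p1, p2, p3, q1, q2, q3⟩ := h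
  refine ⟨?_, ?_, ?_, ?_, ?_, ?_⟩
  · rw [p1]; ring
  · rw [p2]; ring
  · rw [p3]; ring
  · rw [q1]; ring
  · rw [q2]; ring
  · rw [q3]; ring

theorem HasFactor.ne_zero (h : HasFactor S a b x₁ y₁ x₂ y₂) (hS : IsEssentiallyQuadratic S) :
    (x₁ ≠ 0 ∨ y₁ ≠ 0) ∧ (x₂ ≠ 0 ∨ y₂ ≠ 0) := by
  obtain ⟨p1, p2, p3, q1, q2, q3⟩ := h
  refine ne_zero_of_quadratic_split ?_ rfl rfl rfl
  rintro ⟨h1, h2, h3⟩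
  rw [h1, mul_zero] at p1 q1
  rw [h2, mul_zero] at p2 q2
  rw [h3, mul_zero] at p3 q3
  simp only [conicP, conicQ] at p1 p2 p3 q1 q2 q3
  norm_cast at p1 p2 p3 q1 q2 q3
  exact (not_X_dvd_curveC_iff S).1 hS.2 ⟨q1, by linarith, by linarith, p3⟩

theorem HasFactor.cubicRoots (h : HasFactor S a b x₁ y₁ x₂ y₂) (h₁ : x₁ ≠ 0 ∨ y₁ ≠ 0)
    (h₂ : x₂ ≠ 0 ∨ y₂ ≠ 0) (hab : a ≠ 0 ∨ b ≠ 0) :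
    CubicRoots (conicP S) (conicQ S) (pt x₁ y₁ h₁) (pt x₂ y₂ h₂) (pt a b hab) := by
  obtain ⟨p1, p2, p3, q1, q2, q3⟩ := h
  refine ⟨x₁, y₁, x₂, y₂, a, b, -1, h₁, h₂, hab, by simp, rfl, rfl, rfl, fun x y => ?_⟩
  simp only [quad, p1, p2, p3, q1, q2, q3]
  ring

/-- Proportional quadratic parts have vanishing Jacobian K. -/
theorem HasFactor.vanishes_kappa (h : HasFactor S a b x₁ y₁ x₂ y₂) : Vanishes S kappa := by
  obtain ⟨p1, p2, p3, q1, q2, q3⟩ := h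
  rw [vanishes_kappa_iff]
  simp only [kappaVal, p1, p2, p3, q1, q2, q3]
  ring

/-- Here K = 0, and H = -(a y - b x)² (x₁ y₂ - y₁ x₂)² = 0 because the common factor is a square; so
L = -M, which is nonzero as [a : b] is a different zero of C₂. -/
theorem HasFactor.not_vanishes_L (h : HasFactor S a b x₁ y₁ x₂ y₂) (h₁ : x₁ ≠ 0 ∨ y₁ ≠ 0)
    (h₂ : x₂ ≠ 0 ∨ y₂ ≠ 0) (hab : a ≠ 0 ∨ b ≠ 0) (h12 : pt x₁ y₁ h₁ = pt x₂ y₂ h₂)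
    (h13 : pt x₁ y₁ h₁ ≠ pt a b hab) : ¬ Vanishes S L := by
  have hC := h.cubicRoots h₁ h₂ hab
  rw [← h12] at hC
  rw [Ne, ← vanishes_M_iff_of_double hC] at h13
  contrapose! h13
  rw [vanishes_L_iff] at h13
  rw [vanishes_iff]
  intro x y
  have hxy := h13 x y
  rw [pt_eq_iff] at h12
  obtain ⟨p1, p2, p3, q1, q2, q3⟩ := h
  rw [valueC_M]
  rw [LVal] at hxy
  have hKH : 4 * (2 * (((conicP S).xx * (conicQ S).xy - (conicQ S).xx * (conicP S).xy) * x ^ 2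
      + 2 * ((conicP S).xx * (conicQ S).yy - (conicQ S).xx * (conicP S).yy) * x * y
      + ((conicP S).xy * (conicQ S).yy - (conicQ S).xy * (conicP S).yy) * y ^ 2))
    + 8 * (-((y * (conicP S).xy - x * (conicQ S).xy) ^ 2
      - 4 * (y * (conicP S).xx - x * (conicQ S).xx)
        * (y * (conicP S).yy - x * (conicQ S).yy))) = 0 := by
    rw [p1, p2, p3, q1, q2, q3]
    linear_combination -8 * (y * a - x * b) ^ 2 * (x₁ * y₂ - y₁ * x₂) * h12
  linear_combination hKH - hxy

/-- K = 0, and when [a : b] is a zero of the common factor, 8 H and M are the same multiple of (a y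
- b x)². -/
theorem HasFactor.vanishes_L (h : HasFactor S a b x₁ y₁ x₂ y₂) (h₁ : x₁ ≠ 0 ∨ y₁ ≠ 0)
    (hab : a ≠ 0 ∨ b ≠ 0) (h13 : pt x₁ y₁ h₁ = pt a b hab) : Vanishes S L := by
  obtain ⟨c, -, e1, e2⟩ := exists_smul_of_pt_eq h13.symm
  obtain ⟨p1, p2, p3, q1, q2, q3⟩ := h
  rw [vanishes_L_iff]
  intro x y
  simp only [LVal, hess0, hess1, hess2, p1, p2, p3, q1, q2, q3, e1, e2]
  ring

/-- M is a multiple of (y₁ x - x₁ y)², and the transvectant with such a square evaluates C₁ at (x₁,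
y₁) up to a constant. As (a, b) is proportional to (x₁, y₁), the value of C₁ there is that of b p₁ -
a q₁ up to a nonzero constant. -/
theorem HasFactor.vanishes_kappa1_iff (h : HasFactor S a b x₁ y₁ x₂ y₂) (h₁ : x₁ ≠ 0 ∨ y₁ ≠ 0)
    (h₂ : x₂ ≠ 0 ∨ y₂ ≠ 0) (hab : a ≠ 0 ∨ b ≠ 0) (h12 : pt x₁ y₁ h₁ ≠ pt x₂ y₂ h₂)
    (h13 : pt x₁ y₁ h₁ = pt a b hab) :
    Vanishes S kappa1 ↔ b * (conicP S).lin x₁ y₁ - a * (conicQ S).lin x₁ y₁ = 0 := by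
  obtain ⟨c, hc, e1, e2⟩ := exists_smul_of_pt_eq h13.symm
  obtain ⟨p1, p2, p3, q1, q2, q3⟩ := h
  rw [Ne, pt_eq_iff] at h12
  rw [QuadInf.vanishes_kappa1_iff]
  have e : kappa1Val (conicP S) (conicQ S) = -2 * c * (x₁ * y₂ - y₁ * x₂) ^ 2 *
      (b * (conicP S).lin x₁ y₁ - a * (conicQ S).lin x₁ y₁) := by
    simp only [kappa1Val, lin, hess0, hess1, hess2, p1, p2, p3, q1, q2, q3, e1, e2]
    ring
  rw [e, mul_eq_zero, or_iff_right]
  simp [hc, h12]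

/-- K₁ is the nonzero common factor of p₂ and q₂ times b p₁ - a q₁. -/
theorem HasFactor.vanishes_K1_iff (h : HasFactor S a b x₁ y₁ x₂ y₂) (h₁ : x₁ ≠ 0 ∨ y₁ ≠ 0)
    (h₂ : x₂ ≠ 0 ∨ y₂ ≠ 0) : Vanishes S K1 ↔
      ∀ x y, b * (conicP S).lin x y - a * (conicQ S).lin x y = 0 := by
  obtain ⟨p1, p2, p3, q1, q2, q3⟩ := h
  have e : ∀ x y, valueC S K1 x y = (y₁ * x - x₁ * y) * (y₂ * x - x₂ * y) *
      (b * (conicP S).lin x y - a * (conicQ S).lin x y) := by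
    intro x y
    rw [valueC_K1]
    simp only [quad, p1, p2, p3, q1, q2, q3]
    ring
  simp only [vanishes_iff, e]
  constructor
  · intro h0 x y
    obtain ⟨k1, k2⟩ := linear_eq_zero_of_mul h₁ h₂
      (α := b * (conicP S).xz - a * (conicQ S).xz) (β := b * (conicP S).yz - a * (conicQ S).yz)
      (fun x y => by rw [← h0 x y]; simp only [lin]; ring)
    simp only [lin]
    linear_combination x * k1 + y * k2
  · intro h0 x y
    rw [h0, mul_zero]

/-- The factor of proportionality is real. -/
theorem HasFactor.isRealPoint (h : HasFactor S a b x₁ y₁ x₂ y₂) (h₁ : x₁ ≠ 0 ∨ y₁ ≠ 0)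
    (h₂ : x₂ ≠ 0 ∨ y₂ ≠ 0) (hab : a ≠ 0 ∨ b ≠ 0) : IsRealPoint (pt a b hab) ∧
      ∀ x y, b * (conicP S).lin x y - a * (conicQ S).lin x y = 0 → x * conj y - y * conj x ≠ 0 →
        ∀ x y, b * (conicP S).lin x y - a * (conicQ S).lin x y = 0 := by
  obtain ⟨p1, p2, p3, q1, q2, q3⟩ := h
  -- k is a nonzero coefficient of the common factor; a k and b k are then coefficients in the
  -- quadratic parts of the real system.
  obtain ⟨k, hk, hka, hkb⟩ : ∃ k : ℂ, k ≠ 0 ∧ conj (a * k) = a * k ∧ conj (b * k) = b * k := by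
    by_contra! hcon
    have hr : ∀ k, conj (a * k) = a * k → conj (b * k) = b * k → k = 0 := by
      intro k h1 h2
      by_contra h3
      exact hcon k h3 h1 h2
    have k1 := hr _ (by rw [← p1]; simp [conicP]) (by rw [← q1]; simp [conicQ])
    have k2 := hr _ (by rw [← p2]; simp [conicP, map_ofNat])
      (by rw [← q2]; simp [conicQ, map_ofNat])
    have k3 := hr _ (by rw [← p3]; simp [conicP]) (by rw [← q3]; simp [conicQ])
    have := linear_eq_zero_of_mul h₁ h₂ (α := 1) (β := 0)
      (fun x y => by linear_combination x * (x ^ 2 * k1 + x * y * k2 + y ^ 2 * k3))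
    exact one_ne_zero this.1
  have hk' : conj k ≠ 0 := by simpa using hk
  rw [map_mul] at hka hkb
  constructor
  · rw [isRealPoint_pt_iff]
    apply (mul_eq_zero.1 (_ : (k * conj k) * _ = 0)).resolve_left (mul_ne_zero hk hk')
    linear_combination a * k * hkb - b * k * hka
  -- Multiplied by k, the form b p₁ - a q₁ is real. A non-real zero thus brings its conjugate, and a
  -- linear form with two distinct zeros vanishes.
  · intro x y h0 hxy x' y'
    simp only [lin] at h0 ⊢
    set α := b * (conicP S).xz - a * (conicQ S).xz with hα
    set β := b * (conicP S).yz - a * (conicQ S).yz with hβ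
    have hαc : conj k * conj α = k * α := by
      rw [hα]
      simp only [conicP, conicQ, map_sub, map_mul, Complex.conj_ofReal]
      linear_combination (S .a10 : ℂ) * hkb - (S .b10 : ℂ) * hka
    have hβc : conj k * conj β = k * β := by
      rw [hβ]
      simp only [conicP, conicQ, map_sub, map_mul, Complex.conj_ofReal]
      linear_combination (S .a01 : ℂ) * hkb - (S .b01 : ℂ) * hka
    have h1 : α * x + β * y = 0 := by linear_combination h0
    have h2 : k * α * conj x + k * β * conj y = 0 := by
      have := congrArg conj h1
      simp only [map_add, map_mul, map_zero] at this
      linear_combination conj k * this - conj x * hαc - conj y * hβc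
    have hα0 : α = 0 := by
      apply (mul_eq_zero.1 (_ : (k * (x * conj y - y * conj x)) * _ = 0)).resolve_left
        (mul_ne_zero hk hxy)
      linear_combination k * conj y * h1 - y * h2
    have hβ0 : β = 0 := by
      apply (mul_eq_zero.1 (_ : (k * (x * conj y - y * conj x)) * _ = 0)).resolve_left
        (mul_ne_zero hk hxy)
      linear_combination x * h2 - k * conj x * h1
    linear_combination x' * hα0 + y' * hβ0

theorem HasFactor.divisorPQ_eq_zero (h : HasFactor S a b x₁ y₁ x₂ y₂) (h₁ : x₁ ≠ 0 ∨ y₁ ≠ 0)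
    (h₂ : x₂ ≠ 0 ∨ y₂ ≠ 0) (hab : a ≠ 0 ∨ b ≠ 0) {v : LineAtInfinity} (hv₁ : v ≠ pt x₁ y₁ h₁)
    (hv₂ : v ≠ pt x₂ y₂ h₂) : divisorPQ S v = 0 := by
  obtain ⟨p1, p2, p3, q1, q2, q3⟩ := h
  obtain ⟨x, y, hxy, rfl⟩ := exists_pt v
  rw [Ne, pt_eq_iff] at hv₁ hv₂
  rw [divisorPQ_eq]
  apply intersectionNumber_eq_zero_of_quad_ne
  have hne := mul_ne_zero hv₁ hv₂
  simp only [quad, p1, p2, p3, q1, q2, q3]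
  rcases hab with h | h
  · left
    convert mul_ne_zero h hne using 1
    ring
  · right
    convert mul_ne_zero h hne using 1
    ring

end

end

/-! ### Distribution of the multiplicities when the quadratic parts are proportional. -/

section

open Conic ComplexConjugate

section

variable {S : QSystem} {a b x₁ y₁ x₂ y₂ : ℂ}

theorem HasFactor.order [DecidableEq LineAtInfinity] (h : HasFactor S a b x₁ y₁ x₂ y₂)
    (hS : IsEssentiallyQuadratic S) (h₁ : x₁ ≠ 0 ∨ y₁ ≠ 0)
    (h₂ : x₂ ≠ 0 ∨ y₂ ≠ 0) (hab : a ≠ 0 ∨ b ≠ 0) {k : ℕ}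
    (hk : k = if pt x₁ y₁ h₁ = pt x₂ y₂ h₂ then 2 else 1) :
    (b * (conicP S).lin x₁ y₁ - a * (conicQ S).lin x₁ y₁ ≠ 0 →
      divisorPQ S (pt x₁ y₁ h₁) = k ∧
      (b * (conicP S).lin x₂ y₂ - a * (conicQ S).lin x₂ y₂ ≠ 0 → FirstMu S 2)) ∧
    (b * (conicP S).lin x₁ y₁ - a * (conicQ S).lin x₁ y₁ = 0 →
      (∃ x y, b * (conicP S).lin x y - a * (conicQ S).lin x y ≠ 0) →
      ∃ k' : ℕ, (k' = 1 ∨ k' = 2) ∧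
      divisorPQ S (pt x₁ y₁ h₁) = (k + k' : ℕ) ∧ FirstMu S (2 + k')) ∧
    ((∀ x y, b * (conicP S).lin x y - a * (conicQ S).lin x y = 0) →
      divisorPQ S (pt x₁ y₁ h₁) = (2 * k : ℕ) ∧ FirstMu S 4) := by
  have hrel : IsRelPrime (conicP S).poly (conicQ S).poly := hS.1
  obtain ⟨p1, p2, p3, q1, q2, q3⟩ := h
  simp only [divisorPQ_eq, firstMu_iff]
  exact order_of_proportional hrel hab h₁ h₂ p1 p2 p3 q1 q2 q3 hk

/-- The whole multiplicity sits at the single zero of the common factor, so the conditions at its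
two zeros coincide and the order always equals the intersection number. -/
theorem HasFactor.order_of_eq (h : HasFactor S a b x₁ y₁ x₂ y₂)
    (hS : IsEssentiallyQuadratic S) (h₁ : x₁ ≠ 0 ∨ y₁ ≠ 0)
    (h₂ : x₂ ≠ 0 ∨ y₂ ≠ 0) (hab : a ≠ 0 ∨ b ≠ 0) (h12 : pt x₁ y₁ h₁ = pt x₂ y₂ h₂) :
    ∃ m : ℕ, 2 ≤ m ∧ m ≤ 4 ∧ FirstMu S m ∧ divisorPQ S (pt x₁ y₁ h₁) = m := by
  classical
  obtain ⟨hA, hB, hC⟩ := h.order hS h₁ h₂ hab (k := 2) (if_pos h12).symm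
  by_cases hz : ∀ x y, b * (conicP S).lin x y - a * (conicQ S).lin x y = 0
  · obtain ⟨h1, h2⟩ := hC hz
    exact ⟨4, by norm_num, le_rfl, h2, h1⟩
  · by_cases h0 : b * (conicP S).lin x₁ y₁ - a * (conicQ S).lin x₁ y₁ = 0
    · push Not at hz
      obtain ⟨k', hk', h1, h2⟩ := hB h0 hz
      exact ⟨2 + k', by omega, by omega, h2, h1⟩
    · obtain ⟨h1, h2⟩ := hA h0
      refine ⟨2, le_rfl, by norm_num, h2 ?_, h1⟩
      obtain ⟨c, hc, e1, e2⟩ := exists_smul_of_pt_eq h12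
      rw [e1, e2, lin_smul, lin_smul] at h0
      intro h3
      exact h0 (by linear_combination c * h3)

theorem linear_eq_zero_of_ne (h₁ : x₁ ≠ 0 ∨ y₁ ≠ 0)
    (h₂ : x₂ ≠ 0 ∨ y₂ ≠ 0) (h12 : pt x₁ y₁ h₁ ≠ pt x₂ y₂ h₂)
    (e1 : b * (conicP S).lin x₁ y₁ - a * (conicQ S).lin x₁ y₁ = 0)
    (e2 : b * (conicP S).lin x₂ y₂ - a * (conicQ S).lin x₂ y₂ = 0) (x y : ℂ) :
    b * (conicP S).lin x y - a * (conicQ S).lin x y = 0 := by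
  rw [Ne, pt_eq_iff] at h12
  apply (mul_eq_zero.1 (_ : (x₁ * y₂ - y₁ * x₂) * _ = 0)).resolve_left h12
  simp only [lin] at e1 e2 ⊢
  linear_combination (x * y₂ - y * x₂) * e1 + (x₁ * y - y₁ * x) * e2

end

/-- A system with proportional quadratic parts: the common zeros `u`, `v` of the quadratic
parts, and the third zero `s` of the cubic form. -/
theorem structure_of_proportional {S : QSystem} (hS : IsEssentiallyQuadratic S)
    (hprop : Proportional (conicP S) (conicQ S)) :
    ∃ u v s : LineAtInfinity, CubicRoots (conicP S) (conicQ S) u v s ∧ IsRealPoint s ∧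
      (∀ w, w ≠ u → w ≠ v → divisorPQ S w = 0) ∧ Vanishes S kappa ∧
      ((u = v ∧ (u ≠ s → ¬ Vanishes S L) ∧
          ∃ m : ℕ, 2 ≤ m ∧ m ≤ 4 ∧ FirstMu S m ∧ divisorPQ S u = m) ∨
        (u ≠ v ∧ (u = s ∨ v = s → Vanishes S L) ∧
          ((FirstMu S 2 ∧ divisorPQ S u = 1 ∧ divisorPQ S v = 1) ∨
            (∃ k : ℕ, (k = 1 ∨ k = 2) ∧ FirstMu S (2 + k) ∧ divisorPQ S u = (1 + k : ℕ) ∧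
              divisorPQ S v = 1 ∧ IsRealPoint u ∧ ¬ Vanishes S K1 ∧
              (u = s → Vanishes S kappa1) ∧ (v = s → ¬ Vanishes S kappa1)) ∨
            (FirstMu S 4 ∧ divisorPQ S u = 2 ∧ divisorPQ S v = 2 ∧ Vanishes S K1 ∧
              (u = s ∨ v = s → Vanishes S kappa1))))) := by
  classical
  obtain ⟨a, b, x₁, y₁, x₂, y₂, hab, hF⟩ := hprop.exists_factor
  replace hF : HasFactor S a b x₁ y₁ x₂ y₂ := hF
  obtain ⟨h₁, h₂⟩ := hF.ne_zero hS
  obtain ⟨hs, hreal⟩ := hF.isRealPoint h₁ h₂ hab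
  by_cases h12 : pt x₁ y₁ h₁ = pt x₂ y₂ h₂
  · exact ⟨pt x₁ y₁ h₁, pt x₂ y₂ h₂, pt a b hab, hF.cubicRoots h₁ h₂ hab, hs,
      fun w => hF.divisorPQ_eq_zero h₁ h₂ hab, hF.vanishes_kappa,
      Or.inl ⟨h12, hF.not_vanishes_L h₁ h₂ hab h12, hF.order_of_eq hS h₁ h₂ hab h12⟩⟩
  have hL : pt x₁ y₁ h₁ = pt a b hab ∨ pt x₂ y₂ h₂ = pt a b hab → Vanishes S L := by
    rintro (h | h)
    · exact hF.vanishes_L h₁ hab h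
    · exact hF.symm.vanishes_L h₂ hab h
  obtain ⟨hA, hB, hC⟩ := hF.order hS h₁ h₂ hab (k := 1) (if_neg h12).symm
  obtain ⟨hA', hB', hC'⟩ := hF.symm.order hS h₂ h₁ hab (k := 1) (if_neg (Ne.symm h12)).symm
  have hk := hF.vanishes_kappa1_iff h₁ h₂ hab h12
  have hk' := hF.symm.vanishes_kappa1_iff h₂ h₁ hab (Ne.symm h12)
  have hK1 := hF.vanishes_K1_iff h₁ h₂
  by_cases h1 : b * (conicP S).lin x₁ y₁ - a * (conicQ S).lin x₁ y₁ = 0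
  · by_cases h2 : b * (conicP S).lin x₂ y₂ - a * (conicQ S).lin x₂ y₂ = 0
    · have hz := linear_eq_zero_of_ne h₁ h₂ h12 h1 h2
      refine ⟨pt x₁ y₁ h₁, pt x₂ y₂ h₂, pt a b hab, hF.cubicRoots h₁ h₂ hab, hs,
        fun w => hF.divisorPQ_eq_zero h₁ h₂ hab, hF.vanishes_kappa,
        Or.inr ⟨h12, hL, Or.inr (Or.inr ⟨(hC hz).2, (hC hz).1, (hC' hz).1, hK1.2 hz, ?_⟩)⟩⟩
      rintro (h | h)
      · exact (hk h).2 h1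
      · exact (hk' h).2 h2
    · obtain ⟨k, hk12, h3, h4⟩ := hB h1 ⟨_, _, h2⟩
      refine ⟨pt x₁ y₁ h₁, pt x₂ y₂ h₂, pt a b hab, hF.cubicRoots h₁ h₂ hab, hs,
        fun w => hF.divisorPQ_eq_zero h₁ h₂ hab, hF.vanishes_kappa,
        Or.inr ⟨h12, hL, Or.inr (Or.inl ⟨k, hk12, h4, h3, (hA' h2).1, ?_,
          fun h => h2 (hK1.1 h _ _), fun h => (hk h).2 h1, fun h h' => h2 ((hk' h).1 h')⟩)⟩⟩
      rw [isRealPoint_pt_iff]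
      by_contra h
      exact h2 (hreal _ _ h1 h _ _)
  · by_cases h2 : b * (conicP S).lin x₂ y₂ - a * (conicQ S).lin x₂ y₂ = 0
    · obtain ⟨k, hk12, h3, h4⟩ := hB' h2 ⟨_, _, h1⟩
      refine ⟨pt x₂ y₂ h₂, pt x₁ y₁ h₁, pt a b hab, hF.symm.cubicRoots h₂ h₁ hab, hs,
        fun w => hF.symm.divisorPQ_eq_zero h₂ h₁ hab, hF.vanishes_kappa,
        Or.inr ⟨Ne.symm h12, hL ∘ Or.symm, Or.inr (Or.inl ⟨k, hk12, h4, h3, (hA h1).1, ?_,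
          fun h => h1 (hK1.1 h _ _), fun h => (hk' h).2 h2, fun h h' => h1 ((hk h).1 h')⟩)⟩⟩
      rw [isRealPoint_pt_iff]
      by_contra h
      exact h1 (hreal _ _ h2 h _ _)
    · exact ⟨pt x₁ y₁ h₁, pt x₂ y₂ h₂, pt a b hab, hF.cubicRoots h₁ h₂ hab, hs,
        fun w => hF.divisorPQ_eq_zero h₁ h₂ hab, hF.vanishes_kappa,
        Or.inr ⟨h12, hL, Or.inl ⟨(hA h1).2 h2, (hA h1).1, (hA' h2).1⟩⟩⟩

end

section

open Conic

/-! ### Multiplicities and reality of the zeros of the cubic form -/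

theorem triple_eq {α : Type*} {a b c p q r : α} (h : ({a, b, c} : Multiset α) = {p, q, r}) :
    (a = p ∧ b = q ∧ c = r) ∨ (a = p ∧ b = r ∧ c = q) ∨ (a = q ∧ b = p ∧ c = r) ∨
      (a = q ∧ b = r ∧ c = p) ∨ (a = r ∧ b = p ∧ c = q) ∨ (a = r ∧ b = q ∧ c = p) := by
  have pair : ∀ {x y z w : α}, ({x, y} : Multiset α) = {z, w} →
      (x = z ∧ y = w) ∨ (x = w ∧ y = z) := by
    intro x y z w h
    simp only [Multiset.insert_eq_cons] at h
    rcases Multiset.cons_eq_cons.1 h with ⟨e, h'⟩ | ⟨-, t, h1, h2⟩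
    · exact Or.inl ⟨e, Multiset.singleton_inj.1 h'⟩
    · obtain ⟨e1, rfl⟩ := Multiset.singleton_eq_cons_iff _ |>.1 h1
      obtain ⟨e2, -⟩ := Multiset.singleton_eq_cons_iff _ |>.1 h2
      exact Or.inr ⟨e2.symm, e1⟩
  have ha : a ∈ ({p, q, r} : Multiset α) := by
    rw [← h]
    simp
  simp only [Multiset.insert_eq_cons, Multiset.mem_cons, Multiset.mem_singleton] at ha
  rcases ha with rfl | rfl | rfl
  · have := pair ((Multiset.cons_inj_right _).1 h)
    tauto
  · have h' : ({a, b, c} : Multiset α) = {a, p, r} := h.trans (Multiset.cons_swap _ _ _)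
    have := pair ((Multiset.cons_inj_right _).1 h')
    tauto
  · have h' : ({a, b, c} : Multiset α) = {a, p, q} := by
      rw [h]
      simp only [Multiset.insert_eq_cons, ← Multiset.cons_zero]
      rw [Multiset.cons_swap q a, Multiset.cons_swap p a]
    have := pair ((Multiset.cons_inj_right _).1 h')
    tauto

section

variable {S : QSystem} (hS : IsEssentiallyQuadratic S) {u v s : LineAtInfinity}
  (hC : CubicRoots (conicP S) (conicQ S) u v s)

include hS hC

/-- By uniqueness, u, v, s is a permutation of the zeros found from the sign of η; the same
reduction serves the other types. -/
theorem roots_of_condI1 (h : CondI1 S) :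
    IsRealPoint u ∧ IsRealPoint v ∧ IsRealPoint s ∧ u ≠ v ∧ u ≠ s ∧ v ≠ s := by
  obtain ⟨p, q, r, hp, hq, hr, hpq, hpr, hqr, hC'⟩ :=
    exists_roots_of_eta_pos ((not_X_dvd_curveC_iff S).1 hS.2) h
  rcases triple_eq (hC.unique hC') with ⟨rfl, rfl, rfl⟩ | ⟨rfl, rfl, rfl⟩ | ⟨rfl, rfl, rfl⟩ |
    ⟨rfl, rfl, rfl⟩ | ⟨rfl, rfl, rfl⟩ | ⟨rfl, rfl, rfl⟩ <;> tauto

theorem roots_of_condI2 (h : CondI2 S) : u ≠ v ∧ u ≠ s ∧ v ≠ s ∧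
    ((IsRealPoint u ∧ ¬ IsRealPoint v ∧ ¬ IsRealPoint s) ∨
      (¬ IsRealPoint u ∧ IsRealPoint v ∧ ¬ IsRealPoint s) ∨
      (¬ IsRealPoint u ∧ ¬ IsRealPoint v ∧ IsRealPoint s)) := by
  obtain ⟨p, q, r, hp, hq, hr, hpq, hpr, hqr, hC'⟩ :=
    exists_roots_of_eta_neg ((not_X_dvd_curveC_iff S).1 hS.2) h
  rcases triple_eq (hC.unique hC') with ⟨rfl, rfl, rfl⟩ | ⟨rfl, rfl, rfl⟩ | ⟨rfl, rfl, rfl⟩ |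
    ⟨rfl, rfl, rfl⟩ | ⟨rfl, rfl, rfl⟩ | ⟨rfl, rfl, rfl⟩ <;> tauto

theorem roots_of_eta_eq_zero (h : value S eta 0 0 = 0) :
    IsRealPoint u ∧ IsRealPoint v ∧ IsRealPoint s ∧
      ((Vanishes S M ∧ u = v ∧ u = s) ∨
        (¬ Vanishes S M ∧ ((u = v ∧ u ≠ s) ∨ (u = s ∧ u ≠ v) ∨ (v = s ∧ u ≠ v)))) := by
  obtain ⟨p, r, hp, hr, hC'⟩ := exists_roots_of_eta_zero ((not_X_dvd_curveC_iff S).1 hS.2) h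
  have hM := vanishes_M_iff_of_double hC'.perm213.perm132
  by_cases hpr : p = r
  · have := hM.2 hpr
    subst hpr
    rcases triple_eq (hC.unique hC') with ⟨rfl, rfl, rfl⟩ | ⟨rfl, rfl, rfl⟩ | ⟨rfl, rfl, rfl⟩ |
      ⟨rfl, rfl, rfl⟩ | ⟨rfl, rfl, rfl⟩ | ⟨rfl, rfl, rfl⟩ <;> tauto
  · have := mt hM.1 hpr
    rcases triple_eq (hC.unique hC') with ⟨rfl, rfl, rfl⟩ | ⟨rfl, rfl, rfl⟩ | ⟨rfl, rfl, rfl⟩ |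
      ⟨rfl, rfl, rfl⟩ | ⟨rfl, rfl, rfl⟩ | ⟨rfl, rfl, rfl⟩ <;> tauto

theorem roots_of_condI3 (h : CondI3 S) :
    IsRealPoint u ∧ IsRealPoint v ∧ IsRealPoint s ∧
      ((u = v ∧ u ≠ s) ∨ (u = s ∧ u ≠ v) ∨ (v = s ∧ u ≠ v)) := by
  have := roots_of_eta_eq_zero hS hC h.1
  have := h.2
  tauto

theorem roots_of_condI4 (h : CondI4 S) : IsRealPoint u ∧ u = v ∧ u = s := by
  have := roots_of_eta_eq_zero hS hC (value_eta_of_vanishes_M h)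
  have : Vanishes S M := h
  tauto

end

/-! ### The divisors -/

theorem finsum_fst_eq_sum (F : LineAtInfinity →₀ ℕ∞ × ℕ∞) :
    ∑ᶠ w, (F w).1 = F.sum fun _ s => s.1 := by
  rw [Finsupp.sum, finsum_eq_sum_of_support_subset]
  intro w hw
  simp only [Function.mem_support] at hw
  simp only [Finset.mem_coe, Finsupp.mem_support_iff]
  intro h0
  simp [h0] at hw

section

variable {S : QSystem} {p q r : LineAtInfinity} {i j k : ℕ∞}

theorem degPQ_of_divisorD {F : LineAtInfinity →₀ ℕ∞ × ℕ∞} (h : divisorD S = ⇑F) :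
    degPQ S = F.sum fun _ s => s.1 := by
  rw [← finsum_fst_eq_sum, ← h]
  rfl

theorem divisorCZ_eq [DecidableEq LineAtInfinity]
    (hC : CubicRoots (conicP S) (conicQ S) p q r) (w : LineAtInfinity) : divisorCZ S w =
      (if w = p then 1 else 0) + (if w = q then 1 else 0) + (if w = r then 1 else 0) :=
  hC.divisor w

theorem divisorD_three (hC : CubicRoots (conicP S) (conicQ S) p q r) (hpq : p ≠ q) (hpr : p ≠ r)
    (hqr : q ≠ r) (hi : divisorPQ S p = i) (hj : divisorPQ S q = j) (hk : divisorPQ S r = k)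
    (h0 : ∀ w, w ≠ p → w ≠ q → w ≠ r → divisorPQ S w = 0) :
    degPQ S = i + j + k ∧ maxMultC S = 1 ∧ divisorD S =
      ⇑(Finsupp.single p (i, (1 : ℕ∞)) + Finsupp.single q (j, (1 : ℕ∞))
        + Finsupp.single r (k, (1 : ℕ∞))) := by
  classical
  have hD : divisorD S = ⇑(Finsupp.single p (i, (1 : ℕ∞)) + Finsupp.single q (j, (1 : ℕ∞))
        + Finsupp.single r (k, (1 : ℕ∞))) := by
    funext w
    simp only [divisorD, divisorCZ_eq hC, Finsupp.add_apply, Finsupp.single_apply]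
    by_cases h1 : w = p
    · subst h1
      simp [hi, hpq, hpr, hpq.symm, hpr.symm]
    by_cases h2 : w = q
    · subst h2
      simp [hj, hpq, hqr, hpq.symm, hqr.symm]
    by_cases h3 : w = r
    · subst h3
      simp [hk, hpr, hqr, hpr.symm, hqr.symm]
    · simp [h0 w h1 h2 h3, h1, h2, h3, Ne.symm h1, Ne.symm h2, Ne.symm h3]
  refine ⟨?_, le_antisymm (iSup_le fun w => ?_) (le_iSup_of_le p ?_), hD⟩
  · rw [degPQ_of_divisorD hD, Finsupp.sum_add_index' (by simp) (by simp),
      Finsupp.sum_add_index' (by simp) (by simp)]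
    simp [Finsupp.sum_single_index]
  · rw [divisorCZ_eq hC]
    by_cases h1 : w = p
    · subst h1
      simp [hpq, hpr]
    by_cases h2 : w = q
    · subst h2
      simp [hpq.symm, hqr]
    · by_cases h3 : w = r <;> simp [h1, h2, h3, hpr.symm, hqr.symm]
  · simp [divisorCZ_eq hC, hpq, hpr]

theorem divisorD_two (hC : CubicRoots (conicP S) (conicQ S) p q q) (hpq : p ≠ q)
    (hi : divisorPQ S p = i) (hj : divisorPQ S q = j)
    (h0 : ∀ w, w ≠ p → w ≠ q → divisorPQ S w = 0) :
    degPQ S = i + j ∧ maxMultC S = 2 ∧ divisorD S =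
      ⇑(Finsupp.single p (i, (1 : ℕ∞)) + Finsupp.single q (j, (2 : ℕ∞))) := by
  classical
  have hD : divisorD S =
      ⇑(Finsupp.single p (i, (1 : ℕ∞)) + Finsupp.single q (j, (2 : ℕ∞))) := by
    funext w
    simp only [divisorD, divisorCZ_eq hC, Finsupp.add_apply, Finsupp.single_apply]
    by_cases h1 : w = p
    · subst h1
      simp [hi, hpq, hpq.symm]
    by_cases h2 : w = q
    · subst h2
      simp [hj, hpq, hpq.symm, one_add_one_eq_two]
    · simp [h0 w h1 h2, h1, h2, Ne.symm h1, Ne.symm h2]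
  refine ⟨?_, le_antisymm (iSup_le fun w => ?_) (le_iSup_of_le q ?_), hD⟩
  · rw [degPQ_of_divisorD hD, Finsupp.sum_add_index' (by simp) (by simp)]
    simp [Finsupp.sum_single_index]
  · rw [divisorCZ_eq hC]
    by_cases h1 : w = p
    · subst h1
      simp [hpq]
    · by_cases h2 : w = q <;> simp [h1, h2, hpq.symm, one_add_one_eq_two]
  · simp [divisorCZ_eq hC, hpq.symm, one_add_one_eq_two]

theorem divisorD_one (hC : CubicRoots (conicP S) (conicQ S) p p p)
    (hi : divisorPQ S p = i) (h0 : ∀ w, w ≠ p → divisorPQ S w = 0) :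
    degPQ S = i ∧ maxMultC S = 3 ∧ divisorD S = ⇑(Finsupp.single p (i, (3 : ℕ∞))) := by
  classical
  have h3 : (1 + 1 + 1 : ℕ∞) = 3 := by norm_num
  have hD : divisorD S = ⇑(Finsupp.single p (i, (3 : ℕ∞))) := by
    funext w
    simp only [divisorD, divisorCZ_eq hC, Finsupp.single_apply]
    by_cases h1 : w = p
    · subst h1
      simp [hi, h3]
    · simp [h0 w h1, h1, Ne.symm h1]
  refine ⟨?_, le_antisymm (iSup_le fun w => ?_) (le_iSup_of_le p ?_), hD⟩
  · rw [degPQ_of_divisorD hD]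
    simp [Finsupp.sum_single_index]
  · rw [divisorCZ_eq hC]
    by_cases h1 : w = p <;> simp [h1, h3]
  · simp [divisorCZ_eq hC, h3]

end

end

section

open Conic

/-! ### Every essentially quadratic system belongs to a row of the table -/

theorem exists_cubicRoots {S : QSystem} (hS : IsEssentiallyQuadratic S) :
    ∃ u v s, CubicRoots (conicP S) (conicQ S) u v s := by
  have hne := (not_X_dvd_curveC_iff S).1 hS.2
  rcases lt_trichotomy (value S eta 0 0) 0 with h | h | h
  · obtain ⟨p, q, r, -, -, -, -, -, -, hC⟩ := exists_roots_of_eta_neg hne h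
    exact ⟨p, q, r, hC⟩
  · obtain ⟨p, r, -, -, hC⟩ := exists_roots_of_eta_zero hne h
    exact ⟨r, p, p, hC⟩
  · obtain ⟨p, q, r, -, -, -, -, -, -, hC⟩ := exists_roots_of_eta_pos hne h
    exact ⟨p, q, r, hC⟩

theorem cond_cases (S : QSystem) : CondI1 S ∨ CondI2 S ∨ CondI3 S ∨ CondI4 S := by
  by_cases hM : Vanishes S M
  · exact Or.inr (Or.inr (Or.inr hM))
  · rcases lt_trichotomy (value S eta 0 0) 0 with h | h | h
    · exact Or.inr (Or.inl h)
    · exact Or.inr (Or.inr (Or.inl ⟨h, hM⟩))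
    · exact Or.inl h

/-! ### From multiplicities at the zeros of the cubic form to membership in a class. -/

section

variable {S : QSystem} {p q r : LineAtInfinity} {i j k d : ℕ∞}

theorem mem_sigmaClass_three (hS : IsEssentiallyQuadratic S)
    (hC : CubicRoots (conicP S) (conicQ S) p q r)
    (hr : IsRealPoint p ∧ IsRealPoint q ∧ IsRealPoint r ∧ p ≠ q ∧ p ≠ r ∧ q ≠ r)
    (hi : divisorPQ S p = i) (hj : divisorPQ S q = j) (hk : divisorPQ S r = k)
    (h0 : ∀ w, w ≠ p → w ≠ q → w ≠ r → divisorPQ S w = 0) {n : Fin 36} {f : QSystem → Prop}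
    (hn : table n = ⟨d, 1, Three (i, 1) (j, 1) (k, 1), f⟩) (hd : i + j + k = d) :
    S ∈ sigmaClass n := by
  obtain ⟨h1, h2, h3, hpq, hpr, hqr⟩ := hr
  obtain ⟨e1, e2, e3⟩ := divisorD_three hC hpq hpr hqr hi hj hk h0
  refine ⟨hS, ?_, ?_, ?_⟩
  · rw [hn, e1, hd]
  · rw [hn, e2]
  · rw [hn]
    exact ⟨p, q, r, h1, h2, h3, hpq, hpr, hqr, e3⟩

theorem mem_sigmaClass_threeC (hS : IsEssentiallyQuadratic S)
    (hC : CubicRoots (conicP S) (conicQ S) p q r)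
    (hr : IsRealPoint p ∧ ¬ IsRealPoint q ∧ ¬ IsRealPoint r ∧ p ≠ q ∧ p ≠ r ∧ q ≠ r)
    (hi : divisorPQ S p = i) (hj : divisorPQ S q = j) (hk : divisorPQ S r = k)
    (h0 : ∀ w, w ≠ p → w ≠ q → w ≠ r → divisorPQ S w = 0) {n : Fin 36} {f : QSystem → Prop}
    (hn : table n = ⟨d, 1, ThreeC (i, 1) (j, 1) (k, 1), f⟩) (hd : i + j + k = d) :
    S ∈ sigmaClass n := by
  obtain ⟨h1, h2, h3, hpq, hpr, hqr⟩ := hr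
  obtain ⟨e1, e2, e3⟩ := divisorD_three hC hpq hpr hqr hi hj hk h0
  refine ⟨hS, ?_, ?_, ?_⟩
  · rw [hn, e1, hd]
  · rw [hn, e2]
  · rw [hn]
    exact ⟨p, q, r, h1, h2, h3, hpq, hpr, hqr, e3⟩

theorem mem_sigmaClass_two (hS : IsEssentiallyQuadratic S)
    (hC : CubicRoots (conicP S) (conicQ S) p q q) (hr : IsRealPoint p ∧ IsRealPoint q ∧ p ≠ q)
    (hi : divisorPQ S p = i) (hj : divisorPQ S q = j)
    (h0 : ∀ w, w ≠ p → w ≠ q → divisorPQ S w = 0) {n : Fin 36} {f : QSystem → Prop}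
    (hn : table n = ⟨d, 2, Two (i, 1) (j, 2), f⟩) (hd : i + j = d) :
    S ∈ sigmaClass n := by
  obtain ⟨h1, h2, hpq⟩ := hr
  obtain ⟨e1, e2, e3⟩ := divisorD_two hC hpq hi hj h0
  refine ⟨hS, ?_, ?_, ?_⟩
  · rw [hn, e1, hd]
  · rw [hn, e2]
  · rw [hn]
    exact ⟨p, q, h1, h2, hpq, e3⟩

theorem mem_sigmaClass_one (hS : IsEssentiallyQuadratic S)
    (hC : CubicRoots (conicP S) (conicQ S) p p p) (hr : IsRealPoint p)
    (hi : divisorPQ S p = i) (h0 : ∀ w, w ≠ p → divisorPQ S w = 0) {n : Fin 36}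
    {f : QSystem → Prop} (hn : table n = ⟨i, 3, One (i, 3), f⟩) :
    S ∈ sigmaClass n := by
  obtain ⟨e1, e2, e3⟩ := divisorD_one hC hi h0
  refine ⟨hS, ?_, ?_, ?_⟩
  · rw [hn, e1]
  · rw [hn, e2]
  · rw [hn]
    exact ⟨p, hr, e3⟩

end

theorem exists_row_of_no_common_zero {S : QSystem} (hS : IsEssentiallyQuadratic S)
    (hm : FirstMu S 0) (h0 : ∀ w, divisorPQ S w = 0) :
    ∃ i, (table i).cond S ∧ S ∈ sigmaClass i := by
  obtain ⟨u, v, s, hC⟩ := exists_cubicRoots hS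
  rcases cond_cases S with hI | hI | hI | hI
  · exact ⟨0, ⟨hm, hI⟩, mem_sigmaClass_three hS hC (roots_of_condI1 hS hC hI) (h0 _) (h0 _) (h0 _)
      (fun w _ _ _ => h0 w) rfl (by norm_num)⟩
  · refine ⟨1, ⟨hm, hI⟩, ?_⟩
    obtain ⟨h1, h2, h3, h4 | h4 | h4⟩ := roots_of_condI2 hS hC hI
    · exact mem_sigmaClass_threeC hS hC (by tauto) (h0 _) (h0 _) (h0 _)
        (fun w _ _ _ => h0 w) rfl (by norm_num)
    · exact mem_sigmaClass_threeC hS hC.perm213 (by have := h1.symm; tauto) (h0 _) (h0 _) (h0 _)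
        (fun w _ _ _ => h0 w) rfl (by norm_num)
    · exact mem_sigmaClass_threeC hS hC.perm132.perm213
        (by have := h2.symm; have := h3.symm; tauto) (h0 _) (h0 _) (h0 _)
        (fun w _ _ _ => h0 w) rfl (by norm_num)
  · refine ⟨2, ⟨hm, hI⟩, ?_⟩
    obtain ⟨h1, h2, h3, ⟨rfl, h4⟩ | ⟨rfl, h4⟩ | ⟨rfl, h4⟩⟩ := roots_of_condI3 hS hC hI
    · exact mem_sigmaClass_two hS hC.perm132.perm213 ⟨h3, h1, h4.symm⟩ (h0 _) (h0 _)
        (fun w _ _ => h0 w) rfl (by norm_num)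
    · exact mem_sigmaClass_two hS hC.perm213 ⟨h2, h1, h4.symm⟩ (h0 _) (h0 _)
        (fun w _ _ => h0 w) rfl (by norm_num)
    · exact mem_sigmaClass_two hS hC ⟨h1, h2, h4⟩ (h0 _) (h0 _)
        (fun w _ _ => h0 w) rfl (by norm_num)
  · obtain ⟨h1, rfl, rfl⟩ := roots_of_condI4 hS hC hI
    exact ⟨3, ⟨hm, hI⟩, mem_sigmaClass_one hS hC h1 (h0 _) (fun w _ => h0 w) rfl⟩

/-- All of the multiplicity m sits at the real zero u. The row is fixed by m, by the type of the
cubic form and, when that form has exactly one double zero, by whether u is this zero. -/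
theorem exists_row_of_not_proportional {S : QSystem} (hS : IsEssentiallyQuadratic S)
    (hprop : ¬ Proportional (conicP S) (conicQ S))
    (hzero : ∃ x y, (x ≠ 0 ∨ y ≠ 0) ∧ (conicP S).quad x y = 0 ∧ (conicQ S).quad x y = 0) :
    ∃ i, (table i).cond S ∧ S ∈ sigmaClass i := by
  obtain ⟨u, v, s, m, hC, hu, hm1, hm4, hm, hI, h0, hκ, hsv, hL⟩ :=
    structure_of_not_proportional hS hprop hzero
  have h0' : ∀ w, u ≠ w → divisorPQ S w = 0 := fun w hw => h0 w (Ne.symm hw)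
  rcases cond_cases S with h | h | h | h
  · have hr := roots_of_condI1 hS hC h
    have huv := hr.2.2.2.1
    have hus := hr.2.2.2.2.1
    have hκ' : ¬ Vanishes S kappa := fun h => huv (hκ.1 h)
    interval_cases m
    · exact ⟨4, ⟨hm, h⟩, mem_sigmaClass_three hS hC hr hI (h0' _ huv) (h0' _ hus)
        (fun w hw _ _ => h0 w hw) rfl (by norm_num)⟩
    · exact ⟨9, ⟨hm, hκ', h⟩, mem_sigmaClass_three hS hC hr hI (h0' _ huv) (h0' _ hus)
        (fun w hw _ _ => h0 w hw) rfl (by norm_num)⟩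
    · exact ⟨17, ⟨hm, hκ', h⟩, mem_sigmaClass_three hS hC hr hI (h0' _ huv) (h0' _ hus)
        (fun w hw _ _ => h0 w hw) rfl (by norm_num)⟩
    · exact ⟨25, ⟨hm, hκ', h⟩, mem_sigmaClass_three hS hC hr hI (h0' _ huv) (h0' _ hus)
        (fun w hw _ _ => h0 w hw) rfl (by norm_num)⟩
  · obtain ⟨huv, hus, hvs, hr⟩ := roots_of_condI2 hS hC h
    have hr' : IsRealPoint u ∧ ¬ IsRealPoint v ∧ ¬ IsRealPoint s ∧ u ≠ v ∧ u ≠ s ∧ v ≠ s := by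
      tauto
    have hκ' : ¬ Vanishes S kappa := fun h => huv (hκ.1 h)
    interval_cases m
    · exact ⟨5, ⟨hm, h⟩, mem_sigmaClass_threeC hS hC hr' hI (h0' _ huv) (h0' _ hus)
        (fun w hw _ _ => h0 w hw) rfl (by norm_num)⟩
    · exact ⟨11, ⟨hm, hκ', h⟩, mem_sigmaClass_threeC hS hC hr' hI (h0' _ huv) (h0' _ hus)
        (fun w hw _ _ => h0 w hw) rfl (by norm_num)⟩
    · exact ⟨19, ⟨hm, h⟩, mem_sigmaClass_threeC hS hC hr' hI (h0' _ huv) (h0' _ hus)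
        (fun w hw _ _ => h0 w hw) rfl (by norm_num)⟩
    · exact ⟨28, ⟨hm, hκ', h⟩, mem_sigmaClass_threeC hS hC hr' hI (h0' _ huv) (h0' _ hus)
        (fun w hw _ _ => h0 w hw) rfl (by norm_num)⟩
  · obtain ⟨h1, h2, h3, ⟨rfl, h4⟩ | ⟨rfl, h4⟩ | ⟨rfl, h4⟩⟩ := roots_of_condI3 hS hC h
    · have hκ' := hκ.2 rfl
      have hL' := hL rfl h4
      have hC' := hC.perm132.perm213
      have hr := (⟨h3, h1, h4.symm⟩ : IsRealPoint s ∧ IsRealPoint u ∧ s ≠ u)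
      interval_cases m
      · exact ⟨7, ⟨hm, hκ', h⟩, mem_sigmaClass_two hS hC' hr (h0' _ h4) hI
          (fun w _ hw => h0 w hw) rfl (by norm_num)⟩
      · exact ⟨15, ⟨hm, hκ', hL', h⟩, mem_sigmaClass_two hS hC' hr (h0' _ h4) hI
          (fun w _ hw => h0 w hw) rfl (by norm_num)⟩
      · exact ⟨23, ⟨hm, hκ', hL', h⟩, mem_sigmaClass_two hS hC' hr (h0' _ h4) hI
          (fun w _ hw => h0 w hw) rfl (by norm_num)⟩
      · exact ⟨34, ⟨hm, hκ', hL', h⟩, mem_sigmaClass_two hS hC' hr (h0' _ h4) hI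
          (fun w _ hw => h0 w hw) rfl (by norm_num)⟩
    -- The ordering of the zeros chosen in `structure_of_not_proportional` excludes this case.
    · exact absurd (hsv rfl) h4
    · have hκ' : ¬ Vanishes S kappa := fun h => h4 (hκ.1 h)
      have hr := (⟨h1, h2, h4⟩ : IsRealPoint u ∧ IsRealPoint v ∧ u ≠ v)
      interval_cases m
      · exact ⟨6, ⟨hm, hκ', h⟩, mem_sigmaClass_two hS hC hr hI (h0' _ h4)
          (fun w hw _ => h0 w hw) rfl (by norm_num)⟩
      · exact ⟨13, ⟨hm, hκ', h⟩, mem_sigmaClass_two hS hC hr hI (h0' _ h4)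
          (fun w hw _ => h0 w hw) rfl (by norm_num)⟩
      · exact ⟨20, ⟨hm, hκ', h⟩, mem_sigmaClass_two hS hC hr hI (h0' _ h4)
          (fun w hw _ => h0 w hw) rfl (by norm_num)⟩
      · exact ⟨30, ⟨hm, hκ', h⟩, mem_sigmaClass_two hS hC hr hI (h0' _ h4)
          (fun w hw _ => h0 w hw) rfl (by norm_num)⟩
  · obtain ⟨h1, rfl, rfl⟩ := roots_of_condI4 hS hC h
    interval_cases m
    · exact ⟨8, ⟨hm, h⟩, mem_sigmaClass_one hS hC h1 hI h0 rfl⟩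
    · exact ⟨16, ⟨hm, h⟩, mem_sigmaClass_one hS hC h1 hI h0 rfl⟩
    · exact ⟨24, ⟨hm, h⟩, mem_sigmaClass_one hS hC h1 hI h0 rfl⟩
    · exact ⟨35, ⟨hm, h⟩, mem_sigmaClass_one hS hC h1 hI h0 rfl⟩

theorem exists_row_of_proportional {S : QSystem} (hS : IsEssentiallyQuadratic S)
    (hprop : Proportional (conicP S) (conicQ S)) :
    ∃ i, (table i).cond S ∧ S ∈ sigmaClass i := by
  obtain ⟨u, v, s, hC, hs, h0, hκ, ⟨rfl, hL, m, hm2, hm4, hm, hI⟩ | ⟨huv, hL, hcase⟩⟩ :=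
    structure_of_proportional hS hprop
  · replace h0 : ∀ w, w ≠ u → divisorPQ S w = 0 := fun w h => h0 w h h
    rcases cond_cases S with h | h | h | h
    · exact absurd rfl (roots_of_condI1 hS hC h).2.2.2.1
    · exact absurd rfl (roots_of_condI2 hS hC h).1
    · obtain ⟨h1, -, h3, h4⟩ := roots_of_condI3 hS hC h
      have hus : u ≠ s := by tauto
      have hC' := hC.perm132.perm213
      have hr := (⟨h3, h1, hus.symm⟩ : IsRealPoint s ∧ IsRealPoint u ∧ s ≠ u)
      interval_cases m
      · exact ⟨15, ⟨hm, hκ, hL hus, h⟩, mem_sigmaClass_two hS hC' hr (h0 _ hus.symm) hI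
          (fun w _ hw => h0 w hw) rfl (by norm_num)⟩
      · exact ⟨23, ⟨hm, hκ, hL hus, h⟩, mem_sigmaClass_two hS hC' hr (h0 _ hus.symm) hI
          (fun w _ hw => h0 w hw) rfl (by norm_num)⟩
      · exact ⟨34, ⟨hm, hκ, hL hus, h⟩, mem_sigmaClass_two hS hC' hr (h0 _ hus.symm) hI
          (fun w _ hw => h0 w hw) rfl (by norm_num)⟩
    · obtain ⟨h1, -, rfl⟩ := roots_of_condI4 hS hC h
      interval_cases m
      · exact ⟨16, ⟨hm, h⟩, mem_sigmaClass_one hS hC h1 hI h0 rfl⟩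
      · exact ⟨24, ⟨hm, h⟩, mem_sigmaClass_one hS hC h1 hI h0 rfl⟩
      · exact ⟨35, ⟨hm, h⟩, mem_sigmaClass_one hS hC h1 hI h0 rfl⟩
  · rcases cond_cases S with h | h | h | h
    · have hr := roots_of_condI1 hS hC h
      have hs0 := h0 s hr.2.2.2.2.1.symm hr.2.2.2.2.2.symm
      rcases hcase with ⟨hm, hu, hv⟩ | ⟨k, rfl | rfl, hm, hu, hv, -, hK, -⟩ | ⟨hm, hu, hv, hK, -⟩
      · exact ⟨10, ⟨hm, hκ, h⟩, mem_sigmaClass_three hS hC hr hu hv hs0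
          (fun w h1 h2 _ => h0 w h1 h2) rfl (by norm_num)⟩
      · exact ⟨18, ⟨hm, hκ, h⟩, mem_sigmaClass_three hS hC hr hu hv hs0
          (fun w h1 h2 _ => h0 w h1 h2) rfl (by norm_num)⟩
      · exact ⟨26, ⟨hm, hκ, hK, h⟩, mem_sigmaClass_three hS hC hr hu hv hs0
          (fun w h1 h2 _ => h0 w h1 h2) rfl (by norm_num)⟩
      · exact ⟨27, ⟨hm, hκ, hK, h⟩, mem_sigmaClass_three hS hC hr hu hv hs0
          (fun w h1 h2 _ => h0 w h1 h2) rfl (by norm_num)⟩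
    · obtain ⟨-, hus, hvs, hr⟩ := roots_of_condI2 hS hC h
      have hr' : IsRealPoint s ∧ ¬ IsRealPoint u ∧ ¬ IsRealPoint v ∧ s ≠ u ∧ s ≠ v ∧ u ≠ v :=
        ⟨hs, by tauto, by tauto, hus.symm, hvs.symm, huv⟩
      have hs0 := h0 s hus.symm hvs.symm
      have hC' := hC.perm132.perm213
      rcases hcase with ⟨hm, hu, hv⟩ | ⟨k, -, -, -, -, hu, -⟩ | ⟨hm, hu, hv, -⟩
      · exact ⟨12, ⟨hm, hκ, h⟩, mem_sigmaClass_threeC hS hC' hr' hs0 hu hv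
          (fun w _ h1 h2 => h0 w h1 h2) rfl (by norm_num)⟩
      -- Unequal multiplicities would make u real, while u and v form the complex pair here. This is
      -- why the row with `E₃` and `𝓘₂` needs no condition on κ.
      · exact absurd hu hr'.2.1
      · exact ⟨29, ⟨hm, hκ, h⟩, mem_sigmaClass_threeC hS hC' hr' hs0 hu hv
          (fun w _ h1 h2 => h0 w h1 h2) rfl (by norm_num)⟩
    · obtain ⟨h1, h2, -, ⟨h4, -⟩ | ⟨rfl, -⟩ | ⟨rfl, -⟩⟩ := roots_of_condI3 hS hC h
      · exact absurd h4 huv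
      · have hC' := hC.perm213
        have hL' := hL (Or.inl rfl)
        have hr := (⟨h2, h1, huv.symm⟩ : IsRealPoint v ∧ IsRealPoint u ∧ v ≠ u)
        rcases hcase with ⟨hm, hu, hv⟩ | ⟨k, rfl | rfl, hm, hu, hv, -, hK, hκ₁, -⟩ |
          ⟨hm, hu, hv, hK, hκ₁⟩
        · exact ⟨14, ⟨hm, hκ, hL', h⟩, mem_sigmaClass_two hS hC' hr hv hu
            (fun w h1 h2 => h0 w h2 h1) rfl (by norm_num)⟩
        · exact ⟨22, ⟨hm, hκ, hL', hκ₁ rfl, h⟩, mem_sigmaClass_two hS hC' hr hv hu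
            (fun w h1 h2 => h0 w h2 h1) rfl (by norm_num)⟩
        · exact ⟨33, ⟨hm, hκ, hL', hκ₁ rfl, hK, h⟩, mem_sigmaClass_two hS hC' hr hv hu
            (fun w h1 h2 => h0 w h2 h1) rfl (by norm_num)⟩
        · exact ⟨32, ⟨hm, hκ, hL', hκ₁ (Or.inl rfl), hK, h⟩, mem_sigmaClass_two hS hC' hr hv hu
            (fun w h1 h2 => h0 w h2 h1) rfl (by norm_num)⟩
      · have hL' := hL (Or.inr rfl)
        have hr := (⟨h1, h2, huv⟩ : IsRealPoint u ∧ IsRealPoint v ∧ u ≠ v)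
        rcases hcase with ⟨hm, hu, hv⟩ | ⟨k, rfl | rfl, hm, hu, hv, -, hK, -, hκ₁⟩ |
          ⟨hm, hu, hv, hK, hκ₁⟩
        · exact ⟨14, ⟨hm, hκ, hL', h⟩, mem_sigmaClass_two hS hC hr hu hv h0 rfl (by norm_num)⟩
        · exact ⟨21, ⟨hm, hκ, hL', hκ₁ rfl, h⟩,
            mem_sigmaClass_two hS hC hr hu hv h0 rfl (by norm_num)⟩
        · exact ⟨31, ⟨hm, hκ, hL', hκ₁ rfl, h⟩,
            mem_sigmaClass_two hS hC hr hu hv h0 rfl (by norm_num)⟩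
        · exact ⟨32, ⟨hm, hκ, hL', hκ₁ (Or.inr rfl), hK, h⟩,
            mem_sigmaClass_two hS hC hr hu hv h0 rfl (by norm_num)⟩
    · exact absurd (roots_of_condI4 hS hC h).2.1 huv

theorem exists_row {S : QSystem} (hS : IsEssentiallyQuadratic S) :
    ∃ i, (table i).cond S ∧ S ∈ sigmaClass i := by
  by_cases hzero : ∃ x y, (x ≠ 0 ∨ y ≠ 0) ∧ (conicP S).quad x y = 0 ∧ (conicQ S).quad x y = 0
  · by_cases hprop : Proportional (conicP S) (conicQ S)
    · exact exists_row_of_proportional hS hprop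
    · exact exists_row_of_not_proportional hS hprop hzero
  · exact exists_row_of_no_common_zero hS ((firstMu_iff S 0).2
      ((hasOrder_zero_or_exists_common_zero _ _).resolve_right hzero))
      (fun w => by rw [divisorPQ_eq, intersectionNumber_eq_zero_of_no_common_zero hzero])

end

section

/-! ### The conditions of different rows exclude each other -/

/-- The conditions of a row: the index of the first nonvanishing `μ_i`, the type of the cubic form,
and whether `κ`, `L`, `κ₁`, `K₁` are required to vanish (`some true`), not to vanish
(`some false`), or are not restricted. -/
def pattern : Fin 36 → ℕ × ℕ × Option Bool × Option Bool × Option Bool × Option Bool := ![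
  (0, 1, none, none, none, none), (0, 2, none, none, none, none), (0, 3, none, none, none, none),
  (0, 4, none, none, none, none),
  (1, 1, none, none, none, none), (1, 2, none, none, none, none),
  (1, 3, false, none, none, none), (1, 3, true, none, none, none), (1, 4, none, none, none, none),
  (2, 1, false, none, none, none), (2, 1, true, none, none, none),
  (2, 2, false, none, none, none), (2, 2, true, none, none, none),
  (2, 3, false, none, none, none), (2, 3, true, true, none, none),
  (2, 3, true, false, none, none), (2, 4, none, none, none, none),
  (3, 1, false, none, none, none), (3, 1, true, none, none, none), (3, 2, none, none, none, none),
  (3, 3, false, none, none, none), (3, 3, true, true, false, none),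
  (3, 3, true, true, true, none), (3, 3, true, false, none, none), (3, 4, none, none, none, none),
  (4, 1, false, none, none, none), (4, 1, true, none, none, false),
  (4, 1, true, none, none, true), (4, 2, false, none, none, none), (4, 2, true, none, none, none),
  (4, 3, false, none, none, none), (4, 3, true, true, false, none),
  (4, 3, true, true, true, true), (4, 3, true, true, true, false),
  (4, 3, true, false, none, none), (4, 4, none, none, none, none)]

/-- A requirement on the truth of a proposition. -/
def Requires (o : Option Bool) (p : Prop) : Prop := ∀ b, o = some b → (b = true ↔ p)

/-- Two requirements that contradict each other. -/
def conflict (o o' : Option Bool) : Bool :=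
  o == some true && o' == some false || o == some false && o' == some true

theorem Requires.not_conflict {o o' : Option Bool} {p : Prop} (h : Requires o p)
    (h' : Requires o' p) : conflict o o' = false := by
  rcases o with - | - | - <;> rcases o' with - | - | - <;> simp_all [Requires, conflict]

/-- The condition `𝓘_t` on the cubic form. -/
def CondType (S : QSystem) (t : ℕ) : Prop :=
  (t = 1 ∧ CondI1 S) ∨ (t = 2 ∧ CondI2 S) ∨ (t = 3 ∧ CondI3 S) ∨ (t = 4 ∧ CondI4 S)

theorem CondType.unique {S : QSystem} {t t' : ℕ} (h : CondType S t) (h' : CondType S t') :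
    t = t' := by
  have h4 : CondI4 S → value S eta 0 0 = 0 := value_eta_of_vanishes_M
  unfold CondType CondI1 CondI2 CondI3 at h h'
  unfold CondI4 at h h' h4
  rcases h with ⟨rfl, h⟩ | ⟨rfl, h⟩ | ⟨rfl, h⟩ | ⟨rfl, h⟩ <;>
    rcases h' with ⟨rfl, h'⟩ | ⟨rfl, h'⟩ | ⟨rfl, h'⟩ | ⟨rfl, h'⟩ <;>
    first
    | rfl
    | (exfalso; first
      | linarith
      | linarith [h.1]
      | linarith [h'.1]
      | linarith [h4 h]
      | linarith [h4 h']
      | exact h.2 h'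
      | exact h'.2 h)

/-- The conditions encoded by a pattern. -/
def Fits (S : QSystem) (c : ℕ × ℕ × Option Bool × Option Bool × Option Bool × Option Bool) : Prop :=
  FirstMu S c.1 ∧ CondType S c.2.1 ∧ Requires c.2.2.1 (Vanishes S kappa) ∧
    Requires c.2.2.2.1 (Vanishes S L) ∧ Requires c.2.2.2.2.1 (Vanishes S kappa1) ∧
    Requires c.2.2.2.2.2 (Vanishes S K1)

theorem fits_of_cond {S : QSystem} (i : Fin 36) (h : (table i).cond S) : Fits S (pattern i) := by
  fin_cases i <;> simp [table] at h <;> simp [pattern, Fits, CondType, Requires, h]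

/-- A system determines the index m and the type of its cubic form. Two distinct rows that share
both make opposite requirements on one of κ, L, κ₁, K₁, a finite check on `pattern`. -/
theorem eq_of_fits {S : QSystem} {i j : Fin 36} (hi : Fits S (pattern i))
    (hj : Fits S (pattern j)) : i = j := by
  obtain ⟨m1, t1, a1, b1, c1, d1⟩ := hi
  obtain ⟨m2, t2, a2, b2, c2, d2⟩ := hj
  have key : ∀ i j : Fin 36, (pattern i).1 = (pattern j).1 → (pattern i).2.1 = (pattern j).2.1 →
      conflict (pattern i).2.2.1 (pattern j).2.2.1 = false →
      conflict (pattern i).2.2.2.1 (pattern j).2.2.2.1 = false →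
      conflict (pattern i).2.2.2.2.1 (pattern j).2.2.2.2.1 = false →
      conflict (pattern i).2.2.2.2.2 (pattern j).2.2.2.2.2 = false → i = j := by
    decide +kernel
  exact key i j (((firstMu_iff S _).1 m1).unique ((firstMu_iff S _).1 m2)) (t1.unique t2)
    (a1.not_conflict a2) (b1.not_conflict b2) (c1.not_conflict c2) (d1.not_conflict d2)

/-! ### Different rows have different divisors -/

/-- The value of `Δ_S`, the nonzero values of the divisor at real points, and the nonzero values at
the other points, for each row. -/
def rowValues : Fin 36 → ℕ × Finset (ℕ × ℕ) × Finset (ℕ × ℕ) := ![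
  (0, {(0, 1)}, ∅), (0, {(0, 1)}, {(0, 1)}), (0, {(0, 1), (0, 2)}, ∅), (0, {(0, 3)}, ∅),
  (1, {(1, 1), (0, 1)}, ∅), (1, {(1, 1)}, {(0, 1)}), (1, {(1, 1), (0, 2)}, ∅),
  (1, {(0, 1), (1, 2)}, ∅), (1, {(1, 3)}, ∅),
  (2, {(2, 1), (0, 1)}, ∅), (2, {(1, 1), (0, 1)}, ∅), (2, {(2, 1)}, {(0, 1)}),
  (2, {(0, 1)}, {(1, 1)}), (2, {(2, 1), (0, 2)}, ∅), (2, {(1, 1), (1, 2)}, ∅),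
  (2, {(0, 1), (2, 2)}, ∅), (2, {(2, 3)}, ∅),
  (3, {(3, 1), (0, 1)}, ∅), (3, {(2, 1), (1, 1), (0, 1)}, ∅), (3, {(3, 1)}, {(0, 1)}),
  (3, {(3, 1), (0, 2)}, ∅), (3, {(2, 1), (1, 2)}, ∅), (3, {(1, 1), (2, 2)}, ∅),
  (3, {(0, 1), (3, 2)}, ∅), (3, {(3, 3)}, ∅),
  (4, {(4, 1), (0, 1)}, ∅), (4, {(3, 1), (1, 1), (0, 1)}, ∅), (4, {(2, 1), (0, 1)}, ∅),
  (4, {(4, 1)}, {(0, 1)}), (4, {(0, 1)}, {(2, 1)}),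
  (4, {(4, 1), (0, 2)}, ∅), (4, {(3, 1), (1, 2)}, ∅), (4, {(2, 1), (2, 2)}, ∅),
  (4, {(1, 1), (3, 2)}, ∅), (4, {(0, 1), (4, 2)}, ∅), (4, {(4, 3)}, ∅)]

section

variable {D : PairDivisor} {s t u v : ℕ∞ × ℕ∞}

theorem One.values (h : One s D) (hv : v ≠ 0) :
    ((∃ w, IsRealPoint w ∧ D w = v) ↔ v = s) ∧ ((∃ w, ¬ IsRealPoint w ∧ D w = v) ↔ False) := by
  classical
  obtain ⟨p, hp, rfl⟩ := h
  simp only [Finsupp.single_apply]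
  constructor
  · constructor
    · rintro ⟨w, hw, rfl⟩
      split_ifs at hv ⊢ <;> simp_all
    · rintro rfl
      exact ⟨p, hp, if_pos rfl⟩
  · simp only [iff_false]
    rintro ⟨w, hw, rfl⟩
    split_ifs at hv <;> simp_all

theorem Two.values (h : Two s t D) (hv : v ≠ 0) :
    ((∃ w, IsRealPoint w ∧ D w = v) ↔ v = s ∨ v = t) ∧
      ((∃ w, ¬ IsRealPoint w ∧ D w = v) ↔ False) := by
  classical
  obtain ⟨p, q, hp, hq, hpq, rfl⟩ := h
  simp only [Finsupp.add_apply, Finsupp.single_apply]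
  constructor
  · constructor
    · rintro ⟨w, hw, rfl⟩
      split_ifs at hv ⊢ <;> simp_all
    · rintro (rfl | rfl)
      · exact ⟨p, hp, by simp [hpq.symm]⟩
      · exact ⟨q, hq, by simp [hpq]⟩
  · simp only [iff_false]
    rintro ⟨w, hw, rfl⟩
    split_ifs at hv <;> simp_all

theorem Three.values (h : Three s t u D) (hv : v ≠ 0) :
    ((∃ w, IsRealPoint w ∧ D w = v) ↔ v = s ∨ v = t ∨ v = u) ∧
      ((∃ w, ¬ IsRealPoint w ∧ D w = v) ↔ False) := by
  classical
  obtain ⟨p, q, r, hp, hq, hr, hpq, hpr, hqr, rfl⟩ := h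
  simp only [Finsupp.add_apply, Finsupp.single_apply]
  constructor
  · constructor
    · rintro ⟨w, hw, rfl⟩
      split_ifs at hv ⊢ <;> simp_all
    · rintro (rfl | rfl | rfl)
      · exact ⟨p, hp, by simp [hpq.symm, hpr.symm]⟩
      · exact ⟨q, hq, by simp [hpq, hqr.symm]⟩
      · exact ⟨r, hr, by simp [hpr, hqr]⟩
  · simp only [iff_false]
    rintro ⟨w, hw, rfl⟩
    split_ifs at hv <;> simp_all

theorem ThreeC.values (h : ThreeC s t u D) (hv : v ≠ 0) :
    ((∃ w, IsRealPoint w ∧ D w = v) ↔ v = s) ∧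
      ((∃ w, ¬ IsRealPoint w ∧ D w = v) ↔ v = t ∨ v = u) := by
  classical
  obtain ⟨p, q, r, hp, hq, hr, hpq, hpr, hqr, rfl⟩ := h
  simp only [Finsupp.add_apply, Finsupp.single_apply]
  constructor
  · constructor
    · rintro ⟨w, hw, rfl⟩
      split_ifs at hv ⊢ <;> simp_all
    · rintro rfl
      exact ⟨p, hp, by simp [hpq.symm, hpr.symm]⟩
  · constructor
    · rintro ⟨w, hw, rfl⟩
      split_ifs at hv ⊢ <;> simp_all
    · rintro (rfl | rfl)
      · exact ⟨q, hq, by simp [hpq, hqr.symm]⟩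
      · exact ⟨r, hr, by simp [hpr, hqr]⟩

end

theorem rowValues_spec {D : PairDivisor} (i : Fin 36) (h : (table i).form D) (a b : ℕ)
    (hab : ((a : ℕ∞), (b : ℕ∞)) ≠ 0) :
    (table i).deg = (rowValues i).1 ∧
    ((∃ w, IsRealPoint w ∧ D w = ((a : ℕ∞), (b : ℕ∞))) ↔ (a, b) ∈ (rowValues i).2.1) ∧
    ((∃ w, ¬ IsRealPoint w ∧ D w = ((a : ℕ∞), (b : ℕ∞))) ↔ (a, b) ∈ (rowValues i).2.2) := by
  have e2 : ∀ c : ℕ, (c : ℕ∞) = 2 ↔ c = 2 := fun c => by exact_mod_cast Iff.rfl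
  have e3 : ∀ c : ℕ, (c : ℕ∞) = 3 ↔ c = 3 := fun c => by exact_mod_cast Iff.rfl
  have e4 : ∀ c : ℕ, (c : ℕ∞) = 4 ↔ c = 4 := fun c => by exact_mod_cast Iff.rfl
  refine ⟨?_, ?_⟩
  · fin_cases i <;> rfl
  · fin_cases i <;>
    first
    | (have h' := One.values h hab
       rw [h'.1, h'.2]; simp [rowValues, Prod.ext_iff, e2, e3, e4])
    | (have h' := Two.values h hab
       rw [h'.1, h'.2]; simp [rowValues, Prod.ext_iff, e2, e3, e4])
    | (have h' := Three.values h hab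
       rw [h'.1, h'.2]; simp [rowValues, Prod.ext_iff, e2, e3, e4])
    | (have h' := ThreeC.values h hab
       rw [h'.1, h'.2]; simp [rowValues, Prod.ext_iff, e2, e3, e4])

/-- The nonzero values of the divisor at real points and at non-real points, together with Δ_S,
already separate the rows, although the number of points with a given value is forgotten. The pair
(0, 0), taken off the support, is left out. -/
theorem eq_of_mem_sigmaClass {S : QSystem} {i j : Fin 36} (hi : S ∈ sigmaClass i)
    (hj : S ∈ sigmaClass j) : i = j := by
  obtain ⟨-, di, -, fi⟩ := hi
  obtain ⟨-, dj, -, fj⟩ := hj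
  have key : ∀ i j : Fin 36, rowValues i = rowValues j → i = j := by decide +kernel
  have h0 : ∀ i : Fin 36, (0, 0) ∉ (rowValues i).2.1 ∧ (0, 0) ∉ (rowValues i).2.2 := by
    decide +kernel
  have hne : ∀ {a b : ℕ}, (a, b) ≠ (0, 0) → ((a : ℕ∞), (b : ℕ∞)) ≠ 0 := by
    intro a b h h'
    simp_all [Prod.ext_iff]
  apply key
  refine Prod.ext ?_ (Prod.ext ?_ ?_)
  · have e1 := (rowValues_spec i fi 1 0 (by simp)).1
    have e2 := (rowValues_spec j fj 1 0 (by simp)).1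
    rw [← di] at e1
    rw [← dj] at e2
    exact_mod_cast e1.symm.trans e2
  · ext ⟨a, b⟩
    by_cases hab : (a, b) = (0, 0)
    · rw [hab]
      exact iff_of_false (h0 i).1 (h0 j).1
    · rw [← (rowValues_spec i fi a b (hne hab)).2.1, ← (rowValues_spec j fj a b (hne hab)).2.1]
  · ext ⟨a, b⟩
    by_cases hab : (a, b) = (0, 0)
    · rw [hab]
      exact iff_of_false (h0 i).2 (h0 j).2
    · rw [← (rowValues_spec i fi a b (hne hab)).2.2, ← (rowValues_spec j fj a b (hne hab)).2.2]

/-- `exists_row` gives a row j in which both descriptions hold. Either description for i forces i =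
j, and then the other one holds as well. -/
theorem mem_sigmaClass_iff {S : QSystem} (hS : IsEssentiallyQuadratic S) (i : Fin 36) :
    S ∈ sigmaClass i ↔ (table i).cond S := by
  obtain ⟨j, hj, hj'⟩ := exists_row hS
  constructor
  · intro h
    rwa [eq_of_mem_sigmaClass h hj']
  · intro h
    rwa [eq_of_fits (fits_of_cond i h) (fits_of_cond j hj)]

theorem existsUnique_sigmaClass {S : QSystem} (hS : IsEssentiallyQuadratic S) :
    ∃! i : Fin 36, S ∈ sigmaClass i := by
  obtain ⟨j, -, hj⟩ := exists_row hS
  exact ⟨j, hj, fun i hi => eq_of_mem_sigmaClass hi hj⟩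

end

section

open MvPolynomial Conic

/-! ### Systems with a nonvanishing `μ_m` have no common factor -/

/-- A divisor of a nonzero form is constant unless it vanishes at the origin. -/
theorem isUnit_of_dvd_form {F G P : MvPolynomial (Fin 3) ℂ} {d : ℕ} (hP : P ≠ 0)
    (hd : ∀ v s, eval (fun i => v i * s) P = eval v P * s ^ d) (hFG : P = F * G) (hF : constantCoeff F ≠ 0) : IsUnit F := by
  -- On the line s ↦ s v the form P becomes P(v) s^d. If P(v) ≠ 0, its divisor F restricts to a unit
  -- times a power of s, and F(0) ≠ 0 makes this restriction constant. So F - F(0) vanishes wherever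
  -- P does not.
  have key : ∀ v : Fin 3 → ℂ, eval v (P * (F - C (constantCoeff F))) = 0 := by
    intro v
    let φ : MvPolynomial (Fin 3) ℂ →ₐ[ℂ] Polynomial ℂ :=
      aeval fun i => Polynomial.C (v i) * Polynomial.X
    have hφ : ∀ U s, (φ U).eval s = eval (fun i => v i * s) U := by
      intro U s
      rw [← Polynomial.coe_evalRingHom, ← RingHom.coe_coe φ, ← RingHom.comp_apply]
      congr 1
      ext i <;> simp [φ]
    have hφP : φ P = Polynomial.C (eval v P) * Polynomial.X ^ d := by
      apply Polynomial.funext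
      intro s
      rw [hφ, Polynomial.eval_mul, Polynomial.eval_C, Polynomial.eval_pow, Polynomial.eval_X,
        hd]
    by_cases h0 : eval v P = 0
    · rw [map_mul, h0, zero_mul]
    · have hdvd : φ F ∣ Polynomial.X ^ d := by
        have h1 : φ F ∣ Polynomial.C (eval v P) * Polynomial.X ^ d := by
          rw [← hφP, hFG, map_mul]
          exact dvd_mul_right _ _
        exact ((Polynomial.isUnit_C.2 (isUnit_iff_ne_zero.2 h0)).dvd_mul_left).1 h1
      obtain ⟨i, -, hi⟩ := (dvd_prime_pow Polynomial.prime_X d).1 hdvd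
      have hF0 : (φ F).eval 0 = constantCoeff F := by
        rw [hφ, constantCoeff_eq]
        simp [← constantCoeff_eq]
      have hi0 : i = 0 := by
        by_contra hne
        apply hF
        rw [← hF0]
        obtain ⟨c, hc⟩ := hi.symm.dvd
        rw [hc]
        simp [hne]
      rw [hi0, pow_zero, associated_one_iff_isUnit, Polynomial.isUnit_iff] at hi
      obtain ⟨c, -, hc⟩ := hi
      have h1 : eval v F = constantCoeff F := by
        rw [← hF0, ← hc, Polynomial.eval_C, ← Polynomial.eval_C (a := c) (x := 1), hc, hφ]
        simp
      rw [map_mul, map_sub, eval_C, h1, sub_self, mul_zero]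
  have h0 : P * (F - C (constantCoeff F)) = 0 := MvPolynomial.funext fun v => by
    rw [key, map_zero]
  have hFC : F = C (constantCoeff F) := sub_eq_zero.1 ((mul_eq_zero.1 h0).resolve_left hP)
  rw [hFC]
  exact (isUnit_iff_ne_zero.2 hF).map C

theorem eval_poly_mul (P : Conic) (v : Fin 3 → ℂ) (s : ℂ) :
    eval (fun i => v i * s) P.poly = eval v P.poly * s ^ 2 := by
  simp only [poly, map_add, map_mul, map_pow, eval_C, eval_X]
  ring

/-- A common divisor of two binary quadratic forms with nonzero resultant is constant. -/
theorem isUnit_of_dvd_of_quadRes {A B E A' B' E' : ℂ} (hR : quadRes A B E A' B' E' ≠ 0)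
    {F : MvPolynomial (Fin 2) ℂ}
    (h : F ∣ C A * X 0 ^ 2 + C B * X 0 * X 1 + C E * X 1 ^ 2)
    (h' : F ∣ C A' * X 0 ^ 2 + C B' * X 0 * X 1 + C E' * X 1 ^ 2) : IsUnit F := by
  have hu : IsUnit (C (quadRes A B E A' B' E') : MvPolynomial (Fin 2) ℂ) :=
    (isUnit_iff_ne_zero.2 hR).map C
  -- Elimination: the resultant times x³, and likewise times y³, lies in the ideal of the two forms;
  -- the multipliers are cofactors of the Sylvester matrix. As x and y are coprime, F is a unit.
  have h0 : F ∣ X 0 ^ 3 := by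
    apply (hu.dvd_mul_left).1
    have := (h.mul_left ((C (A * E' - A' * E) * C E' - C (B * E' - B' * E) * C B') * X 0
        - C E' * C (B * E' - B' * E) * X 1)).add
      (h'.mul_left ((C (B * E' - B' * E) * C B - C E * C (A * E' - A' * E)) * X 0
        + C E * C (B * E' - B' * E) * X 1))
    convert this using 1
    simp only [quadRes, map_sub, map_mul, map_pow]
    ring
  have h1 : F ∣ X 1 ^ 3 := by
    apply (hu.dvd_mul_left).1
    have := (h.mul_left ((C (A * B' - A' * B) * C B' - C (A * E' - A' * E) * C A') * X 1
        + C A' * C (A * B' - A' * B) * X 0)).add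
      (h'.mul_left ((C A * C (A * E' - A' * E) - C B * C (A * B' - A' * B)) * X 1
        - C A * C (A * B' - A' * B) * X 0))
    convert this using 1
    simp only [quadRes, map_sub, map_mul, map_pow]
    ring
  obtain ⟨i, -, hi⟩ := (dvd_prime_pow (X_prime (R := ℂ) (i := (0 : Fin 2))) 3).1 h0
  rcases Nat.eq_zero_or_pos i with rfl | hpos
  · rwa [pow_zero, associated_one_iff_isUnit] at hi
  · have h2 : (X 0 : MvPolynomial (Fin 2) ℂ) ∣ X 1 ^ 3 :=
      ((dvd_pow_self _ hpos.ne').trans hi.symm.dvd).trans h1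
    have h3 := (X_prime (R := ℂ) (i := (0 : Fin 2))).dvd_of_dvd_pow h2
    rw [X_dvd_X] at h3
    simp at h3

/-- Some line Z = t (x Y - y X) has a nonzero resultant. A common divisor restricts to a unit on it,
hence has nonzero constant term, and a divisor of a nonzero form with nonzero constant term is a
constant. -/
theorem isRelPrime_of_hasOrder {P Q : Conic} {m : ℕ} (h : HasOrder P Q m) :
    IsRelPrime P.poly Q.poly := by
  obtain ⟨-, x, y, hm⟩ := h
  obtain ⟨t, ht⟩ : ∃ t, (lineRes P Q x y).eval t ≠ 0 := by
    by_contra! hcon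
    apply hm
    rw [show lineRes P Q x y = 0 from Polynomial.funext fun t => by simpa using hcon t]
    rfl
  let σ : MvPolynomial (Fin 3) ℂ →ₐ[ℂ] MvPolynomial (Fin 2) ℂ :=
    aeval ![X 0, X 1, C t * (C x * X 1 - C y * X 0)]
  have hσ : ∀ P : Conic, σ P.poly = C ((restrA P x y).eval t) * X 0 ^ 2
      + C ((restrB P x y).eval t) * X 0 * X 1 + C ((restrE P x y).eval t) * X 1 ^ 2 := by
    intro P
    have h2 : (C 2 : MvPolynomial (Fin 2) ℂ) = 2 := map_ofNat C 2
    simp [σ, poly, restrA, restrB, restrE, algHom_C, h2]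
    ring
  have hR : quadRes ((restrA P x y).eval t) ((restrB P x y).eval t) ((restrE P x y).eval t)
      ((restrA Q x y).eval t) ((restrB Q x y).eval t) ((restrE Q x y).eval t) ≠ 0 := by
    convert ht using 1
    simp [lineRes, quadRes]
  intro F hP hQ
  have hu : IsUnit (σ F) := by
    apply isUnit_of_dvd_of_quadRes hR
    · rw [← hσ]
      exact map_dvd σ hP
    · rw [← hσ]
      exact map_dvd σ hQ
  have hF : constantCoeff F ≠ 0 := by
    have h1 := (hu.map (constantCoeff (σ := Fin 2) (R := ℂ))).ne_zero
    have h2 : ∀ U, constantCoeff (σ U) = constantCoeff U := by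
      intro U
      rw [← RingHom.coe_coe σ, ← RingHom.comp_apply]
      congr 1
      ext i
      · simp
      · fin_cases i <;> simp [σ]
    rwa [h2] at h1
  obtain ⟨G, hG⟩ := hP
  obtain ⟨G', hG'⟩ := hQ
  -- One of the conics may be the zero polynomial, but not both, since the resultant is nonzero.
  by_cases hP0 : P.poly = 0
  · exact isUnit_of_dvd_form (fun hQ0 => not_isUnit_zero (isUnit_of_dvd_of_quadRes hR
      (by rw [← hσ, hP0, map_zero]) (by rw [← hσ, hQ0, map_zero]))) (eval_poly_mul Q) hG' hF
  · exact isUnit_of_dvd_form hP0 (eval_poly_mul P) hG hF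

end

section

open Conic

/-! ### Sample systems -/

/-- The system with given coefficients. -/
def systemOf (a00 a10 a01 a20 a11 a02 b00 b10 b01 b20 b11 b02 : ℝ) : QSystem
  | .a00 => a00 | .a10 => a10 | .a01 => a01 | .a20 => a20 | .a11 => a11 | .a02 => a02
  | .b00 => b00 | .b10 => b10 | .b01 => b01 | .b20 => b20 | .b11 => b11 | .b02 => b02

/-- The coefficient of `t ^ n` in `p q' - p' q`, for quadratic polynomials in `t`. -/
def minorCoef (p q p' q' : ℂ × ℂ × ℂ) : ℕ → ℂ
  | 0 => p.1 * q'.1 - p'.1 * q.1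
  | 1 => p.1 * q'.2.1 + p.2.1 * q'.1 - (p'.1 * q.2.1 + p'.2.1 * q.1)
  | 2 => p.1 * q'.2.2 + p.2.1 * q'.2.1 + p.2.2 * q'.1
      - (p'.1 * q.2.2 + p'.2.1 * q.2.1 + p'.2.2 * q.1)
  | 3 => p.2.1 * q'.2.2 + p.2.2 * q'.2.1 - (p'.2.1 * q.2.2 + p'.2.2 * q.2.1)
  | 4 => p.2.2 * q'.2.2 - p'.2.2 * q.2.2
  | _ => 0

theorem minorConv_eq_minorCoef {p q p' q' : ℂ × ℂ × ℂ} {P Q P' Q' : ℕ → ℂ}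
    (hp : P = fun n => if n = 0 then p.1 else if n = 1 then p.2.1 else if n = 2 then p.2.2 else 0)
    (hq : Q = fun n => if n = 0 then q.1 else if n = 1 then q.2.1 else if n = 2 then q.2.2 else 0)
    (hp' : P' = fun n =>
      if n = 0 then p'.1 else if n = 1 then p'.2.1 else if n = 2 then p'.2.2 else 0)
    (hq' : Q' = fun n =>
      if n = 0 then q'.1 else if n = 1 then q'.2.1 else if n = 2 then q'.2.2 else 0)
    {n : ℕ} (hn : n ≤ 4) : minorConv P Q P' Q' n = minorCoef p q p' q' n := by
  subst hp hq hp' hq'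
  interval_cases n <;> simp [minorConv, minorCoef, Finset.Nat.antidiagonal_succ]
  all_goals ring

/-- The coefficients of `restrA`, `restrB` and `restrE`. -/
def restrCoef (P : Conic) (x y : ℂ) : (ℂ × ℂ × ℂ) × (ℂ × ℂ × ℂ) × (ℂ × ℂ × ℂ) :=
  ((P.xx, -y * P.xz, y ^ 2 * P.zz), (P.xy, x * P.xz - y * P.yz, -2 * x * y * P.zz),
    (P.yy, x * P.yz, x ^ 2 * P.zz))

theorem coeff_lineRes (P Q : Conic) (x y : ℂ) {n : ℕ} (hn : n ≤ 4) :
    (lineRes P Q x y).coeff n = ∑ i ∈ Finset.HasAntidiagonal.antidiagonal n,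
      (minorCoef (restrCoef P x y).1 (restrCoef P x y).2.2 (restrCoef Q x y).1
          (restrCoef Q x y).2.2 i.1
        * minorCoef (restrCoef P x y).1 (restrCoef P x y).2.2 (restrCoef Q x y).1
          (restrCoef Q x y).2.2 i.2
      - minorCoef (restrCoef P x y).1 (restrCoef P x y).2.1 (restrCoef Q x y).1
          (restrCoef Q x y).2.1 i.1
        * minorCoef (restrCoef P x y).2.1 (restrCoef P x y).2.2 (restrCoef Q x y).2.1
          (restrCoef Q x y).2.2 i.2) := by
  have hA : ∀ P, (restrA P x y).coeff = _ := fun P => funext (coeff_restrA P x y)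
  have hB : ∀ P, (restrB P x y).coeff = _ := fun P => funext (coeff_restrB P x y)
  have hE : ∀ P, (restrE P x y).coeff = _ := fun P => funext (coeff_restrE P x y)
  rw [lineRes, coeff_quadRes]
  refine Finset.sum_congr rfl fun i hi => ?_
  have hi' := Finset.HasAntidiagonal.mem_antidiagonal.1 hi
  have h1 : i.1 ≤ 4 := by omega
  have h2 : i.2 ≤ 4 := by omega
  rw [← minorConv_eq_minorCoef (hA P) (hE P) (hA Q) (hE Q) h1,
    ← minorConv_eq_minorCoef (hA P) (hE P) (hA Q) (hE Q) h2,
    ← minorConv_eq_minorCoef (hA P) (hB P) (hA Q) (hB Q) h1,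
    ← minorConv_eq_minorCoef (hB P) (hE P) (hB Q) (hE Q) h2]

/-- The sample systems are such that nonvanishing can be tested at x = y = 1 alone; the criteria for
L and K₁ use the same point. -/
theorem firstMu_of {S : QSystem} {m : ℕ}
    (h : ∀ n < m, ∀ x y, (lineRes (conicP S) (conicQ S) x y).coeff n = 0)
    (h' : (lineRes (conicP S) (conicQ S) 1 1).coeff m ≠ 0) : FirstMu S m :=
  (firstMu_iff S m).2 ⟨h, 1, 1, h'⟩

theorem vanishes_L_of {S : QSystem} (h : ∀ x y, LVal (conicP S) (conicQ S) x y = 0) :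
    Requires (some true) (Vanishes S L) := by
  simpa [Requires, vanishes_L_iff] using h

theorem not_vanishes_L_of {S : QSystem} (h : LVal (conicP S) (conicQ S) 1 1 ≠ 0) :
    Requires (some false) (Vanishes S L) := by
  have : ¬ Vanishes S L := fun hL => h ((vanishes_L_iff S).1 hL 1 1)
  simpa [Requires] using this

theorem vanishes_K1_of {S : QSystem} (h : ∀ x y, (conicP S).lin x y * (conicQ S).quad x y
    - (conicP S).quad x y * (conicQ S).lin x y = 0) :
    Requires (some true) (Vanishes S K1) := by
  simpa [Requires, vanishes_iff, valueC_K1] using h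

theorem not_vanishes_K1_of {S : QSystem} (h : (conicP S).lin 1 1 * (conicQ S).quad 1 1
    - (conicP S).quad 1 1 * (conicQ S).lin 1 1 ≠ 0) :
    Requires (some false) (Vanishes S K1) := by
  have : ¬ Vanishes S K1 := fun hK => h (by rw [← valueC_K1, (vanishes_iff S K1).1 hK])
  simpa [Requires] using this

theorem requires_none (p : Prop) : Requires none p := by
  simp [Requires]

/-- A system that fits a pattern and for which the line at infinity is not a component of
`C = 0`. -/
def IsSample (S : QSystem)
    (c : ℕ × ℕ × Option Bool × Option Bool × Option Bool × Option Bool) : Prop :=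
  Fits S c ∧ ¬ (S .b20 = 0 ∧ S .a20 = 2 * S .b11 ∧ S .b02 = 2 * S .a11 ∧ S .a02 = 0)

/-- Relative primality follows from μ_m ≠ 0, `exists_row` then puts the system in some class, and
the exclusion of patterns identifies that class as the i-th. -/
theorem IsSample.nonempty {S : QSystem} (i : Fin 36) (h : IsSample S (pattern i)) :
    (sigmaClass i).Nonempty := by
  have hS : IsEssentiallyQuadratic S := by
    refine ⟨?_, (not_X_dvd_curveC_iff S).2 h.2⟩
    rw [curveP_eq, curveQ_eq]
    exact isRelPrime_of_hasOrder ((firstMu_iff S _).1 h.1.1)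
  obtain ⟨j, hj, hj'⟩ := exists_row hS
  rw [eq_of_fits h.1 (fits_of_cond j hj)]
  exact ⟨S, hj'⟩

end

/-! ### Explicit systems for the thirty-six rows, in the order of `pattern`. -/

section

open Conic

set_option maxHeartbeats 2000000 in
theorem isSample_systemOf :
    IsSample (systemOf 0 0 0 1 0 0 0 0 0 0 0 1) (0, 1, none, none, none, none) ∧
    IsSample (systemOf 0 0 0 0 0 1 0 0 0 1 0 0) (0, 2, none, none, none, none) ∧
    IsSample (systemOf 0 0 0 1 1 0 0 0 0 0 0 2) (0, 3, none, none, none, none) ∧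
    IsSample (systemOf 0 0 0 2 0 1 0 0 0 0 1 0) (0, 4, none, none, none, none) ∧
    IsSample (systemOf 0 1 0 0 0 1 0 0 0 0 1 0) (1, 1, none, none, none, none) ∧
    IsSample (systemOf 0 1 0 0 0 1 0 0 0 0 (-1) 0) (1, 2, none, none, none, none) ∧
    IsSample (systemOf 0 1 0 0 2 (-1) 0 0 0 0 2 0) (1, 3, some false, none, none, none) ∧
    IsSample (systemOf 0 0 1 1 0 0 0 0 0 0 1 0) (1, 3, some true, none, none, none) ∧
    IsSample (systemOf 0 0 1 2 0 0 0 0 0 1 1 0) (1, 4, none, none, none, none) ∧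
    IsSample (systemOf 1 0 0 0 0 1 0 0 0 0 1 0) (2, 1, some false, none, none, none) ∧
    IsSample (systemOf 0 1 0 0 0 0 0 0 0 (-1) 0 2) (2, 1, some true, none, none, none) ∧
    IsSample (systemOf 1 0 0 0 0 1 0 0 0 0 (-1) 0) (2, 2, some false, none, none, none) ∧
    IsSample (systemOf 0 1 0 0 0 0 0 0 0 1 0 1) (2, 2, some true, none, none, none) ∧
    IsSample (systemOf 1 0 0 2 1 0 0 0 0 0 1 0) (2, 3, some false, none, none, none) ∧
    IsSample (systemOf 0 1 1 0 0 0 0 0 0 0 1 0) (2, 3, some true, some true, none, none) ∧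
    IsSample (systemOf 0 1 0 0 0 0 0 0 0 0 0 1) (2, 3, some true, some false, none, none) ∧
    IsSample (systemOf 0 0 1 0 0 0 0 0 0 1 0 0) (2, 4, none, none, none, none) ∧
    IsSample (systemOf 1 0 0 0 1 0 0 1 0 1 0 0) (3, 1, some false, none, none, none) ∧
    IsSample (systemOf 1 1 0 0 1 0 0 0 0 0 1 0) (3, 1, some true, none, none, none) ∧
    IsSample (systemOf 1 0 0 0 1 0 0 1 0 (-1) 0 0) (3, 2, none, none, none, none) ∧
    IsSample (systemOf 1 1 0 2 1 0 1 0 0 0 1 0) (3, 3, some false, none, none, none) ∧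
    IsSample (systemOf 1 0 1 0 0 0 0 0 0 0 1 0) (3, 3, some true, some true, some false, none) ∧
    IsSample (systemOf 1 1 0 0 0 0 0 0 0 0 1 0) (3, 3, some true, some true, some true, none) ∧
    IsSample (systemOf 0 0 1 1 0 0 0 1 0 0 0 0) (3, 3, some true, some false, none, none) ∧
    IsSample (systemOf 0 1 0 0 0 1 0 0 1 0 0 0) (3, 4, none, none, none, none) ∧
    IsSample (systemOf 1 0 0 0 1 0 0 0 0 1 0 0) (4, 1, some false, none, none, none) ∧
    IsSample (systemOf 1 0 0 1 1 0 0 1 0 0 0 0) (4, 1, some true, none, none, some false) ∧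
    IsSample (systemOf 1 0 0 0 1 0 0 0 0 0 1 0) (4, 1, some true, none, none, some true) ∧
    IsSample (systemOf 1 0 0 0 1 0 0 0 0 (-1) 0 0) (4, 2, some false, none, none, none) ∧
    IsSample (systemOf 1 0 0 0 0 0 0 0 0 1 0 1) (4, 2, some true, none, none, none) ∧
    IsSample (systemOf 1 0 0 2 1 0 1 0 0 0 1 0) (4, 3, some false, none, none, none) ∧
    IsSample (systemOf 1 0 0 0 1 0 0 1 0 0 0 0) (4, 3, some true, some true, some false, none) ∧
    IsSample (systemOf 1 0 0 0 0 0 0 0 0 0 1 0) (4, 3, some true, some true, some true, some true) ∧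
    IsSample (systemOf 1 0 0 0 1 0 0 0 1 0 0 0) (4, 3, some true, some true, some true, some false) ∧
    IsSample (systemOf 1 0 0 0 0 0 0 0 0 0 0 1) (4, 3, some true, some false, none, none) ∧
    IsSample (systemOf 1 0 0 0 0 0 0 0 0 1 0 0) (4, 4, none, none, none, none) := by
  refine ⟨?_, ?_, ?_, ?_, ?_, ?_, ?_, ?_, ?_, ?_, ?_, ?_, ?_, ?_, ?_, ?_, ?_, ?_, ?_, ?_, ?_, ?_, ?_,
    ?_, ?_, ?_, ?_, ?_, ?_, ?_, ?_, ?_, ?_, ?_, ?_, ?_⟩ <;>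
  (refine ⟨⟨firstMu_of (fun n hn x y => ?_) ?_, ?_, ?_, ?_, ?_, ?_⟩, by simp [systemOf]⟩
   · first
     | (have hn' : n < 1 := hn
        interval_cases n
        simp [coeff_lineRes, minorCoef, restrCoef, conicP, conicQ, systemOf])
     | (dsimp only at hn
        interval_cases n <;>
          simp [coeff_lineRes, minorCoef, restrCoef, conicP, conicQ, systemOf,
            Finset.Nat.antidiagonal_succ])
   · simp [coeff_lineRes, minorCoef, restrCoef, conicP, conicQ, systemOf,
            Finset.Nat.antidiagonal_succ] <;> norm_num
   · simp [CondType, CondI1, CondI2, CondI3, CondI4, value_eta, vanishes_M_iff, hess0, hess1, hess2,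
       conicP, conicQ, systemOf] <;> norm_num
   · simp [Requires, vanishes_kappa_iff, kappaVal, hess0, hess1, hess2,
       conicP, conicQ, systemOf]
   · first
     | exact requires_none _
     | (apply vanishes_L_of; intro x y; simp [LVal, hess0, hess1, hess2, conicP, conicQ, systemOf]
        try ring)
     | (apply not_vanishes_L_of; simp [LVal, hess0, hess1, hess2, conicP, conicQ, systemOf]
        try norm_num)
   · simp [Requires, vanishes_kappa1_iff, kappa1Val, hess0, hess1, hess2,
       conicP, conicQ, systemOf]
   · first
     | exact requires_none _
     | (apply vanishes_K1_of; intro x y; simp [lin, quad, conicP, conicQ, systemOf]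
        try ring)
     | (apply not_vanishes_K1_of; simp [lin, quad, conicP, conicQ, systemOf]
        try norm_num))

theorem sigmaClass_nonempty (i : Fin 36) : (sigmaClass i).Nonempty := by
  obtain ⟨h0, h1, h2, h3, h4, h5, h6, h7, h8, h9, h10, h11, h12, h13, h14, h15, h16, h17, h18, h19,
    h20, h21, h22, h23, h24, h25, h26, h27, h28, h29, h30, h31, h32, h33, h34, h35⟩ :=
    isSample_systemOf
  fin_cases i
  exacts [h0.nonempty 0, h1.nonempty 1, h2.nonempty 2, h3.nonempty 3, h4.nonempty 4, h5.nonempty 5,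
    h6.nonempty 6, h7.nonempty 7, h8.nonempty 8, h9.nonempty 9, h10.nonempty 10,
    h11.nonempty 11, h12.nonempty 12, h13.nonempty 13, h14.nonempty 14, h15.nonempty 15,
    h16.nonempty 16, h17.nonempty 17, h18.nonempty 18, h19.nonempty 19, h20.nonempty 20,
    h21.nonempty 21, h22.nonempty 22, h23.nonempty 23, h24.nonempty 24, h25.nonempty 25,
    h26.nonempty 26, h27.nonempty 27, h28.nonempty 28, h29.nonempty 29, h30.nonempty 30,
    h31.nonempty 31, h32.nonempty 32, h33.nonempty 33, h34.nonempty 34, h35.nonempty 35]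

end

end QuadInf

end

open QuadInf in
/-- The essentially quadratic systems are partitioned by `(Δ_S, M_C, D_S)` into exactly the
thirty-six classes of the table, none of which is empty, and each class is characterized among
them by the conditions on the comitants in the corresponding row. -/
theorem theorem1 :
    (∀ S : QSystem, IsEssentiallyQuadratic S → ∃! i : Fin 36, S ∈ sigmaClass i) ∧
    (∀ i : Fin 36, (sigmaClass i).Nonempty) ∧
    (∀ S : QSystem, IsEssentiallyQuadratic S →
      ∀ i : Fin 36, S ∈ sigmaClass i ↔ (table i).cond S) := by
  exact ⟨fun _ hS => existsUnique_sigmaClass hS, sigmaClass_nonempty,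
    fun _ hS i => mem_sigmaClass_iff hS i⟩
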